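/- Let $r\ge 1$, $\rho>0$, and for $n\ge 1$ and $\sigma>0$ put $D_\sigma^n=\{\theta\in\mathbb C^n: |\mathrm{Im}\,\theta_j|\le\sigma,\ j=1,\dots,n\}$. A function $f:\mathbb R\to\mathbb R$ is called analytic quasi-periodic on $D_\sigma^n$ with frequencies $\nu=(\nu_1,\dots,\nu_n)\in\mathbb R^n$ if $f(t)=F(\nu_1t,\dots,\nu_nt)$ for all $t\in\mathbb R$, where $F$ is analytic on $D_\sigma^n$ and $2\pi$-periodic in each variable. Let $a:\mathbb R\to\mathbb R$ be analytic quasi-periodic on $D_\rho^r$ with frequencies $\omega=(\omega_1,\dots,\omega_r)$, with average $\bar a=\lim_{T\to\infty}\frac1{2T}\int_{-T}^{T}a(t)\,dt>0$. Suppose that, for some $\alpha>0$ and $\tau>r-1$, $$|\langle k,\omega\rangle|\ge\frac{\alpha}{|k|^{\tau}}\qquad\text{for all }k\in\mathbb Z^r\setminus\{0\},$$ where $|k|=|k_1|+\dots+|k_r|$. Then for most sufficiently small $\varepsilon>0$ all solutions of $\ddot x+\varepsilon a(t)x=0$ are quasi-periodic with frequencies $(\omega_1,\dots,\omega_r,\sqrt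 b)$, where $b=\bar a\varepsilon+O(\varepsilon^2)$. Precisely: there are a measurable set $E\subset(0,\infty)$ with $$\lim_{\varepsilon_0\to0^+}\frac{\mathrm{meas}\big((0,\varepsilon_0)\setminus E\big)}{\varepsilon_0}=0,$$ a function $b:E\to(0,\infty)$ and a constant $C$ such that for every $\varepsilon\in E$: 1. $|b(\varepsilon)-\bar a\,\varepsilon|\le C\varepsilon^2$; 2. for all $k\in\mathbb Z^r\setminus\{0\}$ and $l\in\mathbb Z$, $$\big|\langle k,\omega\rangle+l\sqrt{b(\varepsilon)}\big|\ge\frac{\alpha/2}{(|k|+|l|)^{5\tau+4}},$$ so that, as $b(\varepsilon)>0$, the vector $(\omega_1,\dots,\omega_r,\sqrt{b(\varepsilon)})$ is Diophantine; 3. every solution $x:\mathbb R\to\mathbb R$ of $\ddot x+\varepsilon a(t)x=0$ is analytic quasi-periodic, on $D_{\rho'}^{r+1}$ for some $\rho'>0$, with frequencies $(\omega_1,\dots,\omega_r,\sqrt{b(\varepsilon)})$. -/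

import Mathlib

open Filter Topology MeasureTheory

namespace QPHill

/-- The closed complex strip `D_ρ = {θ ∈ ℂⁿ : |Im θ_j| ≤ ρ for all j}`. -/
def strip (n : ℕ) (ρ : ℝ) : Set (Fin n → ℂ) := {θ | ∀ j, |(θ j).im| ≤ ρ}

/-- `f` is analytic quasi-periodic on `D_ρ` with frequencies `ω = (ω₁, …, ωₙ)`:
`f t = F (ω₁ t, …, ωₙ t)` where `F` is analytic on `D_ρ` and `2π`-periodic in each variable. -/
def IsAnalyticQuasiPeriodicOn {n : ℕ} (ρ : ℝ) (ω : Fin n → ℝ) (f : ℝ → ℝ) : Prop :=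
  ∃ F : (Fin n → ℂ) → ℂ,
    AnalyticOnNhd ℂ F (strip n ρ) ∧
    (∀ θ ∈ strip n ρ, ∀ j, F (θ + Pi.single j (2 * (Real.pi : ℂ))) = F θ) ∧
    ∀ t : ℝ, (f t : ℂ) = F (fun j => ((ω j * t : ℝ) : ℂ))

/-- `m` is the average `lim_{T → ∞} (1 / 2T) ∫_{-T}^{T} f(t) dt` of `f`. -/
def IsAverage (f : ℝ → ℝ) (m : ℝ) : Prop :=
  Tendsto (fun T : ℝ => (1 / (2 * T)) * ∫ t in (-T)..T, f t) atTop (𝓝 m)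

/-- The norm `|k| = |k₁| + ⋯ + |kₙ|` of an integer vector, as a real number. -/
def l1 {n : ℕ} (k : Fin n → ℤ) : ℝ := ∑ j, |(k j : ℝ)|

/-- The pairing `⟨k, ω⟩ = k₁ ω₁ + ⋯ + kₙ ωₙ`. -/
def pairing {n : ℕ} (k : Fin n → ℤ) (ω : Fin n → ℝ) : ℝ := ∑ j, (k j : ℝ) * ω j

/-- The Diophantine condition `|⟨k, ω⟩| ≥ α / |k|^τ` for all nonzero integer vectors `k`. -/
def IsDiophantine {n : ℕ} (ω : Fin n → ℝ) (α τ : ℝ) : Prop :=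
  ∀ k : Fin n → ℤ, k ≠ 0 → α / l1 k ^ τ ≤ |pairing k ω|

/-- `x : ℝ → ℝ` solves the Hill equation `x'' + ε a(t) x = 0` on the whole line. -/
def IsHillSolution (a : ℝ → ℝ) (ε : ℝ) (x : ℝ → ℝ) : Prop :=
  ∃ v : ℝ → ℝ, (∀ t, HasDerivAt x (v t) t) ∧ ∀ t, HasDerivAt v (-(ε * a t * x t)) t

/-- `E` is a measurable set of positive parameters that contains most small `ε > 0`: the relative
Lebesgue measure of `(0, ε₀) \ E` in `(0, ε₀)` tends to `0` as `ε₀ → 0+`. -/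
def ContainsMostSmall (E : Set ℝ) : Prop :=
  MeasurableSet E ∧ E ⊆ Set.Ioi 0 ∧
    Tendsto (fun ε₀ : ℝ => volume (Set.Ioo 0 ε₀ \ E) / ENNReal.ofReal ε₀) (𝓝[>] 0) (𝓝 0)

end QPHill

/-!
# Quasi-periodic solutions of the Hill equation with a small quasi-periodic potential

Write the solutions as Floquet solutions `e^{i λ t} U(t)`, with `U` quasi-periodic of frequency `ω`.
Such a function solves `x'' + ε a x = 0` if and only if
`U'' + 2 i λ U' - λ² U + ε a U = 0`. The exponent `λ` is prescribed, and `U` and the parameter `ε`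
are the unknowns, so that the small divisors `⟨k, ω⟩` and `⟨k, ω⟩ + 2 λ` stay fixed throughout the
construction.

*Newton iteration.* Suppose that `U` solves the equation up to an error `R`. For a new approximation
`U (1 + η)` with parameter `ε + δ` the linearized equation, multiplied by `U`, is
`(d/dt + 2 i λ) (U² η') = -(U R + δ a U²)`. It is solved exactly by inverting two first-order
operators with constant coefficients, with `δ` chosen so that `η'` has mean zero, and what is left
over is `η (R + δ a U)`, which is quadratic in `R` (`ApproxFloquet.step`). The division by `λ` that
the zero mode seems to demand cancels: the estimates are uniform in `λ`. The unknowns are families of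
Fourier coefficients that are summable with an exponential weight (`SumBound`), and each step gives
up a part of the width of the strip. Started at `U = 1`, `ε = λ² / ā`, the iteration converges for
every small `λ` for which the divisors have a polynomial lower bound (`exists_floquet`).

*Reality and regularity of the parameter.* The mean over time of the derivative of the Wronskian of
one Floquet solution and the conjugate of another gives
`ε₁ - conj ε₂ = (λ₁² - λ₂²) / ā · (1 + small)` (`IsFloquet.param_sub`). For equal exponents this says
that `ε` is real. For different ones it says that `m = λ² ↦ ε` is a Lipschitz perturbation of
`m ↦ m / ā` on the set of admissible `m`. It therefore extends to a bi-Lipschitz map of an interval,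
which takes sets of density zero at `0` to such sets (`containsMostSmall_image`).

*Measure.* The set of `m = λ²` for which `(ω, λ)` satisfies the Diophantine condition of the theorem
is closed, and its complement has density zero at `0`: since `ω` is Diophantine, only resonances of
high order reach a small interval of exponents, and their total relative measure is the tail of a
convergent series (`exists_density_bound`). With `b = λ²`, the set `E` of the theorem consists of the
parameters `ε` that belong to such `m`.

*Solutions.* For real `ε` the Floquet solution and its conjugate are independent, so that every
solution of the equation is a combination of them (`IsFloquet.isAnalyticQuasiPeriodicOn`). The passage
between analytic functions on a strip and weighted sums of Fourier coefficients is
`exists_fourier_series` in one direction, by moving the contour in one variable at a time, and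
`analyticOnNhd_fourierSeries` in the other.
-/

namespace QPHill

section

variable {r : ℕ}

/-! ### Weighted sums of Fourier coefficients -/

lemma l1_nonneg (k : Fin r → ℤ) : 0 ≤ l1 k := Finset.sum_nonneg fun _ _ => abs_nonneg _

lemma l1_zero : l1 (0 : Fin r → ℤ) = 0 := by simp [l1]

lemma l1_add_le (j k : Fin r → ℤ) : l1 (j + k) ≤ l1 j + l1 k := by
  unfold l1
  rw [← Finset.sum_add_distrib]
  refine Finset.sum_le_sum fun i _ => ?_
  push_cast [Pi.add_apply]
  exact abs_add_le _ _

lemma l1_neg (k : Fin r → ℤ) : l1 (-k) = l1 k := by simp [l1]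

lemma one_le_l1 {k : Fin r → ℤ} (hk : k ≠ 0) : 1 ≤ l1 k := by
  obtain ⟨j, hj⟩ := Function.ne_iff.1 hk
  have h1 : (1 : ℝ) ≤ |(k j : ℝ)| := by exact_mod_cast Int.one_le_abs hj
  exact h1.trans (Finset.single_le_sum (f := fun j => |(k j : ℝ)|)
    (fun _ _ => abs_nonneg _) (Finset.mem_univ j))

lemma pairing_add (j k : Fin r → ℤ) (ω : Fin r → ℝ) :
    pairing (j + k) ω = pairing j ω + pairing k ω := by
  simp [pairing, add_mul, Finset.sum_add_distrib]

lemma pairing_zero (ω : Fin r → ℝ) : pairing 0 ω = 0 := by simp [pairing]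

lemma pairing_neg (k : Fin r → ℤ) (ω : Fin r → ℝ) : pairing (-k) ω = -pairing k ω := by
  simp [pairing]

/-- The family `c` of Fourier coefficients satisfies `∑ ‖c k‖ e^{s |k|} ≤ M`. The bound is imposed
on all finite partial sums, so that summability is part of the definition. -/
def SumBound (s M : ℝ) (c : (Fin r → ℤ) → ℂ) : Prop :=
  ∀ S : Finset (Fin r → ℤ), ∑ k ∈ S, ‖c k‖ * Real.exp (s * l1 k) ≤ M

namespace SumBound

variable {s s' M M' : ℝ} {c d : (Fin r → ℤ) → ℂ}

lemma nonneg (h : SumBound s M c) : 0 ≤ M := by simpa using h ∅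

lemma mono (h : SumBound s M c) (hM : M ≤ M') : SumBound s M' c := fun S => (h S).trans hM

lemma mono_width (h : SumBound s M c) (hs : s' ≤ s) : SumBound s' M c := fun S =>
  (Finset.sum_le_sum fun k _ => by
    have := l1_nonneg k
    gcongr).trans (h S)

lemma of_norm_le (h : SumBound s M c) {A : ℝ} (hA : 0 ≤ A) (hd : ∀ k, ‖d k‖ ≤ A * ‖c k‖) :
    SumBound s (A * M) d := fun S => by
  calc ∑ k ∈ S, ‖d k‖ * Real.exp (s * l1 k)
      ≤ ∑ k ∈ S, A * (‖c k‖ * Real.exp (s * l1 k)) := Finset.sum_le_sum fun k _ => by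
        rw [← mul_assoc]
        gcongr
        exact hd k
    _ ≤ A * M := by
        rw [← Finset.mul_sum]
        exact mul_le_mul_of_nonneg_left (h S) hA

lemma of_norm_le' (h : SumBound s M c) (hd : ∀ k, ‖d k‖ ≤ ‖c k‖) : SumBound s M d := by
  simpa using h.of_norm_le zero_le_one (d := d) (by simpa using hd)

lemma add (hc : SumBound s M c) (hd : SumBound s M' d) : SumBound s (M + M') (c + d) := fun S => by
  calc ∑ k ∈ S, ‖(c + d) k‖ * Real.exp (s * l1 k)
      ≤ ∑ k ∈ S, (‖c k‖ * Real.exp (s * l1 k) + ‖d k‖ * Real.exp (s * l1 k)) :=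
        Finset.sum_le_sum fun k _ => by
          rw [← add_mul]
          gcongr
          exact norm_add_le _ _
    _ ≤ M + M' := by
        rw [Finset.sum_add_distrib]
        exact add_le_add (hc S) (hd S)

lemma smul (hc : SumBound s M c) (z : ℂ) : SumBound s (‖z‖ * M) (z • c) :=
  hc.of_norm_le (norm_nonneg z) fun k => by simp

lemma neg (hc : SumBound s M c) : SumBound s M (-c) := hc.of_norm_le' fun k => by simp

lemma sub (hc : SumBound s M c) (hd : SumBound s M' d) : SumBound s (M + M') (c - d) := by
  simpa [sub_eq_add_neg] using hc.add hd.neg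

lemma summable (h : SumBound s M c) : Summable fun k => ‖c k‖ * Real.exp (s * l1 k) :=
  summable_of_sum_le (fun _ => by positivity) h

lemma tsum_le (h : SumBound s M c) : ∑' k, ‖c k‖ * Real.exp (s * l1 k) ≤ M :=
  Real.tsum_le_of_sum_le (fun _ => by positivity) h

lemma summable_norm (h : SumBound 0 M c) : Summable fun k => ‖c k‖ := by
  simpa using h.summable

lemma tsum_norm_le (h : SumBound 0 M c) : ∑' k, ‖c k‖ ≤ M := by
  simpa using h.tsum_le

lemma term_le (h : SumBound s M c) (k : Fin r → ℤ) : ‖c k‖ * Real.exp (s * l1 k) ≤ M := by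
  simpa using h {k}

lemma norm_apply_le (h : SumBound 0 M c) (k : Fin r → ℤ) : ‖c k‖ ≤ M := by
  simpa using h.term_le k

lemma of_tendsto {u : ℕ → (Fin r → ℤ) → ℂ} (hu : ∀ᶠ n in atTop, SumBound s M (u n))
    (hc : ∀ k, Tendsto (fun n => u n k) atTop (𝓝 (c k))) : SumBound s M c := fun S =>
  le_of_tendsto (tendsto_finsetSum S fun k _ => (hc k).norm.mul_const _)
    (hu.mono fun _ h => h S)

end SumBound

/-- The coefficients of the constant function `1`. -/
def oneCoeff : (Fin r → ℤ) → ℂ := Pi.single 0 1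

lemma sumBound_oneCoeff (s : ℝ) : SumBound s 1 (oneCoeff : (Fin r → ℤ) → ℂ) := fun S => by
  classical
  calc ∑ k ∈ S, ‖(oneCoeff : (Fin r → ℤ) → ℂ) k‖ * Real.exp (s * l1 k)
      ≤ ∑ k ∈ S, (if k = 0 then (1 : ℝ) else 0) := Finset.sum_le_sum fun k _ => by
        by_cases hk : k = 0
        · subst hk; simp [oneCoeff, l1_zero]
        · simp [oneCoeff, hk]
    _ ≤ 1 := by
        rw [Finset.sum_ite_eq' S 0]
        split_ifs <;> norm_num

/-- The convolution of two families of coefficients: the coefficients of the product. -/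
noncomputable def conv (c d : (Fin r → ℤ) → ℂ) : (Fin r → ℤ) → ℂ := fun k => ∑' j, c j * d (k - j)

lemma SumBound.conv {s M M' : ℝ} {c d : (Fin r → ℤ) → ℂ} (hs : 0 ≤ s) (hc : SumBound s M c)
    (hd : SumBound s M' d) : SumBound s (M * M') (conv c d) := fun S => by
  classical
  set w : (Fin r → ℤ) → ℝ := fun k => Real.exp (s * l1 k) with hw
  have hw1 : ∀ j k, w k ≤ w j * w (k - j) := fun j k => by
    rw [hw]
    simp only
    rw [← Real.exp_add, ← mul_add]
    have := l1_add_le j (k - j)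
    rw [add_sub_cancel] at this
    gcongr
  have hcs := hc.summable
  have hsum : ∀ k, Summable fun j => (‖c j‖ * w j) * (‖d (k - j)‖ * w (k - j)) := fun k =>
    Summable.of_nonneg_of_le (fun j => by positivity)
      (fun j => mul_le_mul_of_nonneg_left (hd.term_le (k - j)) (by positivity)) (hcs.mul_right M')
  have hterm : ∀ k, ‖QPHill.conv c d k‖ * w k ≤ ∑' j, (‖c j‖ * w j) * (‖d (k - j)‖ * w (k - j)) := by
    intro k
    have h1 : ∀ j, ‖c j * d (k - j)‖ * w k ≤ (‖c j‖ * w j) * (‖d (k - j)‖ * w (k - j)) := fun j => by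
      rw [norm_mul]
      calc ‖c j‖ * ‖d (k - j)‖ * w k ≤ ‖c j‖ * ‖d (k - j)‖ * (w j * w (k - j)) := by
            gcongr; exact hw1 j k
        _ = _ := by ring
    have h2 : Summable fun j => ‖c j * d (k - j)‖ * w k :=
      Summable.of_nonneg_of_le (fun j => by positivity) h1 (hsum k)
    have hwk : w k ≠ 0 := (Real.exp_pos _).ne'
    have h3 : Summable fun j => ‖c j * d (k - j)‖ := (summable_mul_right_iff hwk).1 h2
    calc ‖QPHill.conv c d k‖ * w k ≤ (∑' j, ‖c j * d (k - j)‖) * w k := by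
          gcongr
          exact norm_tsum_le_tsum_norm h3
      _ = ∑' j, ‖c j * d (k - j)‖ * w k := tsum_mul_right.symm
      _ ≤ _ := h2.tsum_le_tsum h1 (hsum k)
  calc ∑ k ∈ S, ‖QPHill.conv c d k‖ * w k
      ≤ ∑ k ∈ S, ∑' j, (‖c j‖ * w j) * (‖d (k - j)‖ * w (k - j)) :=
        Finset.sum_le_sum fun k _ => hterm k
    _ = ∑' j, ∑ k ∈ S, (‖c j‖ * w j) * (‖d (k - j)‖ * w (k - j)) :=
        (Summable.tsum_finsetSum fun k _ => hsum k).symm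
    _ ≤ ∑' j, (‖c j‖ * w j) * M' := by
        refine Summable.tsum_le_tsum (fun j => ?_) (summable_sum fun k _ => hsum k)
          (hcs.mul_right M')
        rw [← Finset.mul_sum]
        refine mul_le_mul_of_nonneg_left ?_ (by positivity)
        have := hd (S.map (Equiv.subRight j).toEmbedding)
        simpa using this
    _ ≤ M * M' := by
        rw [tsum_mul_right]
        exact mul_le_mul_of_nonneg_right hc.tsum_le hd.nonneg

/-! ### Fourier multipliers of polynomial growth -/

/-- A multiplier `m` of polynomial growth costs a power of the width `σ` that is given up. -/
lemma SumBound.multiplier {s σ M B : ℝ} {p : ℕ} {c m : (Fin r → ℤ) → ℂ} (hc : SumBound s M c)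
    (hσ : 0 < σ) (hσ1 : σ ≤ 1) (hB : 0 ≤ B) (hm : ∀ k, ‖m k‖ ≤ B * (l1 k + 2) ^ p) :
    SumBound (s - σ) (B * (p.factorial * Real.exp 2) / σ ^ p * M) (fun k => m k * c k) := fun S => by
  have key : ∀ k : Fin r → ℤ, ‖m k * c k‖ * Real.exp ((s - σ) * l1 k) ≤
      (B * (p.factorial * Real.exp 2) / σ ^ p) * (‖c k‖ * Real.exp (s * l1 k)) := fun k => by
    have h0 := l1_nonneg k
    have h1 := Real.pow_div_factorial_le_exp (σ * (l1 k + 2)) (by positivity) p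
    have h2 : Real.exp (σ * (l1 k + 2)) ≤ Real.exp 2 * Real.exp (σ * l1 k) := by
      rw [← Real.exp_add]
      apply Real.exp_le_exp.2
      nlinarith
    have h3 : (l1 k + 2) ^ p ≤ (p.factorial * Real.exp 2) / σ ^ p * Real.exp (σ * l1 k) := by
      have hf : (0 : ℝ) < p.factorial := by positivity
      rw [div_le_iff₀ hf, mul_pow] at h1
      rw [div_mul_eq_mul_div, le_div_iff₀ (by positivity)]
      nlinarith
    have h4 : Real.exp (s * l1 k) = Real.exp (σ * l1 k) * Real.exp ((s - σ) * l1 k) := by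
      rw [← Real.exp_add]
      ring_nf
    rw [norm_mul, h4]
    calc ‖m k‖ * ‖c k‖ * Real.exp ((s - σ) * l1 k)
        ≤ (B * ((p.factorial * Real.exp 2) / σ ^ p * Real.exp (σ * l1 k))) * ‖c k‖ *
            Real.exp ((s - σ) * l1 k) := by
          gcongr
          exact (hm k).trans (mul_le_mul_of_nonneg_left h3 hB)
      _ = _ := by ring
  calc _ ≤ ∑ k ∈ S, (B * (p.factorial * Real.exp 2) / σ ^ p) * (‖c k‖ * Real.exp (s * l1 k)) :=
        Finset.sum_le_sum fun k _ => key k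
    _ ≤ _ := by
        rw [← Finset.mul_sum]
        exact mul_le_mul_of_nonneg_left (hc S) (by positivity)

/-! ### Quasi-periodic functions of time -/

/-- The quasi-periodic function `t ↦ ∑ c k e^{i ⟨k, ω⟩ t}` with coefficients `c`. -/
noncomputable def ev (ω : Fin r → ℝ) (c : (Fin r → ℤ) → ℂ) (t : ℝ) : ℂ :=
  ∑' k, c k * Complex.exp (((pairing k ω * t : ℝ) : ℂ) * Complex.I)

/-- The coefficients of the derivative of `ev ω c`. -/
noncomputable def dcoeff (ω : Fin r → ℝ) (c : (Fin r → ℤ) → ℂ) : (Fin r → ℤ) → ℂ :=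
  fun k => ((pairing k ω : ℝ) * Complex.I) * c k

variable {ω : Fin r → ℝ} {c d : (Fin r → ℤ) → ℂ} {s M M' : ℝ}

lemma SumBound.summable_ev (hc : SumBound 0 M c) (t : ℝ) :
    Summable fun k => c k * Complex.exp (((pairing k ω * t : ℝ) : ℂ) * Complex.I) :=
  Summable.of_norm (by
    simpa only [norm_mul, Complex.norm_exp_ofReal_mul_I, mul_one] using hc.summable_norm)

lemma SumBound.norm_ev_le (hc : SumBound 0 M c) (t : ℝ) : ‖ev ω c t‖ ≤ M := by
  refine le_trans (norm_tsum_le_tsum_norm ?_) ?_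
  · exact (hc.summable_ev t).norm
  · simpa only [norm_mul, Complex.norm_exp_ofReal_mul_I, mul_one] using hc.tsum_norm_le

lemma ev_add (hc : SumBound 0 M c) (hd : SumBound 0 M' d) (t : ℝ) :
    ev ω (c + d) t = ev ω c t + ev ω d t := by
  unfold ev
  rw [← (hc.summable_ev t).tsum_add (hd.summable_ev t)]
  simp [add_mul]

lemma ev_smul (z : ℂ) (t : ℝ) : ev ω (z • c) t = z * ev ω c t := by
  unfold ev
  rw [← tsum_mul_left]
  simp [mul_assoc]

lemma ev_neg (t : ℝ) : ev ω (-c) t = -ev ω c t := by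
  simpa using ev_smul (ω := ω) (c := c) (-1) t

lemma ev_sub (hc : SumBound 0 M c) (hd : SumBound 0 M' d) (t : ℝ) :
    ev ω (c - d) t = ev ω c t - ev ω d t := by
  rw [sub_eq_add_neg, ev_add hc hd.neg, ev_neg, sub_eq_add_neg]

lemma ev_oneCoeff (t : ℝ) : ev ω oneCoeff t = 1 := by
  unfold ev
  rw [tsum_eq_single 0]
  · simp [oneCoeff, pairing_zero]
  · intro k hk
    simp [oneCoeff, hk]

lemma ev_conv (hc : SumBound 0 M c) (hd : SumBound 0 M' d) (t : ℝ) :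
    ev ω (conv c d) t = ev ω c t * ev ω d t := by
  obtain ⟨e, he⟩ : ∃ e : (Fin r → ℤ) → ℂ,
      ∀ k, Complex.exp (((pairing k ω * t : ℝ) : ℂ) * Complex.I) = e k := ⟨_, fun _ => rfl⟩
  have he1 : ∀ j k, e j * e (k - j) = e k := fun j k => by
    rw [← he, ← he, ← he, ← Complex.exp_add, ← add_mul, ← Complex.ofReal_add, ← add_mul,
      ← pairing_add, add_sub_cancel]
  have h1 := (hc.summable_ev (ω := ω) t).norm
  have h2 := (hd.summable_ev (ω := ω) t).norm
  unfold ev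
  simp only [he] at h1 h2 ⊢
  have hs := summable_mul_of_summable_norm h1 h2
  let φ : (Fin r → ℤ) × (Fin r → ℤ) ≃ (Fin r → ℤ) × (Fin r → ℤ) :=
    Equiv.prodShear (Equiv.refl _) fun j => Equiv.subRight j
  have hs' := (Equiv.summable_iff φ).2 hs
  have hterm : ∀ z : (Fin r → ℤ) × (Fin r → ℤ),
      (c (φ z).1 * e (φ z).1) * (d (φ z).2 * e (φ z).2) = c z.1 * d (z.2 - z.1) * e z.2 := by
    rintro ⟨j, k⟩
    simp only [φ, Equiv.prodShear_apply, Equiv.refl_apply, Equiv.subRight_apply]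
    rw [← he1 j k]
    ring
  have hs'' : Summable fun z : (Fin r → ℤ) × (Fin r → ℤ) => c z.1 * d (z.2 - z.1) * e z.2 :=
    hs'.congr fun z => hterm z
  calc ∑' k, conv c d k * e k = ∑' k, ∑' j, c j * d (k - j) * e k :=
        tsum_congr fun k => tsum_mul_right.symm
    _ = ∑' j, ∑' k, c j * d (k - j) * e k :=
        Summable.tsum_comm (f := fun j k => c j * d (k - j) * e k) hs''
    _ = ∑' z : (Fin r → ℤ) × (Fin r → ℤ), c z.1 * d (z.2 - z.1) * e z.2 := hs''.tsum_prod.symm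
    _ = ∑' z : (Fin r → ℤ) × (Fin r → ℤ), (c (φ z).1 * e (φ z).1) * (d (φ z).2 * e (φ z).2) :=
        tsum_congr fun z => (hterm z).symm
    _ = ∑' z : (Fin r → ℤ) × (Fin r → ℤ), (c z.1 * e z.1) * (d z.2 * e z.2) :=
        Equiv.tsum_eq φ fun z : (Fin r → ℤ) × (Fin r → ℤ) => (c z.1 * e z.1) * (d z.2 * e z.2)
    _ = _ := (tsum_mul_tsum_of_summable_norm h1 h2).symm

lemma hasDerivAt_ev (hc : SumBound 0 M c) (hd : SumBound 0 M' (dcoeff ω c)) (t : ℝ) :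
    HasDerivAt (ev ω c) (ev ω (dcoeff ω c) t) t := by
  refine hasDerivAt_tsum (u := fun k => ‖dcoeff ω c k‖)
    (g := fun k t => c k * Complex.exp (((pairing k ω * t : ℝ) : ℂ) * Complex.I))
    (g' := fun k t => dcoeff ω c k * Complex.exp (((pairing k ω * t : ℝ) : ℂ) * Complex.I))
    hd.summable_norm (fun k y => ?_) (fun k y => ?_) (hc.summable_ev 0) t
  · have h1 : HasDerivAt (fun y : ℝ => ((pairing k ω * y : ℝ) : ℂ) * Complex.I)
        ((pairing k ω : ℝ) * Complex.I) y := by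
      have := ((hasDerivAt_id y).const_mul (pairing k ω)).ofReal_comp.mul_const Complex.I
      simpa using this
    refine (h1.cexp.const_mul (c k)).congr_deriv ?_
    simp only [dcoeff]
    ring
  · rw [norm_mul, Complex.norm_exp_ofReal_mul_I, mul_one]

lemma conj_ev (t : ℝ) : (starRingEnd ℂ) (ev ω c t) =
    ev ω (fun k => (starRingEnd ℂ) (c (-k))) t := by
  unfold ev
  rw [← (Equiv.neg (Fin r → ℤ)).tsum_eq (fun k => (starRingEnd ℂ) (c (-k)) * _), Complex.conj_tsum]
  refine tsum_congr fun k => ?_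
  rw [map_mul, Equiv.neg_apply, neg_neg, pairing_neg, ← Complex.exp_conj, map_mul, Complex.conj_I,
    Complex.conj_ofReal]
  push_cast
  ring_nf

lemma SumBound.conj (hc : SumBound s M c) :
    SumBound s M (fun k => (starRingEnd ℂ) (c (-k))) := fun S => by
  have := hc (S.map (Equiv.neg (Fin r → ℤ)).toEmbedding)
  simpa [l1_neg] using this

end

section

variable {r : ℕ} {ω : Fin r → ℝ} {c d : (Fin r → ℤ) → ℂ} {s M M' : ℝ}

/-! ### Averages -/

lemma norm_average_exp_le (ν T : ℝ) (hT : 0 < T) :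
    ‖((1 / (2 * T) : ℝ) : ℂ) * ∫ t in (-T)..T, Complex.exp (((ν * t : ℝ) : ℂ) * Complex.I)‖ ≤ 1 := by
  have h := intervalIntegral.norm_integral_le_of_norm_le_const (a := -T) (b := T)
    (f := fun t : ℝ => Complex.exp (((ν * t : ℝ) : ℂ) * Complex.I)) (C := 1)
    fun t _ => (Complex.norm_exp_ofReal_mul_I _).le
  rw [norm_mul, Complex.norm_real, Real.norm_of_nonneg (by positivity)]
  have h2 : |T - -T| = 2 * T := by rw [abs_of_pos] <;> linarith
  rw [h2, one_mul] at h
  calc 1 / (2 * T) * _ ≤ 1 / (2 * T) * (2 * T) := by gcongr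
    _ = 1 := by field_simp

lemma tendsto_average_exp {ν : ℝ} (hν : ν ≠ 0) :
    Tendsto (fun T : ℝ => ((1 / (2 * T) : ℝ) : ℂ) *
      ∫ t in (-T)..T, Complex.exp (((ν * t : ℝ) : ℂ) * Complex.I)) atTop (𝓝 0) := by
  have hlim : Tendsto (fun T : ℝ => (1 / |ν|) * T⁻¹) atTop (𝓝 0) := by
    simpa using tendsto_inv_atTop_zero.const_mul (1 / |ν|)
  refine squeeze_zero_norm' ?_ hlim
  filter_upwards [eventually_gt_atTop 0] with T hT
  have hc : (ν : ℂ) * Complex.I ≠ 0 := mul_ne_zero (by exact_mod_cast hν) Complex.I_ne_zero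
  have h1 : ∫ t in (-T)..T, Complex.exp (((ν * t : ℝ) : ℂ) * Complex.I) =
      (Complex.exp (ν * Complex.I * (T : ℝ)) - Complex.exp (ν * Complex.I * ((-T : ℝ) : ℂ))) /
        (ν * Complex.I) := by
    rw [← integral_exp_mul_complex hc]
    congr 1
    ext t
    push_cast
    ring_nf
  have h2 : ∀ x : ℝ, ‖Complex.exp (ν * Complex.I * (x : ℂ))‖ = 1 := fun x => by
    have := Complex.norm_exp_ofReal_mul_I (ν * x)
    rw [← this]
    push_cast
    ring_nf
  rw [h1, norm_mul, norm_div, norm_mul, Complex.norm_I, mul_one, Complex.norm_real,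
    Complex.norm_real, Real.norm_of_nonneg (by positivity : (0 : ℝ) ≤ 1 / (2 * T))]
  have h3 := norm_sub_le (Complex.exp (ν * Complex.I * ((T : ℝ) : ℂ)))
    (Complex.exp (ν * Complex.I * ((-T : ℝ) : ℂ)))
  rw [h2, h2] at h3
  have hν' : 0 < |ν| := abs_pos.2 hν
  rw [Real.norm_eq_abs]
  calc 1 / (2 * T) * (_ / |ν|) ≤ 1 / (2 * T) * ((1 + 1) / |ν|) := by gcongr
    _ = 1 / |ν| * T⁻¹ := by field_simp; norm_num

/-- For rationally independent frequencies the time average of a quasi-periodic function is its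
coefficient of index `0`. -/
lemma tendsto_average_ev (hω : ∀ k : Fin r → ℤ, k ≠ 0 → pairing k ω ≠ 0) (hc : SumBound 0 M c) :
    Tendsto (fun T : ℝ => ((1 / (2 * T) : ℝ) : ℂ) * ∫ t in (-T)..T, ev ω c t) atTop (𝓝 (c 0)) := by
  have hint : ∀ T : ℝ, ∫ t in (-T)..T, ev ω c t =
      ∑' k, c k * ∫ t in (-T)..T, Complex.exp (((pairing k ω * t : ℝ) : ℂ) * Complex.I) := by
    intro T
    have := intervalIntegral.hasSum_integral_of_dominated_convergence (μ := volume)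
      (a := -T) (b := T)
      (F := fun (k : Fin r → ℤ) (t : ℝ) =>
        c k * Complex.exp (((pairing k ω * t : ℝ) : ℂ) * Complex.I))
      (f := ev ω c) (fun k _ => ‖c k‖)
      (fun k => by
        apply Continuous.aestronglyMeasurable
        fun_prop)
      (fun k => ae_of_all _ fun t _ => by
        rw [norm_mul, Complex.norm_exp_ofReal_mul_I, mul_one])
      (ae_of_all _ fun t _ => hc.summable_norm)
      intervalIntegrable_const
      (ae_of_all _ fun t _ => (hc.summable_ev t).hasSum)
    rw [← this.tsum_eq]
    exact tsum_congr fun k => intervalIntegral.integral_const_mul _ _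
  have hlim : ∑' k : Fin r → ℤ, (if k = 0 then c k else 0) = c 0 := by
    rw [tsum_eq_single 0]
    · simp
    · intro k hk
      simp [hk]
  rw [← hlim]
  have hfun : (fun T : ℝ => ((1 / (2 * T) : ℝ) : ℂ) * ∫ t in (-T)..T, ev ω c t) = fun T : ℝ =>
      ∑' k, c k * (((1 / (2 * T) : ℝ) : ℂ) *
        ∫ t in (-T)..T, Complex.exp (((pairing k ω * t : ℝ) : ℂ) * Complex.I)) := by
    ext T
    rw [hint, ← tsum_mul_left]
    exact tsum_congr fun k => by ring
  rw [hfun]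
  refine tendsto_tsum_of_dominated_convergence (bound := fun k => ‖c k‖) hc.summable_norm ?_ ?_
  · intro k
    by_cases hk : k = 0
    · subst hk
      simp only [if_true, pairing_zero]
      refine tendsto_const_nhds.congr' ?_
      filter_upwards [eventually_gt_atTop 0] with T hT
      have hT' : (T : ℂ) ≠ 0 := by exact_mod_cast hT.ne'
      simp only [zero_mul, Complex.ofReal_zero, Complex.exp_zero]
      rw [intervalIntegral.integral_const, Complex.real_smul, mul_one, ← Complex.ofReal_mul]
      have : 1 / (2 * T) * (T - -T) = 1 := by field_simp; ring
      rw [this]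
      simp
    · rw [if_neg hk]
      simpa using (tendsto_average_exp (hω k hk)).const_mul (c k)
  · filter_upwards [eventually_gt_atTop 0] with T hT k
    rw [norm_mul]
    exact mul_le_of_le_one_right (norm_nonneg _) (norm_average_exp_le _ _ hT)

lemma coeff_zero_eq_of_ev_eq (hω : ∀ k : Fin r → ℤ, k ≠ 0 → pairing k ω ≠ 0)
    (hc : SumBound 0 M c) (hd : SumBound 0 M' d) (h : ∀ t, ev ω c t = ev ω d t) : c 0 = d 0 := by
  have h1 := tendsto_average_ev hω hc
  have h2 := tendsto_average_ev hω hd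
  rw [funext h] at h1
  exact tendsto_nhds_unique h1 h2

/-! ### Inverses by Neumann series -/

lemma SumBound.tsum {f : ℕ → (Fin r → ℤ) → ℂ} {u : ℕ → ℝ} (hf : ∀ n, SumBound s (u n) (f n))
    (hu : Summable u) : SumBound s (∑' n, u n) (fun k => ∑' n, f n k) := fun S => by
  have hsum : ∀ k, Summable fun n => ‖f n k‖ * Real.exp (s * l1 k) := fun k =>
    Summable.of_nonneg_of_le (fun n => by positivity) (fun n => (hf n).term_le k) hu
  have hsum' : ∀ k, Summable fun n => ‖f n k‖ := fun k =>
    (summable_mul_right_iff (Real.exp_pos _).ne').1 (hsum k)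
  calc ∑ k ∈ S, ‖∑' n, f n k‖ * Real.exp (s * l1 k)
      ≤ ∑ k ∈ S, ∑' n, ‖f n k‖ * Real.exp (s * l1 k) := Finset.sum_le_sum fun k _ => by
        rw [tsum_mul_right]
        gcongr
        exact norm_tsum_le_tsum_norm (hsum' k)
    _ = ∑' n, ∑ k ∈ S, ‖f n k‖ * Real.exp (s * l1 k) :=
        (Summable.tsum_finsetSum fun k _ => hsum k).symm
    _ ≤ ∑' n, u n := Summable.tsum_le_tsum (fun n => hf n S) (summable_sum fun k _ => hsum k) hu

lemma ev_tsum {f : ℕ → (Fin r → ℤ) → ℂ} {u : ℕ → ℝ} (hf : ∀ n, SumBound 0 (u n) (f n))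
    (hu : Summable u) (t : ℝ) : ev ω (fun k => ∑' n, f n k) t = ∑' n, ev ω (f n) t := by
  have hs : Summable (Function.uncurry fun (n : ℕ) (k : Fin r → ℤ) =>
      f n k * Complex.exp (((pairing k ω * t : ℝ) : ℂ) * Complex.I)) := by
    refine Summable.of_norm ?_
    refine (summable_prod_of_nonneg fun _ => norm_nonneg _).2 ⟨fun n => ?_, ?_⟩
    · exact ((hf n).summable_ev t).norm
    · refine Summable.of_nonneg_of_le (fun n => tsum_nonneg fun _ => norm_nonneg _)
        (fun n => ?_) hu
      simpa only [Function.uncurry_apply_pair, norm_mul, Complex.norm_exp_ofReal_mul_I, mul_one]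
        using (hf n).tsum_norm_le
  unfold ev
  rw [← Summable.tsum_comm hs]
  exact tsum_congr fun k => tsum_mul_right.symm

lemma exists_inverse_one_add {η : (Fin r → ℤ) → ℂ} {h : ℝ} (hs : 0 ≤ s) (hη : SumBound s h η)
    (hh : h ≤ 1 / 2) (ω : Fin r → ℝ) : ∃ Y : (Fin r → ℤ) → ℂ, SumBound s (2 * h) (Y - oneCoeff) ∧
      ∀ t, ev ω Y t * (1 + ev ω η t) = 1 := by
  let pw : ℕ → (Fin r → ℤ) → ℂ := fun n => Nat.rec (-η) (fun _ x => conv (-η) x) n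
  have h0 := hη.nonneg
  have hpw : ∀ n, SumBound s (h * (1 / 2) ^ n) (pw n) := fun n => by
    induction n with
    | zero =>
      rw [pow_zero, mul_one]
      exact hη.neg
    | succ n ih =>
      refine (hη.neg.conv hs ih).mono ?_
      rw [pow_succ]
      have : 0 ≤ h * (1 / 2) ^ n := by positivity
      nlinarith
  have hu : Summable fun n : ℕ => h * (1 / 2 : ℝ) ^ n := summable_geometric_two.mul_left h
  have hut : ∑' n : ℕ, h * (1 / 2 : ℝ) ^ n = 2 * h := by
    rw [tsum_mul_left, tsum_geometric_two, mul_comm]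
  have hZ := SumBound.tsum hpw hu
  rw [hut] at hZ
  have hη0 := hη.mono_width hs
  have hpw0 := fun n => (hpw n).mono_width hs
  refine ⟨oneCoeff + fun k => ∑' n, pw n k, by simpa using hZ, fun t => ?_⟩
  have hev : ∀ n, ev ω (pw n) t = -ev ω η t * (-ev ω η t) ^ n := fun n => by
    induction n with
    | zero =>
      rw [pow_zero, mul_one]
      exact ev_neg t
    | succ n ih =>
      change ev ω (conv (-η) (pw n)) t = _
      rw [ev_conv hη0.neg (hpw0 n), ih, ev_neg]
      ring
  have hlt : ‖-ev ω η t‖ < 1 := by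
    rw [norm_neg]
    exact (hη0.norm_ev_le t).trans_lt (by linarith)
  have hne : 1 + ev ω η t ≠ 0 := fun h => by
    have : -ev ω η t = 1 := by linear_combination -h
    rw [this] at hlt
    simp at hlt
  rw [ev_add (sumBound_oneCoeff 0) (hZ.mono_width hs), ev_oneCoeff, ev_tsum hpw0 hu,
    tsum_congr hev, tsum_mul_left, tsum_geometric_of_norm_lt_one hlt]
  rw [sub_neg_eq_add]
  field_simp
  ring

end

section

variable {r : ℕ} {ω : Fin r → ℝ} {c d : (Fin r → ℤ) → ℂ} {s M M' : ℝ}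

/-! ### Derivatives of quasi-periodic functions -/

lemma abs_pairing_le (k : Fin r → ℤ) (ω : Fin r → ℝ) : |pairing k ω| ≤ (∑ j, |ω j|) * l1 k := by
  calc |pairing k ω| ≤ ∑ j, |(k j : ℝ) * ω j| := Finset.abs_sum_le_sum_abs _ _
    _ ≤ ∑ j, |(k j : ℝ)| * ∑ i, |ω i| := Finset.sum_le_sum fun j _ => by
        rw [abs_mul]
        gcongr
        exact Finset.single_le_sum (f := fun i => |ω i|) (fun _ _ => abs_nonneg _)
          (Finset.mem_univ j)
    _ = _ := by rw [← Finset.sum_mul, mul_comm]; rfl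

lemma SumBound.dcoeff {σ : ℝ} (hc : SumBound s M c) (hσ : 0 < σ) (hσ1 : σ ≤ 1) (ω : Fin r → ℝ) :
    SumBound (s - σ) ((∑ j, |ω j|) * Real.exp 2 / σ * M) (dcoeff ω c) := by
  have hK : 0 ≤ ∑ j, |ω j| := Finset.sum_nonneg fun _ _ => abs_nonneg _
  have := hc.multiplier (p := 1) (m := fun k => (pairing k ω : ℝ) * Complex.I) hσ hσ1 hK fun k => by
    rw [norm_mul, Complex.norm_I, mul_one, Complex.norm_real, Real.norm_eq_abs, pow_one]
    exact (abs_pairing_le k ω).trans (by gcongr; linarith)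
  simp only [Nat.factorial_one, Nat.cast_one, one_mul, pow_one] at this
  exact this

lemma SumBound.exists_dcoeff (hs : 0 < s) (hc : SumBound s M c) (ω : Fin r → ℝ) :
    ∃ M', SumBound (s / 2) M' (QPHill.dcoeff ω c) :=
  ⟨_, ((hc.dcoeff (σ := min (s / 2) 1) (by positivity) (min_le_right _ _) ω).mono_width
    (by linarith [min_le_left (s / 2) 1]))⟩

lemma SumBound.hasDerivAt_ev (hs : 0 < s) (hc : SumBound s M c) (t : ℝ) :
    HasDerivAt (ev ω c) (ev ω (QPHill.dcoeff ω c) t) t := by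
  obtain ⟨M', h'⟩ := hc.exists_dcoeff hs ω
  exact QPHill.hasDerivAt_ev (hc.mono_width hs.le) (h'.mono_width (by linarith)) t

/-! ### The Newton step -/

/-- `U` solves `U'' + 2 i λ U' - λ² U + ε a U = R` up to the error `R` of size `e`, where `U` and
its inverse `V` are within `u` of `1`, all in width `w`. If `R = 0` this says that
`e^{i λ t} U(t)` solves the Hill equation. -/
structure ApproxFloquet (ω : Fin r → ℝ) (a : (Fin r → ℤ) → ℂ) (lam w u e : ℝ)
    (U V R : (Fin r → ℤ) → ℂ) (ε : ℂ) : Prop where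
  bound_U : SumBound w u (U - oneCoeff)
  bound_V : SumBound w u (V - oneCoeff)
  bound_R : SumBound w e R
  inv : ∀ t, ev ω V t * ev ω U t = 1
  eqn : ∀ t, ev ω (dcoeff ω (dcoeff ω U)) t + 2 * Complex.I * lam * ev ω (dcoeff ω U) t -
    lam ^ 2 * ev ω U t + ε * ev ω a t * ev ω U t = ev ω R t

/-- The multiplier inverting `d/dt + i ν` on the modes of nonzero index; it kills the mode `0`. -/
noncomputable def invMult (ω : Fin r → ℝ) (ν : ℝ) (k : Fin r → ℤ) : ℂ :=
  if k = 0 then 0 else (((pairing k ω + ν : ℝ) : ℂ) * Complex.I)⁻¹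

/-- The coefficients `c` multiplied by `invMult ω ν`. -/
noncomputable def solveMode (ω : Fin r → ℝ) (ν : ℝ) (c : (Fin r → ℤ) → ℂ) : (Fin r → ℤ) → ℂ :=
  fun k => invMult ω ν k * c k

/-- The divisors `⟨k, ω⟩ + ν`, `k ≠ 0`, are at least `(B (|k| + 2) ^ p)⁻¹` in modulus. -/
def DivisorBound (ω : Fin r → ℝ) (ν B : ℝ) (p : ℕ) : Prop :=
  ∀ k : Fin r → ℤ, k ≠ 0 → 1 ≤ B * (l1 k + 2) ^ p * |pairing k ω + ν|

lemma DivisorBound.ne_zero {ν B : ℝ} {p : ℕ} (h : DivisorBound ω ν B p) {k : Fin r → ℤ}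
    (hk : k ≠ 0) : pairing k ω + ν ≠ 0 := fun h0 => by
  have := h k hk
  rw [h0] at this
  norm_num at this

lemma SumBound.solveMode {ν B σ : ℝ} {p : ℕ} (h : DivisorBound ω ν B p) (hB : 0 ≤ B)
    (hc : SumBound s M c) (hσ : 0 < σ) (hσ1 : σ ≤ 1) :
    SumBound (s - σ) (B * (p.factorial * Real.exp 2) / σ ^ p * M) (solveMode ω ν c) := by
  refine hc.multiplier hσ hσ1 hB fun k => ?_
  have h0 := l1_nonneg k
  unfold invMult
  split_ifs with hk
  · rw [norm_zero]
    positivity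
  · rw [norm_inv, norm_mul, Complex.norm_I, mul_one, Complex.norm_real, Real.norm_eq_abs]
    have hpos : 0 < |pairing k ω + ν| := abs_pos.2 (h.ne_zero hk)
    rw [inv_eq_one_div, div_le_iff₀ hpos]
    exact h k hk

lemma sumBound_two_of_sub_one {u : ℝ} (hs : SumBound s u (c - oneCoeff)) (hu : u ≤ 1) :
    SumBound s 2 c := by
  have := (hs.add (sumBound_oneCoeff s)).mono (M' := 2) (by linarith)
  simpa using this

/-- Multiplying `d` by the square of a function close to `1` changes its mean little. -/
lemma norm_mean_mul_sq_sub_le (hω : ∀ k : Fin r → ℤ, k ≠ 0 → pairing k ω ≠ 0)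
    {f : (Fin r → ℤ) → ℂ} {u F : ℝ} (hc : SumBound 0 u (c - oneCoeff)) (hu : u ≤ 1)
    (hd : SumBound 0 M d) (hf : SumBound 0 F f)
    (h : ∀ t, ev ω f t = ev ω d t * (ev ω c t) ^ 2) : ‖f 0 - d 0‖ ≤ M * (3 * u) := by
  set x := c - oneCoeff with hx
  have hc2 := sumBound_two_of_sub_one hc hu
  have hu0 := hc.nonneg
  have hb : SumBound 0 (M * (u * u + 2 * u)) (conv d (conv x x + (2 : ℂ) • x)) := by
    have h1 := hc.smul (2 : ℂ)
    rw [Complex.norm_ofNat] at h1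
    exact hd.conv le_rfl ((hc.conv le_rfl hc).add h1)
  have heq : (f - d) 0 = (conv d (conv x x + (2 : ℂ) • x)) 0 := by
    refine coeff_zero_eq_of_ev_eq hω (hf.sub hd) hb fun t => ?_
    rw [ev_sub hf hd, ev_conv hd ((hc.conv le_rfl hc).add (hc.smul 2)),
      ev_add (hc.conv le_rfl hc) (hc.smul 2), ev_conv hc hc, ev_smul, hx,
      ev_sub hc2 (sumBound_oneCoeff 0), ev_oneCoeff, h]
    ring
  have h2 := hb.norm_apply_le 0
  rw [← heq] at h2
  refine h2.trans ?_
  have := hd.nonneg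
  gcongr
  nlinarith

set_option maxHeartbeats 2000000 in
/-- One Newton step. The linearized equation is solved exactly by means of the integrating factor
`U²`, so that the new error `η (R + δ a U)` is quadratic in the old one. The correction `δ` of the
parameter makes the derivative of `η` have mean zero. -/
theorem ApproxFloquet.step {a U V R : (Fin r → ℤ) → ℂ} {ε : ℂ}
    {lam w u e A abar B s₀ σ h : ℝ} {p : ℕ}
    (H : ApproxFloquet ω a lam w u e U V R ε) (ha : SumBound w A a) (ha0 : a 0 = abar)
    (habar : 0 < abar) (hB : 0 ≤ B) (h0 : DivisorBound ω 0 B p)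
    (h2 : DivisorBound ω (2 * lam) B p) (hlam : 0 < lam) (hs₀ : 0 < s₀) (hs₁ : s₀ ≤ 1)
    (hσ : 0 < σ) (hw : s₀ + 2 * σ ≤ w) (hσs : σ ≤ s₀)
    (hu : 36 * A * u ≤ abar)
    (hl : 128 * lam * A * (B * (p.factorial * Real.exp 2) / s₀ ^ p) ≤ abar)
    (hh : h = 36 * (B * (p.factorial * Real.exp 2) / σ ^ p) ^ 2 * (2 + 40 * A / abar) * e)
    (hh2 : h ≤ 1 / 2) :
    ∃ U' V' R' ε', ApproxFloquet ω a lam (w - 2 * σ) (u + 4 * h) ((1 + 20 * A / abar) * h * e)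
      U' V' R' ε' ∧ SumBound (w - 2 * σ) (2 * h) (U' - U) ∧ ‖ε' - ε‖ ≤ 10 * e / abar := by
  have hw0 : 0 ≤ w := by linarith
  have hσ1 : σ ≤ 1 := hσs.trans hs₁
  have hωne : ∀ k : Fin r → ℤ, k ≠ 0 → pairing k ω ≠ 0 := fun k hk => by
    simpa using h0.ne_zero hk
  have hA := ha.nonneg
  have hu0 := H.bound_U.nonneg
  have he := H.bound_R.nonneg
  have habarA : abar ≤ A := by
    have := (ha.mono_width hw0).norm_apply_le 0
    rwa [ha0, Complex.norm_real, Real.norm_of_nonneg habar.le] at this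
  have hApos : 0 < A := habar.trans_le habarA
  have hu36 : 36 * u ≤ 1 := by
    by_contra hcon
    push Not at hcon
    nlinarith
  have hu1 : u ≤ 1 := by linarith
  set κ := B * (p.factorial * Real.exp 2) / σ ^ p with hκ
  set κ₀ := B * (p.factorial * Real.exp 2) / s₀ ^ p with hκ₀
  have hκ0 : 0 ≤ κ := by positivity
  have hκ₀0 : 0 ≤ κ₀ := by positivity
  have bU := sumBound_two_of_sub_one H.bound_U hu1
  have bV := sumBound_two_of_sub_one H.bound_V hu1
  have bR := H.bound_R
  -- the data `W = V²`, `b = a U²`, `f = U R` of the linearized equation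
  set W := conv V V with hW
  have bW : SumBound w 4 W := (bV.conv hw0 bV).mono (by norm_num)
  set b := conv a (conv U U) with hb
  have bb : SumBound w (4 * A) b := (ha.conv hw0 (bU.conv hw0 bU)).mono (by linarith)
  set f := conv U R with hf
  have bf : SumBound w (2 * e) f := bU.conv hw0 bR
  have evW : ∀ t, ev ω W t = ev ω V t ^ 2 := fun t => by
    rw [hW, ev_conv (bV.mono_width hw0) (bV.mono_width hw0), sq]
  have evb : ∀ t, ev ω b t = ev ω a t * ev ω U t ^ 2 := fun t => by
    rw [hb, ev_conv (ha.mono_width hw0) ((bU.conv hw0 bU).mono_width hw0),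
      ev_conv (bU.mono_width hw0) (bU.mono_width hw0), sq]
  have evf : ∀ t, ev ω f t = ev ω U t * ev ω R t := fun t => by
    rw [hf, ev_conv (bU.mono_width hw0) (bR.mono_width hw0)]
  have hW0 : ‖W 0 - 1‖ ≤ 3 * u := by
    have := norm_mean_mul_sq_sub_le hωne (H.bound_V.mono_width hw0) hu1 (sumBound_oneCoeff 0)
      (bW.mono_width hw0) fun t => by rw [evW, ev_oneCoeff, one_mul]
    simpa [oneCoeff] using this
  have hb0 : ‖b 0 - abar‖ ≤ A * (3 * u) := by
    have := norm_mean_mul_sq_sub_le hωne (H.bound_U.mono_width hw0) hu1 (ha.mono_width hw0)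
      (bb.mono_width hw0) evb
    rwa [ha0] at this
  have hW0le : ‖W 0‖ ≤ 2 := by
    have := norm_le_norm_add_norm_sub' (W 0) 1
    rw [norm_one] at this
    linarith
  have hW0ge : 1 / 2 ≤ ‖W 0‖ := by
    have := norm_le_norm_add_norm_sub (W 0) 1
    rw [norm_one] at this
    linarith
  have hW0ne : W 0 ≠ 0 := fun h => by rw [h, norm_zero] at hW0ge; linarith
  -- means of products with `L⁻¹`: here a fixed part `s₀` of the width is given up
  have hmean : ∀ {g : (Fin r → ℤ) → ℂ} {G : ℝ}, SumBound w G g →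
      ‖conv W (solveMode ω (2 * lam) g) 0‖ ≤ 4 * (κ₀ * G) := fun {g G} hg => by
    have h1 := (hg.solveMode h2 hB hs₀ hs₁).mono_width (s' := 0) (by linarith)
    exact ((bW.mono_width hw0).conv le_rfl h1).norm_apply_le 0
  set mb := conv W (solveMode ω (2 * lam) b) 0 with hmb
  set mf := conv W (solveMode ω (2 * lam) f) 0 with hmf
  have bmb : ‖mb‖ ≤ 4 * (κ₀ * (4 * A)) := hmean bb
  have bmf : ‖mf‖ ≤ 4 * (κ₀ * (2 * e)) := hmean bf
  have hnorm2 : ‖2 * Complex.I * (lam : ℂ)‖ = 2 * lam := by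
    rw [norm_mul, norm_mul, Complex.norm_I, Complex.norm_real, Real.norm_of_nonneg hlam.le,
      Complex.norm_ofNat, mul_one]
  set Δ := b 0 * W 0 + 2 * Complex.I * lam * mb with hΔ
  have hΔge : abar / 2 ≤ ‖Δ‖ := by
    have e1 : (abar : ℂ) - Δ = -((b 0 - abar) * W 0 + abar * (W 0 - 1) +
        2 * Complex.I * lam * mb) := by rw [hΔ]; ring
    have e2 : ‖(abar : ℂ) - Δ‖ ≤ A * (3 * u) * 2 + abar * (3 * u) +
        2 * lam * (4 * (κ₀ * (4 * A))) := by
      rw [e1, norm_neg]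
      refine (norm_add₃_le).trans ?_
      rw [norm_mul, norm_mul, norm_mul (2 * Complex.I * (lam : ℂ)), hnorm2, Complex.norm_real,
        Real.norm_of_nonneg habar.le]
      gcongr
    have e3 := norm_le_norm_add_norm_sub' (abar : ℂ) Δ
    rw [Complex.norm_real, Real.norm_of_nonneg habar.le] at e3
    have e4 : abar * (3 * u) ≤ A * (3 * u) := by gcongr
    nlinarith
  have hΔne : Δ ≠ 0 := fun h => by rw [h, norm_zero] at hΔge; linarith
  set δ := -(f 0 * W 0 + 2 * Complex.I * lam * mf) / Δ with hδ
  have hlκ : 128 * (lam * κ₀) ≤ 1 := by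
    by_contra hcon
    push Not at hcon
    nlinarith
  have bδ : ‖δ‖ ≤ 10 * e / abar := by
    rw [hδ, norm_div, norm_neg, div_le_div_iff₀ (by linarith) habar]
    have e1 : ‖f 0 * W 0 + 2 * Complex.I * lam * mf‖ ≤ 2 * e * 2 +
        2 * lam * (4 * (κ₀ * (2 * e))) := by
      refine (norm_add_le _ _).trans ?_
      rw [norm_mul, norm_mul (2 * Complex.I * (lam : ℂ)), hnorm2]
      have := (bf.mono_width hw0).norm_apply_le 0
      gcongr
    have e2 : 2 * lam * (4 * (κ₀ * (2 * e))) ≤ e := by nlinarith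
    have e3 : ‖f 0 * W 0 + 2 * Complex.I * lam * mf‖ ≤ 5 * e := by linarith
    calc _ ≤ 5 * e * abar := by gcongr
      _ = 10 * e * (abar / 2) := by ring
      _ ≤ _ := by gcongr
  -- the right-hand side of the linearized equation and its solution `g`
  set q := f + δ • b with hq
  set C₁ := 2 + 40 * A / abar with hC₁
  have hC₁0 : 0 ≤ C₁ := by positivity
  have bq : SumBound w (C₁ * e) q := by
    refine (bf.add (bb.smul δ)).mono ?_
    calc 2 * e + ‖δ‖ * (4 * A) ≤ 2 * e + 10 * e / abar * (4 * A) := by gcongr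
      _ = C₁ * e := by rw [hC₁]; field_simp; ring
  set G := solveMode ω (2 * lam) q with hG
  have bG : SumBound (w - σ) (κ * (C₁ * e)) G := bq.solveMode h2 hB hσ hσ1
  have hwσ : 0 ≤ w - σ := by linarith
  set γ := conv W G 0 / W 0 with hγ
  have bγ : ‖γ‖ ≤ 8 * (κ * (C₁ * e)) := by
    have e1 := (((bW.mono_width (by linarith : w - σ ≤ w)).conv hwσ bG).mono_width
      hwσ).norm_apply_le 0
    have e0 : 0 ≤ κ * (C₁ * e) := by positivity
    rw [hγ, norm_div, div_le_iff₀ (by linarith)]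
    nlinarith
  set g := γ • oneCoeff - G with hg
  have bg : SumBound (w - σ) (9 * (κ * (C₁ * e))) g := by
    refine (((sumBound_oneCoeff (w - σ)).smul γ).sub bG).mono ?_
    linarith
  have hG0 : G 0 = 0 := by simp [hG, solveMode, invMult]
  have hmG : conv W G 0 = mf + δ * mb := by
    have b1 := (bf.solveMode h2 hB hσ hσ1).mono_width hwσ
    have b2 := (bb.solveMode h2 hB hσ hσ1).mono_width hwσ
    have b3 := bW.mono_width hw0
    have hGeq : G = solveMode ω (2 * lam) f + δ • solveMode ω (2 * lam) b := by
      ext k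
      simp only [hG, hq, solveMode, Pi.add_apply, Pi.smul_apply, smul_eq_mul]
      ring
    have := coeff_zero_eq_of_ev_eq (c := conv W G)
      (d := conv W (solveMode ω (2 * lam) f) + δ • conv W (solveMode ω (2 * lam) b)) hωne
      (b3.conv le_rfl (bG.mono_width hwσ)) ((b3.conv le_rfl b1).add ((b3.conv le_rfl b2).smul δ))
      fun t => by
        rw [ev_conv b3 (bG.mono_width hwσ), ev_add (b3.conv le_rfl b1) ((b3.conv le_rfl b2).smul δ),
          ev_smul, ev_conv b3 b1, ev_conv b3 b2, hGeq, ev_add b1 (b2.smul δ), ev_smul]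
        ring
    simpa [hmf, hmb] using this
  have hmode0 : 2 * Complex.I * lam * γ = -(q 0) := by
    have e1 : δ * Δ = -(f 0 * W 0 + 2 * Complex.I * lam * mf) := by
      rw [hδ]; field_simp
    rw [hγ, hmG, hq, Pi.add_apply, Pi.smul_apply, smul_eq_mul]
    field_simp
    rw [hΔ] at e1
    linear_combination e1
  have hgeq : dcoeff ω g + (2 * Complex.I * lam) • g = -q := by
    ext k
    by_cases hk : k = 0
    · subst hk
      simp only [Pi.add_apply, dcoeff, pairing_zero, Complex.ofReal_zero, zero_mul, zero_add,
        Pi.smul_apply, smul_eq_mul, hg, Pi.sub_apply, hG0, Pi.neg_apply]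
      simpa [oneCoeff] using hmode0
    · have hne : ((pairing k ω + 2 * lam : ℝ) : ℂ) ≠ 0 := by exact_mod_cast h2.ne_zero hk
      have hI := Complex.I_ne_zero
      simp only [Pi.add_apply, dcoeff, Pi.smul_apply, smul_eq_mul, hg, Pi.sub_apply, hG, solveMode,
        invMult, hk, if_false, oneCoeff, Pi.neg_apply, ne_eq, not_false_eq_true, Pi.single_eq_of_ne,
        mul_zero, zero_sub]
      have : (pairing k ω : ℂ) * Complex.I + 2 * Complex.I * lam =
          ((pairing k ω + 2 * lam : ℝ) : ℂ) * Complex.I := by push_cast; ring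
      field_simp
      push_cast
      ring
  -- the derivative `Y` of the correction has mean zero, hence a primitive `η`
  set Y := conv W g with hY
  have bY : SumBound (w - σ) (36 * (κ * (C₁ * e))) Y :=
    ((bW.mono_width (by linarith)).conv hwσ bg).mono (by linarith)
  have hY0 : Y 0 = 0 := by
    have b3 := bW.mono_width hw0
    have b4 := bG.mono_width hwσ
    have := coeff_zero_eq_of_ev_eq (c := Y) (d := γ • W - conv W G) hωne (bY.mono_width hwσ)
      ((b3.smul γ).sub (b3.conv le_rfl b4)) fun t => by
        rw [hY, ev_conv b3 (bg.mono_width hwσ), ev_sub (b3.smul γ) (b3.conv le_rfl b4), ev_smul,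
          ev_conv b3 b4, hg, ev_sub ((sumBound_oneCoeff 0).smul γ) b4, ev_smul, ev_oneCoeff]
        ring
    rw [this, Pi.sub_apply, Pi.smul_apply, smul_eq_mul, hγ]
    field_simp
    ring
  set η := solveMode ω 0 Y with hη
  have bη : SumBound (w - 2 * σ) h η := by
    have := bY.solveMode h0 hB hσ hσ1
    rw [show w - σ - σ = w - 2 * σ by ring] at this
    refine this.mono (le_of_eq ?_)
    rw [hh]
    ring
  have hηY : dcoeff ω η = Y := by
    ext k
    by_cases hk : k = 0
    · subst hk
      simp [dcoeff, pairing_zero, hY0]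
    · have hne : ((pairing k ω : ℝ) : ℂ) ≠ 0 := by exact_mod_cast hωne k hk
      have hI := Complex.I_ne_zero
      simp only [dcoeff, hη, solveMode, invMult, hk, if_false, add_zero]
      field_simp
  -- the new approximation
  have hw2 : s₀ ≤ w - 2 * σ := by linarith
  have hw2' : 0 < w - 2 * σ := by linarith
  obtain ⟨Z, bZ, hZ⟩ := exists_inverse_one_add hw2'.le bη hh2 ω
  have hle : w - 2 * σ ≤ w := by linarith
  have bU2 := bU.mono_width hle
  have bV2 := bV.mono_width hle
  have bUη : SumBound (w - 2 * σ) (2 * h) (conv U η) := bU2.conv hw2'.le bη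
  have bVZ : SumBound (w - 2 * σ) (4 * h) (conv V (Z - oneCoeff)) :=
    (bV2.conv hw2'.le bZ).mono (by linarith)
  have hh0 := bη.nonneg
  have bU' := bU2.add bUη
  have baU : SumBound w (2 * A) (conv a U) := (ha.conv hw0 bU).mono (by linarith)
  have bRr : SumBound w ((1 + 20 * A / abar) * e) (R + δ • conv a U) := by
    refine (bR.add (baU.smul δ)).mono ?_
    calc e + ‖δ‖ * (2 * A) ≤ e + 10 * e / abar * (2 * A) := by gcongr
      _ = _ := by field_simp; ring
  have evU' : ∀ t, ev ω (U + conv U η) t = ev ω U t * (1 + ev ω η t) := fun t => by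
    rw [ev_add (bU2.mono_width hw2'.le) (bUη.mono_width hw2'.le),
      ev_conv (bU2.mono_width hw2'.le) (bη.mono_width hw2'.le)]
    ring
  refine ⟨U + conv U η, V + conv V (Z - oneCoeff), conv η (R + δ • conv a U), ε + δ,
    ⟨?_, ?_, ?_, ?_, ?_⟩, ?_, ?_⟩
  · have := ((H.bound_U.mono_width hle).add bUη).mono (M' := u + 4 * h) (by linarith)
    rwa [show U - oneCoeff + conv U η = U + conv U η - oneCoeff by abel] at this
  · have := (H.bound_V.mono_width hle).add bVZ
    rwa [show V - oneCoeff + conv V (Z - oneCoeff) = V + conv V (Z - oneCoeff) - oneCoeff by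
      abel] at this
  · refine (bη.conv hw2'.le (bRr.mono_width hle)).mono (le_of_eq ?_)
    ring
  · intro t
    have hZb : SumBound 0 2 Z := sumBound_two_of_sub_one (bZ.mono_width hw2'.le) (by linarith)
    rw [evU', ev_add (bV.mono_width hw0) (bVZ.mono_width hw2'.le),
      ev_conv (bV.mono_width hw0) (bZ.mono_width hw2'.le), ev_sub hZb (sumBound_oneCoeff 0),
      ev_oneCoeff]
    linear_combination (ev ω Z t * (1 + ev ω η t)) * H.inv t + hZ t
  · intro t
    have hwpos : 0 < w := by linarith
    have hwσpos : 0 < w - σ := by linarith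
    obtain ⟨M₁, bDU⟩ := bU.exists_dcoeff hwpos ω
    obtain ⟨M₂, bDU'⟩ := bU'.exists_dcoeff hw2' ω
    have dU : ∀ t, HasDerivAt (ev ω U) (ev ω (dcoeff ω U) t) t := bU.hasDerivAt_ev hwpos
    have dDU : ∀ t, HasDerivAt (ev ω (dcoeff ω U)) (ev ω (dcoeff ω (dcoeff ω U)) t) t :=
      bDU.hasDerivAt_ev (by linarith)
    have dη : ∀ t, HasDerivAt (ev ω η) (ev ω Y t) t := by
      rw [← hηY]
      exact bη.hasDerivAt_ev hw2'
    have dY : ∀ t, HasDerivAt (ev ω Y) (ev ω (dcoeff ω Y) t) t := bY.hasDerivAt_ev hwσpos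
    have dg : ∀ t, HasDerivAt (ev ω g) (ev ω (dcoeff ω g) t) t := bg.hasDerivAt_ev hwσpos
    have dU' : ∀ t, HasDerivAt (ev ω (U + conv U η)) (ev ω (dcoeff ω (U + conv U η)) t) t :=
      bU'.hasDerivAt_ev hw2'
    have dDU' : ∀ t, HasDerivAt (ev ω (dcoeff ω (U + conv U η)))
        (ev ω (dcoeff ω (dcoeff ω (U + conv U η))) t) t := bDU'.hasDerivAt_ev (by linarith)
    have hfun : ev ω (U + conv U η) = fun t => ev ω U t * (1 + ev ω η t) := funext evU'
    have e1 : ∀ t, ev ω (dcoeff ω (U + conv U η)) t =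
        ev ω (dcoeff ω U) t * (1 + ev ω η t) + ev ω U t * ev ω Y t := fun t => by
      have := dU' t
      rw [hfun] at this
      exact this.unique ((dU t).mul ((dη t).const_add 1))
    have e2 : ev ω (dcoeff ω (dcoeff ω (U + conv U η))) t =
        ev ω (dcoeff ω (dcoeff ω U)) t * (1 + ev ω η t) + ev ω (dcoeff ω U) t * ev ω Y t +
          (ev ω (dcoeff ω U) t * ev ω Y t + ev ω U t * ev ω (dcoeff ω Y) t) := by
      have := dDU' t
      rw [funext e1] at this
      exact this.unique (((dDU t).mul ((dη t).const_add 1)).add ((dU t).mul (dY t)))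
    have egY : ∀ t, ev ω g t = ev ω U t ^ 2 * ev ω Y t := fun t => by
      rw [hY, ev_conv (bW.mono_width hw0) (bg.mono_width hwσ), evW]
      linear_combination (-(ev ω V t * ev ω U t) - 1) * ev ω g t * H.inv t
    have e3 : ev ω (dcoeff ω g) t = (2 * ev ω U t * ev ω (dcoeff ω U) t) * ev ω Y t +
        ev ω U t ^ 2 * ev ω (dcoeff ω Y) t := by
      have := dg t
      rw [funext egY] at this
      have h' := this.unique (((dU t).pow 2).mul (dY t))
      rw [h']
      simp
    obtain ⟨M₃, bDg⟩ := bg.exists_dcoeff hwσpos ω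
    have e4 : ev ω (dcoeff ω g) t + 2 * Complex.I * lam * ev ω g t =
        -(ev ω U t * ev ω R t + δ * (ev ω a t * ev ω U t ^ 2)) := by
      rw [← ev_smul, ← ev_add (bDg.mono_width (by linarith))
        ((bg.mono_width hwσ).smul _), hgeq, ev_neg, hq, ev_add (bf.mono_width hw0)
        ((bb.mono_width hw0).smul δ), ev_smul, evf, evb]
    rw [e3, egY] at e4
    have hU : ev ω U t ≠ 0 := fun h => by
      have := H.inv t
      rw [h, mul_zero] at this
      exact zero_ne_one this
    have e5 : 2 * ev ω (dcoeff ω U) t * ev ω Y t + ev ω U t * ev ω (dcoeff ω Y) t +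
        2 * Complex.I * lam * (ev ω U t * ev ω Y t) = -(ev ω R t + δ * (ev ω a t * ev ω U t)) := by
      apply mul_left_cancel₀ hU
      linear_combination e4
    rw [e1, e2, evU', ev_conv (bη.mono_width hw2'.le) (bRr.mono_width hw0),
      ev_add (bR.mono_width hw0) ((baU.mono_width hw0).smul δ), ev_smul,
      ev_conv (ha.mono_width hw0) (bU.mono_width hw0)]
    linear_combination (1 + ev ω η t) * H.eqn t + e5
  · simpa using bUη
  · simpa using bδ

end

section

variable {r : ℕ} {ω : Fin r → ℝ}

/-! ### Convergence of the Newton iteration -/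

lemma exists_seq_of_step {S : Type*} {P : ℕ → S → Prop} {Q : ℕ → S → S → Prop} (x₀ : S)
    (h0 : P 0 x₀) (hstep : ∀ n x, P n x → ∃ y, P (n + 1) y ∧ Q n x y) :
    ∃ f : ℕ → S, ∀ n, P n (f n) ∧ Q n (f n) (f (n + 1)) := by
  choose F hF using hstep
  let g : ∀ n, {x // P n x} := fun n =>
    Nat.rec ⟨x₀, h0⟩ (fun n x => ⟨F n x.1 x.2, (hF n x.1 x.2).1⟩) n
  exact ⟨fun n => (g n).1, fun n => ⟨(g n).2, (hF n (g n).1 (g n).2).2⟩⟩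

lemma tendsto_ev_of_sumBound {u : ℕ → (Fin r → ℤ) → ℂ} {c : (Fin r → ℤ) → ℂ} {β : ℕ → ℝ} {M : ℝ}
    {N : ℕ → ℝ} (hu : ∀ n, SumBound 0 (N n) (u n)) (hc : SumBound 0 M c)
    (h : ∀ n, SumBound 0 (β n) (c - u n)) (hβ : Tendsto β atTop (𝓝 0)) (t : ℝ) :
    Tendsto (fun n => ev ω (u n) t) atTop (𝓝 (ev ω c t)) := by
  refine tendsto_iff_norm_sub_tendsto_zero.2 (squeeze_zero (fun _ => norm_nonneg _) (fun n => ?_) hβ)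
  rw [norm_sub_rev, ← ev_sub hc (hu n)]
  exact (h n).norm_ev_le t

lemma dcoeff_sub (c d : (Fin r → ℤ) → ℂ) : dcoeff ω (c - d) = dcoeff ω c - dcoeff ω d := by
  ext k
  simp only [dcoeff, Pi.sub_apply]
  ring

lemma dcoeff_oneCoeff : dcoeff ω oneCoeff = 0 := by
  ext k
  by_cases hk : k = 0
  · subst hk; simp [dcoeff, pairing_zero]
  · simp [dcoeff, oneCoeff, hk]

/-- If the mode-by-mode limit of a sequence of coefficients has geometrically small differences,
the sequence converges in the weighted norm. -/
lemma exists_limit_of_geometric {u : ℕ → (Fin r → ℤ) → ℂ} {s C : ℝ} (hs : 0 ≤ s)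
    (hu : ∀ n, SumBound s (C * (1 / 2) ^ n) (u (n + 1) - u n)) :
    ∃ c, (∀ k, Tendsto (fun n => u n k) atTop (𝓝 (c k))) ∧
      ∀ n, SumBound s (2 * C * (1 / 2) ^ n) (c - u n) := by
  have hlim : ∀ k, ∃ z, Tendsto (fun n => u n k) atTop (𝓝 z) := fun k =>
    cauchySeq_tendsto_of_complete (cauchySeq_of_le_geometric (1 / 2) C (by norm_num) fun n => by
      rw [dist_comm, dist_eq_norm]
      exact ((hu n).mono_width hs).norm_apply_le k)
  choose c hc using hlim
  have hC : 0 ≤ C := by simpa using (hu 0).nonneg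
  refine ⟨c, hc, fun n => ?_⟩
  have hm : ∀ m, SumBound s (2 * C * ((1 / 2) ^ n - (1 / 2) ^ (n + m))) (u (n + m) - u n) := by
    intro m
    induction m with
    | zero => intro S; simp
    | succ m ih =>
      have h := ih.add (hu (n + m))
      rw [show u (n + m) - u n + (u (n + m + 1) - u (n + m)) = u (n + (m + 1)) - u n by
        rw [← add_assoc]; abel] at h
      refine h.mono (le_of_eq ?_)
      rw [← add_assoc, pow_succ]
      ring
  refine SumBound.of_tendsto (u := fun m => u (m + n) - u n) (Eventually.of_forall fun m => ?_)
    fun k => ((tendsto_add_atTop_iff_nat n).2 (hc k)).sub_const _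
  rw [add_comm m n]
  refine (hm m).mono ?_
  have : (0 : ℝ) ≤ (1 / 2) ^ (n + m) := by positivity
  nlinarith

lemma ApproxFloquet.mono {a U V R : (Fin r → ℤ) → ℂ} {ε : ℂ} {lam w w' u u' e e' : ℝ}
    (H : ApproxFloquet ω a lam w u e U V R ε) (hw : w' = w) (hu : u = u') (he : e ≤ e') :
    ApproxFloquet ω a lam w' u' e' U V R ε := by
  subst hw hu
  exact ⟨H.bound_U, H.bound_V, H.bound_R.mono he, H.inv, H.eqn⟩

/-- The conditions on the constants under which the Newton iteration, started at `U = 1` with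
errors of size `e₀`, converges. -/
theorem exists_floquet_of_small {a U₀ V₀ R₀ : (Fin r → ℤ) → ℂ} {ε₀ : ℂ} {lam A abar B s e₀ H : ℝ}
    {p : ℕ} (hs : 0 < s) (hs1 : s ≤ 1) (H₀ : ApproxFloquet ω a lam s 0 e₀ U₀ V₀ R₀ ε₀)
    (ha : SumBound s A a) (ha0 : a 0 = abar) (habar : 0 < abar) (hB : 0 ≤ B)
    (h0 : DivisorBound ω 0 B p) (h2 : DivisorBound ω (2 * lam) B p) (hlam : 0 < lam)
    (hH : H = 36 * (B * (p.factorial * Real.exp 2) / (s / 8) ^ p) ^ 2 * (2 + 40 * A / abar))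
    (hl : 128 * lam * A * (B * (p.factorial * Real.exp 2) / (s / 2) ^ p) ≤ abar)
    (c1 : (1 + 20 * A / abar) * (H * e₀) * (2 * 4 ^ p) ≤ 1)
    (c2 : 36 * A * (8 * (H * e₀)) ≤ abar) (c3 : H * e₀ ≤ 1 / 2) :
    ∃ U ε, SumBound (s / 2) (8 * (H * e₀)) (U - oneCoeff) ∧
      ∀ t, ev ω (dcoeff ω (dcoeff ω U)) t + 2 * Complex.I * lam * ev ω (dcoeff ω U) t -
        lam ^ 2 * ev ω U t + ε * ev ω a t * ev ω U t = 0 := by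
  have hA := ha.nonneg
  have he0 := H₀.bound_R.nonneg
  have hH0 : 0 ≤ H := by rw [hH]; positivity
  set x : ℕ → ℝ := fun n => (1 / 2 : ℝ) ^ n with hx
  have hx0 : ∀ n, 0 < x n := fun n => by positivity
  have hx1 : ∀ n, x n ≤ 1 := fun n => pow_le_one₀ (by norm_num) (by norm_num)
  have hxs : ∀ n, x (n + 1) = x n / 2 := fun n => by simp only [hx, pow_succ]; ring
  set e : ℕ → ℝ := fun n => e₀ * (1 / (2 * 4 ^ p)) ^ n with he
  have hen : ∀ n, 0 ≤ e n := fun n => by positivity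
  have hHe : ∀ n, 36 * (B * (p.factorial * Real.exp 2) / (s / 8 * x n) ^ p) ^ 2 *
      (2 + 40 * A / abar) * e n = H * e₀ * x n := fun n => by
    have h4 : (x n ^ p) ^ 2 = (1 / 4 ^ p) ^ n := by
      calc (((1 / 2 : ℝ) ^ n) ^ p) ^ 2 = (((1 / 2 : ℝ) ^ 2) ^ p) ^ n := by
            simp only [← pow_mul]
            congr 1
            ring
        _ = (1 / 4 ^ p) ^ n := by
          rw [← one_div_pow]
          norm_num
    have h5 : e n = e₀ * x n * (x n ^ p) ^ 2 := by
      rw [h4]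
      simp only [he, hx]
      rw [mul_assoc, ← mul_pow]
      congr 2
      field_simp
    have h6 : x n ^ p ≠ 0 := (pow_pos (hx0 n) p).ne'
    rw [h5, hH, mul_pow (s / 8)]
    field_simp
  obtain ⟨f, hf⟩ := exists_seq_of_step
    (P := fun n (X : ((Fin r → ℤ) → ℂ) × ((Fin r → ℤ) → ℂ) × ((Fin r → ℤ) → ℂ) × ℂ) =>
      ApproxFloquet ω a lam (s / 2 + s / 2 * x n) (8 * (H * e₀) * (1 - x n)) (e n)
        X.1 X.2.1 X.2.2.1 X.2.2.2)
    (Q := fun n X Y => SumBound (s / 2) (2 * (H * e₀) * x n) (Y.1 - X.1) ∧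
      ‖Y.2.2.2 - X.2.2.2‖ ≤ 10 * e₀ / abar * x n)
    (U₀, V₀, R₀, ε₀) (H₀.mono (by simp [hx]) (by simp [hx]) (by simp [he])) (by
      rintro n ⟨U, V, R, ε⟩ hX
      have hxn := hx0 n
      have hxn1 := hx1 n
      have hHe0 : 0 ≤ H * e₀ := by positivity
      have hsx : s * x n ≤ s := by nlinarith
      obtain ⟨U', V', R', ε', hX', hU, hε⟩ := hX.step (s₀ := s / 2) (σ := s / 8 * x n)
        (h := H * e₀ * x n) (p := p) (B := B)
        (ha.mono_width (by nlinarith)) ha0 habar hB h0 h2 hlam (by positivity) (by linarith)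
        (by positivity) (by nlinarith) (by nlinarith)
        (by
          exact le_trans (mul_le_mul_of_nonneg_left
            (mul_le_of_le_one_right (by positivity) (by linarith)) (by positivity)) c2)
        hl (hHe n).symm (by nlinarith)
      refine ⟨(U', V', R', ε'), hX'.mono ?_ ?_ ?_, ?_, ?_⟩
      · rw [hxs]; ring
      · rw [hxs]; ring
      · have e1 : e (n + 1) = e n * (1 / (2 * 4 ^ p)) := by simp only [he, pow_succ]; ring
        rw [e1]
        calc (1 + 20 * A / abar) * (H * e₀ * x n) * e n
            ≤ (1 + 20 * A / abar) * (H * e₀ * 1) * e n := by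
              have := hen n
              gcongr
          _ = e n * ((1 + 20 * A / abar) * (H * e₀)) := by ring
          _ ≤ e n * (1 / (2 * 4 ^ p)) := by
              refine mul_le_mul_of_nonneg_left ?_ (hen n)
              rw [le_div_iff₀ (by positivity)]
              exact c1
      · refine (hU.mono_width ?_).mono (le_of_eq (by ring))
        nlinarith
      · refine hε.trans ?_
        rw [div_mul_eq_mul_div]
        refine div_le_div_of_nonneg_right ?_ habar.le
        rw [mul_assoc]
        refine mul_le_mul_of_nonneg_left ?_ (by norm_num)
        simp only [he, hx]
        refine mul_le_mul_of_nonneg_left ?_ he0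
        refine pow_le_pow_left₀ (by positivity) ?_ n
        refine one_div_le_one_div_of_le (by norm_num) ?_
        have : (1 : ℝ) ≤ 4 ^ p := one_le_pow₀ (by norm_num)
        linarith)
  obtain ⟨U, hUlim, hU⟩ := exists_limit_of_geometric (u := fun n => (f n).1) (s := s / 2)
    (C := 2 * (H * e₀)) (by positivity) fun n => (hf n).2.1
  obtain ⟨ε, hε⟩ := cauchySeq_tendsto_of_complete
    (cauchySeq_of_le_geometric (f := fun n => (f n).2.2.2) (1 / 2) (10 * e₀ / abar) (by norm_num)
      fun n => by
        rw [dist_comm, dist_eq_norm]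
        exact (hf n).2.2)
  have hHe0 : 0 ≤ H * e₀ := by positivity
  have hwn : ∀ n, s / 2 ≤ s / 2 + s / 2 * x n := fun n => by
    have := hx0 n
    nlinarith
  have hbn : ∀ n, SumBound (s / 2) (8 * (H * e₀)) ((f n).1 - oneCoeff) := fun n =>
    ((hf n).1.bound_U.mono_width (hwn n)).mono (by
      have := hx0 n
      nlinarith)
  have hUb : SumBound (s / 2) (8 * (H * e₀)) (U - oneCoeff) :=
    SumBound.of_tendsto (Eventually.of_forall hbn) fun k => (hUlim k).sub_const _
  refine ⟨U, ε, hUb, fun t => ?_⟩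
  have b0 : SumBound (s / 2) (8 * (H * e₀) + 1) U := by
    simpa using hUb.add (sumBound_oneCoeff (s / 2))
  have bn : ∀ n, SumBound (s / 2) (8 * (H * e₀) + 1) (f n).1 := fun n => by
    simpa using (hbn n).add (sumBound_oneCoeff (s / 2))
  have hs4 : 0 < s / 4 := by positivity
  have hs41 : s / 4 ≤ 1 := by linarith
  have hβ : ∀ K : ℝ, Tendsto (fun n : ℕ => K * (2 * (2 * (H * e₀)) * (1 / 2) ^ n)) atTop (𝓝 0) :=
    fun K => by
      simpa using ((tendsto_pow_atTop_nhds_zero_of_lt_one (by norm_num : (0 : ℝ) ≤ 1 / 2)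
        (by norm_num)).const_mul (2 * (2 * (H * e₀)))).const_mul K
  have l0 : Tendsto (fun n => ev ω (f n).1 t) atTop (𝓝 (ev ω U t)) :=
    tendsto_ev_of_sumBound (fun n => (bn n).mono_width (by linarith)) (b0.mono_width (by linarith))
      (fun n => ((hU n).mono_width (by linarith))) (by simpa using hβ 1) t
  set K := (∑ j, |ω j|) * Real.exp 2 / (s / 4) with hK
  have d1 := fun {N : ℝ} {c : (Fin r → ℤ) → ℂ} (h : SumBound (s / 2) N c) =>
    (h.dcoeff hs4 hs41 ω).mono_width (s' := s / 4) (by linarith)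
  have d2 := fun {N : ℝ} {c : (Fin r → ℤ) → ℂ} (h : SumBound (s / 4) N c) =>
    (h.dcoeff hs4 hs41 ω).mono_width (s' := 0) (by linarith)
  have l1 : Tendsto (fun n => ev ω (dcoeff ω (f n).1) t) atTop (𝓝 (ev ω (dcoeff ω U) t)) := by
    refine tendsto_ev_of_sumBound (fun n => (d1 (bn n)).mono_width hs4.le)
      ((d1 b0).mono_width hs4.le) (fun n => ?_) (hβ K) t
    rw [← dcoeff_sub]
    exact (d1 (hU n)).mono_width hs4.le
  have l2 : Tendsto (fun n => ev ω (dcoeff ω (dcoeff ω (f n).1)) t) atTop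
      (𝓝 (ev ω (dcoeff ω (dcoeff ω U)) t)) := by
    refine tendsto_ev_of_sumBound (fun n => d2 (d1 (bn n))) (d2 (d1 b0)) (fun n => ?_)
      (hβ (K * K)) t
    rw [← dcoeff_sub, ← dcoeff_sub, mul_assoc]
    exact d2 (d1 (hU n))
  have lR : Tendsto (fun n => ev ω (f n).2.2.1 t) atTop (𝓝 0) := by
    refine squeeze_zero_norm (a := e) (fun n => ?_) ?_
    · exact ((hf n).1.bound_R.mono_width (by linarith [hwn n])).norm_ev_le t
    · have h4 : (1 : ℝ) ≤ 4 ^ p := one_le_pow₀ (by norm_num)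
      have : Tendsto e atTop (𝓝 (e₀ * 0)) :=
        (tendsto_pow_atTop_nhds_zero_of_lt_one (r := 1 / (2 * 4 ^ p : ℝ)) (by positivity)
          (by rw [div_lt_one (by positivity)]; linarith)).const_mul e₀
      rwa [mul_zero] at this
  have lL := ((l2.add (l1.const_mul (2 * Complex.I * lam))).sub (l0.const_mul ((lam : ℂ) ^ 2))).add
    ((hε.mul_const (ev ω a t)).mul l0)
  exact tendsto_nhds_unique (lL.congr fun n => (hf n).1.eqn t) lR

/-- Reducibility of the Hill equation: if `⟨k, ω⟩` and `⟨k, ω⟩ + 2 λ` satisfy the divisor bound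
and `λ` is small, there is a parameter `ε`, at first complex, for which the equation has a Floquet
solution `e^{i λ t} U(t)` with `U` quasi-periodic of frequency `ω` and `U - 1 = O(λ²)`. -/
theorem exists_floquet {a : (Fin r → ℤ) → ℂ} {A abar B s : ℝ} {p : ℕ} (hs : 0 < s) (hs1 : s ≤ 1)
    (ha : SumBound s A a) (ha0 : a 0 = abar) (habar : 0 < abar) (hB : 0 ≤ B)
    (h0 : DivisorBound ω 0 B p) :
    ∃ lam₀ K : ℝ, 0 < lam₀ ∧ 0 ≤ K ∧ ∀ lam : ℝ, 0 < lam → lam ≤ lam₀ →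
      DivisorBound ω (2 * lam) B p →
      ∃ U ε, SumBound (s / 2) (K * lam ^ 2) (U - oneCoeff) ∧
        ∀ t, ev ω (dcoeff ω (dcoeff ω U)) t + 2 * Complex.I * lam * ev ω (dcoeff ω U) t -
          lam ^ 2 * ev ω U t + ε * ev ω a t * ev ω U t = 0 := by
  have hA := ha.nonneg
  obtain ⟨H, hH⟩ : ∃ H, H =
    36 * (B * (p.factorial * Real.exp 2) / (s / 8) ^ p) ^ 2 * (2 + 40 * A / abar) := ⟨_, rfl⟩
  have hH0 : 0 ≤ H := by rw [hH]; positivity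
  set K₀ := A / abar + 1 with hK₀
  have hK₀0 : 0 ≤ K₀ := by positivity
  set X₁ := (1 + 20 * A / abar) * (H * K₀) * (2 * 4 ^ p) with hX₁
  set X₂ := 36 * A * (8 * (H * K₀)) / abar with hX₂
  set X₃ := 2 * (H * K₀) with hX₃
  set X₄ := 128 * A * (B * (p.factorial * Real.exp 2) / (s / 2) ^ p) / abar with hX₄
  have p₁ : 0 ≤ X₁ := by positivity
  have p₂ : 0 ≤ X₂ := by positivity
  have p₃ : 0 ≤ X₃ := by positivity
  have p₄ : 0 ≤ X₄ := by positivity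
  set Λ := 1 + (X₁ + X₂ + X₃ + X₄) with hΛ
  have hΛpos : 0 < Λ := by positivity
  refine ⟨1 / Λ, 8 * (H * K₀), by positivity, by positivity, fun lam hlam hle h2 => ?_⟩
  have hΛl : Λ * lam ≤ 1 := by
    rw [le_div_iff₀ hΛpos] at hle
    linarith
  have hlam1 : lam ≤ 1 := by nlinarith
  have hsq : lam ^ 2 ≤ lam := by nlinarith
  have small : ∀ X, 0 ≤ X → X ≤ Λ → X * lam ≤ 1 := fun X hX hXΛ =>
    (mul_le_mul_of_nonneg_right hXΛ hlam.le).trans hΛl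
  have small2 : ∀ X, 0 ≤ X → X ≤ Λ → X * lam ^ 2 ≤ 1 := fun X hX hXΛ =>
    (mul_le_mul_of_nonneg_left hsq hX).trans (small X hX hXΛ)
  have s₁ := small2 X₁ p₁ (by linarith)
  have s₂ := small2 X₂ p₂ (by linarith)
  have s₃ := small2 X₃ p₃ (by linarith)
  have s₄ := small X₄ p₄ (by linarith)
  have hε0 : ‖((lam ^ 2 / abar : ℝ) : ℂ)‖ = lam ^ 2 / abar := by
    rw [Complex.norm_real, Real.norm_of_nonneg (by positivity)]
  have hl2 : ‖((lam ^ 2 : ℝ) : ℂ)‖ = lam ^ 2 := by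
    rw [Complex.norm_real, Real.norm_of_nonneg (by positivity)]
  have bR : SumBound s (K₀ * lam ^ 2)
      (((lam ^ 2 / abar : ℝ) : ℂ) • a - ((lam ^ 2 : ℝ) : ℂ) • oneCoeff) := by
    refine ((ha.smul _).sub ((sumBound_oneCoeff s).smul _)).mono (le_of_eq ?_)
    rw [hε0, hl2, hK₀]
    ring
  have H₀ : ApproxFloquet ω a lam s 0 (K₀ * lam ^ 2) oneCoeff oneCoeff
      (((lam ^ 2 / abar : ℝ) : ℂ) • a - ((lam ^ 2 : ℝ) : ℂ) • oneCoeff)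
      ((lam ^ 2 / abar : ℝ) : ℂ) := by
    refine ⟨?_, ?_, bR, fun t => by simp [ev_oneCoeff], fun t => ?_⟩
    · intro S; simp
    · intro S; simp
    · have hz : dcoeff ω (0 : (Fin r → ℤ) → ℂ) = 0 := by ext k; simp [dcoeff]
      have hz' : ev ω (0 : (Fin r → ℤ) → ℂ) t = 0 := by simp [ev]
      rw [dcoeff_oneCoeff, hz, hz', ev_oneCoeff, ev_sub ((ha.mono_width hs.le).smul _)
        ((sumBound_oneCoeff 0).smul _), ev_smul, ev_smul, ev_oneCoeff]
      push_cast
      ring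
  obtain ⟨U, ε, hU, hε⟩ := exists_floquet_of_small hs hs1 H₀ ha ha0 habar hB h0 h2 hlam hH
    (by
      rw [hX₄, div_mul_eq_mul_div, div_le_one habar] at s₄
      linarith)
    (by
      rw [hX₁] at s₁
      linarith)
    (by
      rw [hX₂, div_mul_eq_mul_div, div_le_one habar] at s₂
      linarith)
    (by
      rw [hX₃] at s₃
      linarith)
  exact ⟨U, ε, hU.mono (le_of_eq (by ring)), hε⟩

end

section

variable {r : ℕ} {ω : Fin r → ℝ}

/-! ### Reality and Lipschitz dependence of the parameter -/

/-- `e^{i λ t} U(t)` is a Floquet solution of the Hill equation with parameter `ε`; the amplitude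
`U` is within `u` of `1` in width `s`, and its derivative is bounded by `D`. -/
structure IsFloquet (ω : Fin r → ℝ) (a : (Fin r → ℤ) → ℂ) (s u D lam : ℝ)
    (U : (Fin r → ℤ) → ℂ) (ε : ℂ) : Prop where
  bound : SumBound s u (U - oneCoeff)
  dbound : SumBound 0 D (dcoeff ω U)
  eqn : ∀ t, ev ω (dcoeff ω (dcoeff ω U)) t + 2 * Complex.I * lam * ev ω (dcoeff ω U) t -
    lam ^ 2 * ev ω U t + ε * ev ω a t * ev ω U t = 0

lemma dcoeff_zero_apply (c : (Fin r → ℤ) → ℂ) : dcoeff ω c 0 = 0 := by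
  simp [dcoeff, pairing_zero]

lemma SumBound.exists_ddcoeff {s M : ℝ} {c : (Fin r → ℤ) → ℂ} (hs : 0 < s) (hc : SumBound s M c)
    (ω : Fin r → ℝ) : ∃ M', SumBound 0 M' (QPHill.dcoeff ω (QPHill.dcoeff ω c)) := by
  obtain ⟨M₁, h₁⟩ := hc.exists_dcoeff hs ω
  obtain ⟨M₂, h₂⟩ := h₁.exists_dcoeff (by positivity) ω
  exact ⟨M₂, h₂.mono_width (by positivity)⟩

/-- The mean of the equation. -/
lemma IsFloquet.mean_eq (hω : ∀ k : Fin r → ℤ, k ≠ 0 → pairing k ω ≠ 0) {a U : (Fin r → ℤ) → ℂ}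
    {s u D lam A abar : ℝ} {ε : ℂ} (H : IsFloquet ω a s u D lam U ε) (hs : 0 < s) (hu : u ≤ 1)
    (ha : SumBound 0 A a) (ha0 : a 0 = abar) :
    ∃ z w : ℂ, ‖z - 1‖ ≤ u ∧ ‖w - abar‖ ≤ A * u ∧ lam ^ 2 * z = ε * w := by
  have bU := sumBound_two_of_sub_one H.bound hu
  obtain ⟨M₁, bD⟩ := bU.exists_dcoeff hs ω
  obtain ⟨M₂, bDD⟩ := bU.exists_ddcoeff hs ω
  have bD0 := bD.mono_width (s' := 0) (by positivity)
  have bU0 := bU.mono_width hs.le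
  have baU := ha.conv le_rfl bU0
  have baU1 := ha.conv le_rfl (H.bound.mono_width hs.le)
  refine ⟨U 0, conv a U 0, ?_, ?_, ?_⟩
  · have := (H.bound.mono_width hs.le).norm_apply_le 0
    simpa [oneCoeff] using this
  · have h1 : (conv a U - a) 0 = conv a (U - oneCoeff) 0 :=
      coeff_zero_eq_of_ev_eq hω (baU.sub ha) baU1 fun t => by
        rw [ev_sub baU ha, ev_conv ha bU0, ev_conv ha (H.bound.mono_width hs.le),
          ev_sub bU0 (sumBound_oneCoeff 0), ev_oneCoeff]
        ring
    have h2 := baU1.norm_apply_le 0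
    rwa [← h1, Pi.sub_apply, ha0] at h2
  · have h := coeff_zero_eq_of_ev_eq (c := dcoeff ω (dcoeff ω U) +
        (2 * Complex.I * lam) • dcoeff ω U + ε • conv a U) (d := ((lam : ℂ) ^ 2) • U) hω
      ((bDD.add (bD0.smul _)).add (baU.smul _)) (bU0.smul _) fun t => by
        rw [ev_add (bDD.add (bD0.smul _)) (baU.smul _), ev_add bDD (bD0.smul _), ev_smul, ev_smul,
          ev_smul, ev_conv ha bU0]
        linear_combination H.eqn t
    simp only [Pi.add_apply, Pi.smul_apply, dcoeff_zero_apply, smul_eq_mul, mul_zero, zero_add] at h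
    exact h.symm

/-- The mean of the Wronskian of a Floquet solution and the conjugate of another one relates the
two parameters to the two Floquet exponents. -/
lemma IsFloquet.wronskian_mean (hω : ∀ k : Fin r → ℤ, k ≠ 0 → pairing k ω ≠ 0)
    {a U₁ U₂ : (Fin r → ℤ) → ℂ} {s u₁ u₂ D₁ D₂ l₁ l₂ A abar : ℝ} {ε₁ ε₂ : ℂ}
    (H₁ : IsFloquet ω a s u₁ D₁ l₁ U₁ ε₁) (H₂ : IsFloquet ω a s u₂ D₂ l₂ U₂ ε₂)
    (hs : 0 < s) (hu₁ : u₁ ≤ 1) (hu₂ : u₂ ≤ 1) (ha : SumBound 0 A a) (ha0 : a 0 = abar)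
    (hreal : ∀ t, (starRingEnd ℂ) (ev ω a t) = ev ω a t) :
    ∃ x y : ℂ, ‖x‖ ≤ 2 * D₁ + 2 * D₂ + |l₁ + l₂| * (u₁ + 2 * u₂) ∧
      ‖y - abar‖ ≤ A * (u₁ + 2 * u₂) ∧
      Complex.I * (l₁ - l₂) * (Complex.I * (l₁ + l₂) + x) = -((ε₁ - (starRingEnd ℂ) ε₂) * y) := by
  set X : (Fin r → ℤ) → ℂ := fun k => (starRingEnd ℂ) (U₂ (-k)) with hX
  have bU := sumBound_two_of_sub_one H₁.bound hu₁
  have bX : SumBound s 2 X := (sumBound_two_of_sub_one H₂.bound hu₂).conj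
  have bU0 := bU.mono_width hs.le
  have bX0 := bX.mono_width hs.le
  obtain ⟨M₁, bDDU⟩ := bU.exists_ddcoeff hs ω
  obtain ⟨M₂, bDDX⟩ := bX.exists_ddcoeff hs ω
  have hDX : dcoeff ω X = fun k => (starRingEnd ℂ) (dcoeff ω U₂ (-k)) := by
    ext k
    simp only [dcoeff, hX, map_mul, Complex.conj_ofReal, Complex.conj_I, pairing_neg]
    push_cast
    ring
  have hDDX : dcoeff ω (dcoeff ω X) = fun k => (starRingEnd ℂ) (dcoeff ω (dcoeff ω U₂) (-k)) := by
    rw [hDX]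
    ext k
    simp only [dcoeff, map_mul, Complex.conj_ofReal, Complex.conj_I, pairing_neg]
    push_cast
    ring
  have bDX : SumBound 0 D₂ (dcoeff ω X) := by
    rw [hDX]
    exact H₂.dbound.conj
  have bX1 : SumBound 0 u₂ (X - oneCoeff) := by
    have := (H₂.bound.mono_width hs.le).conj
    convert this using 1
    ext k
    by_cases hk : k = 0
    · subst hk; simp [hX, oneCoeff]
    · simp [hX, oneCoeff, hk]
  have eqX : ∀ t, ev ω (dcoeff ω (dcoeff ω X)) t - 2 * Complex.I * l₂ * ev ω (dcoeff ω X) t -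
      l₂ ^ 2 * ev ω X t + (starRingEnd ℂ) ε₂ * ev ω a t * ev ω X t = 0 := fun t => by
    have := congrArg (starRingEnd ℂ) (H₂.eqn t)
    simp only [map_add, map_sub, map_mul, map_pow, hreal, Complex.conj_I, Complex.conj_ofReal,
      map_zero, map_ofNat, conj_ev] at this
    rw [hDDX, hDX]
    linear_combination this
  -- `g` is the Wronskian stripped of its exponential factor
  set g := conv (dcoeff ω U₁) X - conv U₁ (dcoeff ω X) +
    (Complex.I * (l₁ + l₂)) • conv U₁ X with hg
  have b1 := H₁.dbound.conv le_rfl bX0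
  have b2 := bU0.conv le_rfl bDX
  have b3 := bU0.conv le_rfl bX0
  have bg := (b1.sub b2).add (b3.smul (Complex.I * (l₁ + l₂)))
  have evg : ∀ t, ev ω g t = ev ω (dcoeff ω U₁) t * ev ω X t - ev ω U₁ t * ev ω (dcoeff ω X) t +
      Complex.I * (l₁ + l₂) * (ev ω U₁ t * ev ω X t) := fun t => by
    rw [hg, ev_add (b1.sub b2) (b3.smul _), ev_sub b1 b2, ev_smul, ev_conv H₁.dbound bX0,
      ev_conv bU0 bDX, ev_conv bU0 bX0]
  have b5 := ha.conv le_rfl b3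
  obtain ⟨M₃, bDg⟩ : ∃ M, SumBound 0 M (dcoeff ω g) := by
    obtain ⟨N₁, n₁⟩ := bU.exists_dcoeff hs ω
    obtain ⟨N₂, n₂⟩ := bX.exists_dcoeff hs ω
    have hs2 : 0 < s / 2 := by positivity
    have h := ((n₁.conv hs2.le (bX.mono_width (by linarith))).sub
      ((bU.mono_width (by linarith)).conv hs2.le n₂)).add
      (((bU.conv hs.le bX).mono_width (by linarith : s / 2 ≤ s)).smul (Complex.I * (l₁ + l₂)))
    obtain ⟨N, n⟩ := h.exists_dcoeff hs2 ω
    exact ⟨N, n.mono_width (by positivity)⟩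
  have hderiv : ∀ t, ev ω (dcoeff ω g) t = ev ω ((-(Complex.I * (l₁ - l₂))) • g -
      (ε₁ - (starRingEnd ℂ) ε₂) • conv a (conv U₁ X)) t := fun t => by
    rw [ev_sub (bg.smul _) (b5.smul _), ev_smul, ev_smul, ev_conv ha b3, ev_conv bU0 bX0]
    have dU := hasDerivAt_ev bU0 H₁.dbound t
    have dX := hasDerivAt_ev bX0 bDX t
    have dDU := hasDerivAt_ev H₁.dbound bDDU t
    have dDX := hasDerivAt_ev bDX bDDX t
    have h := hasDerivAt_ev bg bDg t
    have dg' := (((dDU.mul dX).sub (dU.mul dDX)).add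
      ((dU.mul dX).const_mul (Complex.I * (l₁ + l₂))))
    have hfun : ev ω g = fun t => ev ω (dcoeff ω U₁) t * ev ω X t -
        ev ω U₁ t * ev ω (dcoeff ω X) t + Complex.I * (l₁ + l₂) * (ev ω U₁ t * ev ω X t) :=
      funext evg
    rw [← hg, hfun] at h
    have h' := h.unique dg'
    rw [h', evg]
    have hI := Complex.I_sq
    linear_combination (ev ω X t) * H₁.eqn t - ev ω U₁ t * eqX t +
      ((l₁ - l₂) * (l₁ + l₂) * ev ω U₁ t * ev ω X t) * hI
  have hmean := coeff_zero_eq_of_ev_eq hω bDg ((bg.smul _).sub (b5.smul _)) hderiv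
  rw [dcoeff_zero_apply, Pi.sub_apply, Pi.smul_apply, Pi.smul_apply, smul_eq_mul,
    smul_eq_mul] at hmean
  -- the product of the amplitudes is close to `1`
  have hu₂0 := bX1.nonneg
  have bUX : SumBound 0 (u₁ + 2 * u₂) (conv U₁ (X - oneCoeff) + (U₁ - oneCoeff)) :=
    ((bU0.conv le_rfl bX1).add (H₁.bound.mono_width hs.le)).mono (by linarith)
  have evUX : ∀ t, ev ω (conv U₁ (X - oneCoeff) + (U₁ - oneCoeff)) t =
      ev ω U₁ t * ev ω X t - 1 := fun t => by
    rw [ev_add (bU0.conv le_rfl bX1) (H₁.bound.mono_width hs.le), ev_conv bU0 bX1,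
      ev_sub bX0 (sumBound_oneCoeff 0), ev_sub bU0 (sumBound_oneCoeff 0), ev_oneCoeff]
    ring
  have b6 := ha.conv le_rfl bUX
  refine ⟨g 0 - Complex.I * (l₁ + l₂), conv a (conv U₁ X) 0, ?_, ?_, ?_⟩
  · have b7 := (b1.sub b2).add (bUX.smul (Complex.I * (l₁ + l₂)))
    have h1 := coeff_zero_eq_of_ev_eq (c := g - (Complex.I * (l₁ + l₂)) • oneCoeff)
      (d := conv (dcoeff ω U₁) X - conv U₁ (dcoeff ω X) + (Complex.I * (l₁ + l₂)) •
        (conv U₁ (X - oneCoeff) + (U₁ - oneCoeff))) hω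
      (bg.sub ((sumBound_oneCoeff 0).smul _)) b7 fun t => by
        rw [ev_sub bg ((sumBound_oneCoeff 0).smul _), ev_smul, ev_oneCoeff, evg,
          ev_add (b1.sub b2) (bUX.smul _), ev_sub b1 b2, ev_smul, ev_conv H₁.dbound bX0,
          ev_conv bU0 bDX, evUX]
        ring
    have h2 := b7.norm_apply_le 0
    rw [← h1] at h2
    have h3 : ‖Complex.I * ((l₁ : ℂ) + l₂)‖ = |l₁ + l₂| := by
      rw [norm_mul, Complex.norm_I, one_mul, ← Complex.ofReal_add, Complex.norm_real,
        Real.norm_eq_abs]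
    rw [h3] at h2
    simp only [Pi.sub_apply, Pi.smul_apply, oneCoeff, Pi.single_eq_same, smul_eq_mul,
      mul_one] at h2
    linarith
  · have h1 : (conv a (conv U₁ X) - a) 0 =
        conv a (conv U₁ (X - oneCoeff) + (U₁ - oneCoeff)) 0 :=
      coeff_zero_eq_of_ev_eq hω (b5.sub ha) b6 fun t => by
        rw [ev_sub b5 ha, ev_conv ha b3, ev_conv ha bUX, evUX, ev_conv bU0 bX0]
        ring
    have h2 := b6.norm_apply_le 0
    rwa [← h1, Pi.sub_apply, ha0] at h2
  · linear_combination hmean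

lemma norm_div_sub_one_le {x y : ℂ} (hx : ‖x - 1‖ ≤ 1 / 20) (hy : ‖y - 1‖ ≤ 1 / 20) :
    ‖x / y - 1‖ ≤ 1 / 2 := by
  have h1 := norm_le_norm_add_norm_sub y 1
  rw [norm_one] at h1
  have hy0 : y ≠ 0 := fun h => by rw [h] at hy; norm_num at hy
  have h2 : x / y - 1 = ((x - 1) - (y - 1)) / y := by field_simp; ring
  have h3 := norm_sub_le (x - 1) (y - 1)
  rw [h2, norm_div, div_le_iff₀ (norm_pos_iff.2 hy0)]
  linarith

/-- The parameters of two Floquet solutions of small exponents: `ε₁ - conj ε₂` is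
`(λ₁² - λ₂²) / ā` up to a relative error `1 / 2`. -/
lemma IsFloquet.param_sub (hω : ∀ k : Fin r → ℤ, k ≠ 0 → pairing k ω ≠ 0)
    {a U₁ U₂ : (Fin r → ℤ) → ℂ} {s u₁ u₂ D₁ D₂ l₁ l₂ A abar : ℝ} {ε₁ ε₂ : ℂ}
    (H₁ : IsFloquet ω a s u₁ D₁ l₁ U₁ ε₁) (H₂ : IsFloquet ω a s u₂ D₂ l₂ U₂ ε₂)
    (hs : 0 < s) (ha : SumBound 0 A a) (ha0 : a 0 = abar) (habar : 0 < abar)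
    (hreal : ∀ t, (starRingEnd ℂ) (ev ω a t) = ev ω a t)
    (hl₁ : 0 < l₁) (hl₂ : 0 < l₂) (hu₁ : u₁ ≤ 1 / 100) (hu₂ : u₂ ≤ 1 / 100)
    (hA₁ : A * u₁ ≤ abar / 100) (hA₂ : A * u₂ ≤ abar / 100)
    (hD₁ : D₁ ≤ l₁ / 100) (hD₂ : D₂ ≤ l₂ / 100) :
    ‖ε₁ - (starRingEnd ℂ) ε₂ - ((l₁ ^ 2 - l₂ ^ 2) / abar : ℝ)‖ ≤
      |l₁ ^ 2 - l₂ ^ 2| / (2 * abar) := by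
  obtain ⟨x, y, hx, hy, hxy⟩ := H₁.wronskian_mean hω H₂ hs (by linarith) (by linarith) ha ha0 hreal
  have hl : 0 < l₁ + l₂ := by linarith
  have hlc : (l₁ : ℂ) + l₂ ≠ 0 := by exact_mod_cast hl.ne'
  have hac : (abar : ℂ) ≠ 0 := by exact_mod_cast habar.ne'
  rw [abs_of_pos hl] at hx
  set P : ℂ := 1 + x / (Complex.I * (l₁ + l₂)) with hP
  set Q : ℂ := y / abar with hQ
  have hP1 : ‖P - 1‖ ≤ 1 / 20 := by
    rw [hP, add_sub_cancel_left, norm_div, norm_mul, Complex.norm_I, one_mul, ← Complex.ofReal_add,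
      Complex.norm_real, Real.norm_of_nonneg hl.le, div_le_iff₀ hl]
    nlinarith
  have hQ1 : ‖Q - 1‖ ≤ 1 / 20 := by
    have : Q - 1 = (y - abar) / abar := by rw [hQ]; field_simp
    rw [this, norm_div, Complex.norm_real, Real.norm_of_nonneg habar.le, div_le_iff₀ habar]
    linarith
  have hQ0 : Q ≠ 0 := fun h => by
    rw [h] at hQ1
    norm_num at hQ1
  have hI := Complex.I_ne_zero
  have hy0 : y ≠ 0 := fun h => hQ0 (by rw [hQ, h, zero_div])
  have key : ε₁ - (starRingEnd ℂ) ε₂ - ((l₁ ^ 2 - l₂ ^ 2) / abar : ℝ) =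
      ((l₁ ^ 2 - l₂ ^ 2) / abar : ℝ) * (P / Q - 1) := by
    have e1 : ε₁ - (starRingEnd ℂ) ε₂ =
        -(Complex.I * (l₁ - l₂) * (Complex.I * (l₁ + l₂) + x)) / y := by
      rw [hxy]
      field_simp
    rw [e1, hP, hQ]
    push_cast
    field_simp
    linear_combination (-(abar * ((l₁ : ℂ) ^ 2 - l₂ ^ 2) * (Complex.I * (l₁ + l₂) + x))) *
      Complex.I_sq
  rw [key, norm_mul, Complex.norm_real, Real.norm_eq_abs, abs_div, abs_of_pos habar]
  calc |l₁ ^ 2 - l₂ ^ 2| / abar * ‖P / Q - 1‖ ≤ |l₁ ^ 2 - l₂ ^ 2| / abar * (1 / 2) := by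
        have := norm_div_sub_one_le hP1 hQ1
        gcongr
    _ = _ := by field_simp

end

section

variable {r : ℕ} {ω : Fin r → ℝ}

/-- The Floquet solutions for all small nonresonant exponents `λ`, with real parameters `ε(λ)`.
As a function of `λ²`, the difference `ε - λ² / ā` has Lipschitz constant `1 / (2 ā)`. -/
theorem exists_real_floquet {a : (Fin r → ℤ) → ℂ} {A abar B s : ℝ} {p : ℕ} (hs : 0 < s)
    (hs1 : s ≤ 1) (ha : SumBound s A a) (ha0 : a 0 = abar) (habar : 0 < abar)
    (hreal : ∀ t, (starRingEnd ℂ) (ev ω a t) = ev ω a t) (hB : 0 ≤ B)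
    (h0 : DivisorBound ω 0 B p) :
    ∃ (lam₀ C : ℝ) (U : ℝ → (Fin r → ℤ) → ℂ) (ε : ℝ → ℝ), 0 < lam₀ ∧
      (∀ lam, 0 < lam → lam ≤ lam₀ → DivisorBound ω (2 * lam) B p →
        IsFloquet ω a (s / 2) (1 / 100) (lam / 100) lam (U lam) (ε lam) ∧ 0 < ε lam ∧
        |lam ^ 2 - abar * ε lam| ≤ C * ε lam ^ 2 ∧ |lam ^ 2 - abar * ε lam| ≤ lam ^ 2 / 2) ∧
      ∀ l₁ l₂, 0 < l₁ → l₁ ≤ lam₀ → DivisorBound ω (2 * l₁) B p → 0 < l₂ → l₂ ≤ lam₀ →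
        DivisorBound ω (2 * l₂) B p →
        |ε l₁ - ε l₂ - (l₁ ^ 2 - l₂ ^ 2) / abar| ≤ |l₁ ^ 2 - l₂ ^ 2| / (2 * abar) := by
  have hωne : ∀ k : Fin r → ℤ, k ≠ 0 → pairing k ω ≠ 0 := fun k hk => by
    simpa using h0.ne_zero hk
  have hA := ha.nonneg
  have ha' : SumBound 0 A a := ha.mono_width hs.le
  obtain ⟨lam₁, K, hlam₁, hK, hex⟩ := exists_floquet hs hs1 ha ha0 habar hB h0
  choose! U ε hU using hex
  set KD := (∑ j, |ω j|) * Real.exp 2 / (s / 2) * K with hKD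
  have hKD0 : 0 ≤ KD := by
    have : 0 ≤ ∑ j, |ω j| := Finset.sum_nonneg fun _ _ => abs_nonneg _
    positivity
  set Λ := 1 + (100 * K + 100 * (A * K / abar) + 100 * KD) with hΛ
  have t1 : 0 ≤ A * K / abar := by positivity
  have hΛpos : 0 < Λ := by positivity
  have hdata : ∀ lam, 0 < lam → lam ≤ min lam₁ (1 / Λ) → DivisorBound ω (2 * lam) B p →
      IsFloquet ω a (s / 2) (K * lam ^ 2) (KD * lam ^ 2) lam (U lam) (ε lam) ∧
        K * lam ^ 2 ≤ 1 / 100 ∧ A * (K * lam ^ 2) ≤ abar / 100 ∧ KD * lam ^ 2 ≤ lam / 100 := by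
    intro lam hl hle h2
    obtain ⟨hb, heq⟩ := hU lam hl (hle.trans (min_le_left _ _)) h2
    have hd : SumBound 0 (KD * lam ^ 2) (dcoeff ω (U lam)) := by
      have h1 := hb.dcoeff (σ := s / 2) (by positivity) (by linarith) ω
      rw [dcoeff_sub, dcoeff_oneCoeff, sub_zero, sub_self, ← mul_assoc] at h1
      exact h1
    have hΛl : Λ * lam ≤ 1 := by
      have := hle.trans (min_le_right _ _)
      rw [le_div_iff₀ hΛpos] at this
      linarith
    have hlam1 : lam ≤ 1 := by nlinarith
    have hsq : lam ^ 2 ≤ lam := by nlinarith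
    have small : ∀ X, 0 ≤ X → 100 * X ≤ Λ → X * lam ≤ 1 / 100 := fun X hX hXΛ => by
      have := mul_le_mul_of_nonneg_right hXΛ hl.le
      linarith
    refine ⟨⟨hb, hd, heq⟩, ?_, ?_, ?_⟩
    · exact (mul_le_mul_of_nonneg_left hsq hK).trans (small K hK (by linarith))
    · have h1 := (mul_le_mul_of_nonneg_left hsq t1).trans (small _ t1 (by linarith))
      have h2 : A * K / abar * lam ^ 2 = A * (K * lam ^ 2) / abar := by ring
      rw [h2, div_le_iff₀ habar] at h1
      linarith
    · have := small KD hKD0 (by linarith)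
      nlinarith
  have hsub : ∀ l₁ l₂, 0 < l₁ → l₁ ≤ min lam₁ (1 / Λ) → DivisorBound ω (2 * l₁) B p → 0 < l₂ →
      l₂ ≤ min lam₁ (1 / Λ) → DivisorBound ω (2 * l₂) B p →
      ‖ε l₁ - (starRingEnd ℂ) (ε l₂) - ((l₁ ^ 2 - l₂ ^ 2) / abar : ℝ)‖ ≤
        |l₁ ^ 2 - l₂ ^ 2| / (2 * abar) := by
    intro l₁ l₂ p₁ q₁ d₁ p₂ q₂ d₂
    obtain ⟨F₁, x₁, y₁, z₁⟩ := hdata l₁ p₁ q₁ d₁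
    obtain ⟨F₂, x₂, y₂, z₂⟩ := hdata l₂ p₂ q₂ d₂
    exact F₁.param_sub hωne F₂ (by positivity) ha' ha0 habar hreal p₁ p₂ x₁ x₂ y₁ y₂ z₁ z₂
  -- comparing a solution with itself shows that its parameter is real
  have hre : ∀ lam, 0 < lam → lam ≤ min lam₁ (1 / Λ) → DivisorBound ω (2 * lam) B p →
      ε lam = ((ε lam).re : ℂ) := by
    intro lam hl hle h2
    have h := hsub lam lam hl hle h2 hl hle h2
    simp only [sub_self, zero_div, Complex.ofReal_zero, sub_zero, abs_zero] at h
    have h' := norm_le_zero_iff.1 h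
    exact (Complex.conj_eq_iff_re.1 (sub_eq_zero.1 h').symm).symm
  refine ⟨min lam₁ (1 / Λ), 4 * abar ^ 2 * K + 2 * abar * A * K, U, fun l => (ε l).re,
    lt_min hlam₁ (by positivity), ?_, ?_⟩
  · intro lam hl hle h2
    obtain ⟨F, x, y, z⟩ := hdata lam hl hle h2
    have hεre := hre lam hl hle h2
    obtain ⟨ζ, w, hζ, hw, hm⟩ := F.mean_eq hωne (by positivity) (by linarith) ha' ha0
    have hlpos : 0 < lam ^ 2 := by positivity
    set e := (ε lam).re with he
    rw [hεre] at hm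
    have hn1 : ‖((abar * e - lam ^ 2 : ℝ) : ℂ)‖ ≤ lam ^ 2 * (K * lam ^ 2) +
        |e| * (A * (K * lam ^ 2)) := by
      have : ((abar * e - lam ^ 2 : ℝ) : ℂ) = ((lam ^ 2 : ℝ) : ℂ) * (ζ - 1) - (e : ℂ) * (w - abar) := by
        push_cast
        linear_combination (-1 : ℂ) * hm
      rw [this]
      refine (norm_sub_le _ _).trans ?_
      rw [norm_mul, norm_mul, Complex.norm_real, Complex.norm_real, Real.norm_of_nonneg hlpos.le,
        Real.norm_eq_abs]
      gcongr
    rw [Complex.norm_real, Real.norm_eq_abs] at hn1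
    have hn2 : |abar * e - lam ^ 2| ≤ lam ^ 2 / 100 + |e| * (abar / 100) := by
      refine hn1.trans ?_
      have e1 := abs_nonneg e
      have := mul_le_mul_of_nonneg_left x hlpos.le
      have := mul_le_mul_of_nonneg_left y e1
      linarith
    have hepos : 0 < e := by
      by_contra hneg
      push Not at hneg
      rw [abs_of_nonpos hneg] at hn2
      have := (abs_le.1 hn2).1
      nlinarith
    rw [abs_of_pos hepos] at hn1 hn2
    have hl2 : lam ^ 2 ≤ 2 * abar * e := by
      have := (abs_le.1 hn2).1
      nlinarith
    refine ⟨⟨F.bound.mono x, F.dbound.mono z, ?_⟩, hepos, ?_, ?_⟩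
    · rw [← hεre]
      exact F.eqn
    · rw [abs_sub_comm]
      refine hn1.trans ?_
      calc lam ^ 2 * (K * lam ^ 2) + e * (A * (K * lam ^ 2))
          ≤ (2 * abar * e) * (K * (2 * abar * e)) + e * (A * (K * (2 * abar * e))) := by gcongr
        _ = _ := by ring
    · rw [abs_sub_comm]
      have := (abs_le.1 hn2).2
      nlinarith
  · intro l₁ l₂ p₁ q₁ d₁ p₂ q₂ d₂
    have h := hsub l₁ l₂ p₁ q₁ d₁ p₂ q₂ d₂
    rw [hre l₁ p₁ q₁ d₁, hre l₂ p₂ q₂ d₂, Complex.conj_ofReal, ← Complex.ofReal_sub,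
      ← Complex.ofReal_sub, Complex.norm_real, Real.norm_eq_abs] at h
    exact h

end

section

variable {r : ℕ}

/-! ### Fourier coefficients of periodic analytic functions -/

lemma sum_prod_le_tsum_pow {f : ℤ → ℝ} (hf : Summable f) (h0 : ∀ m, 0 ≤ f m)
    (S : Finset (Fin r → ℤ)) : ∑ k ∈ S, ∏ j, f (k j) ≤ (∑' m, f m) ^ r := by
  classical
  let T : Fin r → Finset ℤ := fun j => S.image fun k => k j
  calc ∑ k ∈ S, ∏ j, f (k j) ≤ ∑ k ∈ Fintype.piFinset T, ∏ j, f (k j) :=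
        Finset.sum_le_sum_of_subset_of_nonneg
          (fun k hk => Fintype.mem_piFinset.2 fun j => Finset.mem_image_of_mem _ hk)
          fun k _ _ => Finset.prod_nonneg fun _ _ => h0 _
    _ = ∏ j, ∑ m ∈ T j, f m := (Finset.prod_univ_sum T fun _ m => f m).symm
    _ ≤ ∏ _j : Fin r, ∑' m, f m := Finset.prod_le_prod
        (fun j _ => Finset.sum_nonneg fun _ _ => h0 _)
        fun j _ => hf.sum_le_tsum _ fun _ _ => h0 _
    _ = _ := by simp

lemma summable_exp_neg_mul_abs {δ : ℝ} (hδ : 0 < δ) :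
    Summable fun m : ℤ => Real.exp (-(δ * |(m : ℝ)|)) := by
  have h : Summable fun n : ℕ => Real.exp (-δ) ^ n :=
    summable_geometric_of_lt_one (Real.exp_pos _).le (Real.exp_lt_one_iff.2 (by linarith))
  have h' : ∀ n : ℕ, Real.exp (-δ) ^ n = Real.exp (-(δ * |(n : ℝ)|)) := fun n => by
    rw [← Real.exp_nat_mul, Nat.abs_cast]
    ring_nf
  refine Summable.of_nat_of_neg ?_ ?_
  · exact h.congr fun n => by simpa using h' n
  · exact h.congr fun n => by simpa using h' n

lemma sumBound_of_exp_decay {c : (Fin r → ℤ) → ℂ} {M s δ : ℝ} (hδ : 0 < δ) (hM : 0 ≤ M)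
    (hc : ∀ k, ‖c k‖ ≤ M * Real.exp (-((s + δ) * l1 k))) :
    SumBound s (M * (∑' m : ℤ, Real.exp (-(δ * |(m : ℝ)|))) ^ r) c := fun S => by
  calc ∑ k ∈ S, ‖c k‖ * Real.exp (s * l1 k)
      ≤ ∑ k ∈ S, M * ∏ j, Real.exp (-(δ * |(k j : ℝ)|)) := Finset.sum_le_sum fun k _ => by
        have : ∏ j, Real.exp (-(δ * |(k j : ℝ)|)) =
            Real.exp (-((s + δ) * l1 k)) * Real.exp (s * l1 k) := by
          rw [← Real.exp_sum, ← Real.exp_add, Finset.sum_neg_distrib, ← Finset.mul_sum]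
          congr 1
          unfold l1
          ring
        rw [this, ← mul_assoc]
        exact mul_le_mul_of_nonneg_right (hc k) (Real.exp_pos _).le
    _ ≤ _ := by
        rw [← Finset.mul_sum]
        exact mul_le_mul_of_nonneg_left (sum_prod_le_tsum_pow (summable_exp_neg_mul_abs hδ)
          (fun _ => (Real.exp_pos _).le) S) hM

/-- Shifting the contour to `Im z = ∓ s` bounds the Fourier coefficients of a function that is
holomorphic and `1`-periodic in a strip. -/
lemma norm_integral_exp_mul_le {g : ℂ → ℂ} {s M : ℝ} (hs : 0 ≤ s)
    (hg : DifferentiableOn ℂ g {z | |z.im| ≤ s}) (hper : ∀ z : ℂ, |z.im| ≤ s → g (z + 1) = g z)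
    (hM : ∀ z : ℂ, |z.im| ≤ s → ‖g z‖ ≤ M) (m : ℤ) :
    ‖∫ u in (0 : ℝ)..1, Complex.exp (-(2 * Real.pi * Complex.I * m * (u : ℂ))) * g u‖ ≤
      M * Real.exp (-(2 * Real.pi * s * |(m : ℝ)|)) := by
  obtain ⟨y, hys, hym⟩ : ∃ y : ℝ, |y| ≤ s ∧ m * y = -(s * |(m : ℝ)|) := by
    rcases le_total 0 (m : ℝ) with h | h
    · exact ⟨-s, by rw [abs_neg, abs_of_nonneg hs], by rw [abs_of_nonneg h]; ring⟩
    · exact ⟨s, by rw [abs_of_nonneg hs], by rw [abs_of_nonpos h]; ring⟩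
  set h : ℂ → ℂ := fun z => Complex.exp (-(2 * Real.pi * Complex.I * m * z)) * g z with hh
  have hdiff : DifferentiableOn ℂ h {z | |z.im| ≤ s} := by
    refine DifferentiableOn.mul ?_ hg
    fun_prop
  have hper' : ∀ z : ℂ, |z.im| ≤ s → h (z + 1) = h z := fun z hz => by
    simp only [hh]
    rw [hper z hz]
    congr 1
    rw [Complex.exp_eq_exp_iff_exists_int]
    exact ⟨-m, by push_cast; ring⟩
  have hrect := Complex.integral_boundary_rect_eq_zero_of_differentiableOn h 0 (1 + y * Complex.I)
    (hdiff.mono fun z hz => by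
      have h2 := (Complex.mem_reProdIm.1 hz).2
      simp only [Complex.zero_im, Complex.add_im, Complex.one_im, Complex.mul_im, Complex.ofReal_re,
        Complex.I_im, Complex.ofReal_im, Complex.I_re, mul_one, mul_zero, zero_add, add_zero] at h2
      have h3 := Set.abs_sub_left_of_mem_uIcc h2
      simp only [sub_zero] at h3
      exact h3.trans hys)
  simp only [Complex.zero_re, Complex.zero_im, Complex.add_re, Complex.one_re, Complex.mul_re,
    Complex.ofReal_re, Complex.I_re, mul_zero, Complex.ofReal_im, Complex.I_im, mul_one, sub_self,
    add_zero, Complex.add_im, Complex.one_im, Complex.mul_im, zero_add, Complex.ofReal_zero,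
    zero_mul, Complex.ofReal_one] at hrect
  have hvert : ∫ x in (0 : ℝ)..y, h (1 + x * Complex.I) = ∫ x in (0 : ℝ)..y, h (x * Complex.I) := by
    refine intervalIntegral.integral_congr fun x hx => ?_
    rw [add_comm, hper']
    have h3 := Set.abs_sub_left_of_mem_uIcc hx
    simp only [sub_zero] at h3
    simpa using h3.trans hys
  rw [hvert, add_sub_cancel_right, sub_eq_zero] at hrect
  change ‖∫ u in (0 : ℝ)..1, h u‖ ≤ _
  rw [hrect]
  have hb := intervalIntegral.norm_integral_le_of_norm_le_const (a := (0 : ℝ)) (b := 1)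
    (f := fun x : ℝ => h (x + y * Complex.I))
    (C := M * Real.exp (-(2 * Real.pi * s * |(m : ℝ)|))) fun x _ => by
      have hre : (-(2 * Real.pi * Complex.I * m * ((x : ℂ) + y * Complex.I))).re =
          -(2 * Real.pi * s * |(m : ℝ)|) := by
        have : (-(2 * Real.pi * Complex.I * m * ((x : ℂ) + y * Complex.I))) =
            ((2 * Real.pi * (m * y) : ℝ) : ℂ) + ((-(2 * Real.pi * m * x) : ℝ) : ℂ) * Complex.I := by
          push_cast
          linear_combination (-(2 * Real.pi * m * y) : ℂ) * Complex.I_sq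
        rw [this, hym]
        simp
        ring
      simp only [hh]
      rw [norm_mul, Complex.norm_exp, hre, mul_comm]
      exact mul_le_mul_of_nonneg_right (hM _ (by simpa using hys)) (Real.exp_pos _).le
  simpa using hb

section Torus

variable {F : (Fin r → ℂ) → ℂ} {ρ : ℝ}

lemma periodic_int_multiple (hper : ∀ θ ∈ strip r ρ, ∀ j,
      F (θ + Pi.single j (2 * (Real.pi : ℂ))) = F θ) {θ : Fin r → ℂ} (hθ : θ ∈ strip r ρ)
    (j : Fin r) (m : ℤ) : F (θ + Pi.single j (2 * (Real.pi : ℂ) * m)) = F θ := by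
  have hmem : ∀ m : ℤ, θ + Pi.single j (2 * (Real.pi : ℂ) * m) ∈ strip r ρ := fun m i => by
    by_cases h : i = j
    · subst h
      have := hθ i
      simpa using this
    · simpa [h] using hθ i
  have hs : ∀ m : ℤ, F (θ + Pi.single j (2 * (Real.pi : ℂ) * (m + 1 : ℤ))) =
      F (θ + Pi.single j (2 * (Real.pi : ℂ) * m)) := fun m => by
    rw [← hper _ (hmem m) j, add_assoc, ← Pi.single_add]
    push_cast
    ring_nf
  induction m using Int.induction_on with
  | zero => simp
  | succ n ih => rw [hs, ih]
  | pred n ih =>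
    rw [← hs, sub_add_cancel]
    exact ih

lemma periodic_int_vector (hper : ∀ θ ∈ strip r ρ, ∀ j,
      F (θ + Pi.single j (2 * (Real.pi : ℂ))) = F θ) {θ : Fin r → ℂ} (hθ : θ ∈ strip r ρ)
    (n : Fin r → ℤ) : F (θ + fun j => 2 * (Real.pi : ℂ) * n j) = F θ := by
  classical
  have key : ∀ S : Finset (Fin r), F (θ + ∑ j ∈ S, Pi.single j (2 * (Real.pi : ℂ) * n j)) = F θ ∧
      θ + ∑ j ∈ S, Pi.single j (2 * (Real.pi : ℂ) * n j) ∈ strip r ρ := fun S => by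
    induction S using Finset.induction_on with
    | empty => simpa using hθ
    | insert j S hj ih =>
      rw [Finset.sum_insert hj, add_comm (Pi.single j _), ← add_assoc]
      refine ⟨(periodic_int_multiple hper ih.2 j (n j)).trans ih.1, fun i => ?_⟩
      by_cases h : i = j
      · subst h
        have := ih.2 i
        rw [Pi.add_apply, Pi.single_eq_same]
        simpa using this
      · rw [Pi.add_apply, Pi.single_eq_of_ne h, add_zero]
        exact ih.2 i
  have h := (key Finset.univ).1
  rwa [Finset.univ_sum_single (fun j => 2 * (Real.pi : ℂ) * n j)] at h

lemma exists_bound_on_strip (hF : AnalyticOnNhd ℂ F (strip r ρ)) (hper : ∀ θ ∈ strip r ρ, ∀ j,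
      F (θ + Pi.single j (2 * (Real.pi : ℂ))) = F θ) :
    ∃ M : ℝ, 0 ≤ M ∧ ∀ θ ∈ strip r ρ, ‖F θ‖ ≤ M := by
  have hK : IsCompact (Set.univ.pi fun _ : Fin r =>
      Set.Icc (0 : ℝ) (2 * Real.pi) ×ℂ Set.Icc (-ρ) ρ) :=
    isCompact_univ_pi fun _ => isCompact_Icc.reProdIm isCompact_Icc
  have hsub : (Set.univ.pi fun _ : Fin r =>
      Set.Icc (0 : ℝ) (2 * Real.pi) ×ℂ Set.Icc (-ρ) ρ) ⊆ strip r ρ := fun θ hθ j =>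
    abs_le.2 (Complex.mem_reProdIm.1 (hθ j trivial)).2
  obtain ⟨M, hM⟩ := hK.exists_bound_of_continuousOn (hF.continuousOn.mono hsub)
  refine ⟨max M 0, le_max_right _ _, fun θ hθ => ?_⟩
  have hpi := Real.two_pi_pos
  set n : Fin r → ℤ := fun j => -⌊(θ j).re / (2 * Real.pi)⌋ with hn
  rw [← periodic_int_vector hper hθ n]
  refine (hM _ fun j _ => ?_).trans (le_max_left _ _)
  rw [Complex.mem_reProdIm]
  have h1 := Int.floor_le ((θ j).re / (2 * Real.pi))
  have h2 := (Int.lt_floor_add_one ((θ j).re / (2 * Real.pi))).le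
  rw [le_div_iff₀ hpi] at h1
  rw [div_le_iff₀ hpi] at h2
  have e1 : (2 * (Real.pi : ℂ) * (n j : ℂ)) = ((2 * Real.pi * n j : ℝ) : ℂ) := by push_cast; ring
  refine ⟨?_, ?_⟩
  · rw [Pi.add_apply, e1, Complex.add_re, Complex.ofReal_re, hn]
    push_cast
    constructor <;> nlinarith
  · rw [Pi.add_apply, e1, Complex.add_im, Complex.ofReal_im, add_zero]
    exact abs_le.1 (hθ j)

lemma real_mem_strip (hρ : 0 ≤ ρ) (x : Fin r → ℝ) : (fun j => (x j : ℂ)) ∈ strip r ρ := fun j => by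
  simpa using hρ

/-- The restriction of `F` to the real torus, in the variable `θ / 2π`. -/
lemma exists_torus_restriction (hρ : 0 ≤ ρ) (hF : AnalyticOnNhd ℂ F (strip r ρ))
    (hper : ∀ θ ∈ strip r ρ, ∀ j, F (θ + Pi.single j (2 * (Real.pi : ℂ))) = F θ) :
    ∃ f : C(UnitAddTorus (Fin r), ℂ), ∀ x : Fin r → ℝ,
      f (fun j => (x j : UnitAddCircle)) = F fun j => ((2 * Real.pi * x j : ℝ) : ℂ) := by
  have hq : IsOpenQuotientMap (Pi.map fun (_ : Fin r) (x : ℝ) => (x : UnitAddCircle)) :=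
    IsOpenQuotientMap.piMap fun _ => QuotientAddGroup.isOpenQuotientMap_mk
  let G : C(Fin r → ℝ, ℂ) := ⟨fun x => F fun j => ((2 * Real.pi * x j : ℝ) : ℂ),
    hF.continuousOn.comp_continuous (by fun_prop) fun x => real_mem_strip hρ _⟩
  let q : C(Fin r → ℝ, UnitAddTorus (Fin r)) := ⟨_, hq.continuous⟩
  have hq' : IsQuotientMap q := hq.isQuotientMap
  have hfac : Function.FactorsThrough G q := fun x y hxy => by
    have hn : ∀ j, ∃ n : ℤ, x j = y j + n := fun j => by
      have := congrFun hxy j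
      obtain ⟨n, hn⟩ := AddSubgroup.mem_zmultiples_iff.1 (QuotientAddGroup.eq.1 this)
      rw [zsmul_eq_mul, mul_one] at hn
      exact ⟨-n, by push_cast; linarith⟩
    choose n hn using hn
    change F _ = F _
    rw [← periodic_int_vector hper (real_mem_strip hρ fun j => 2 * Real.pi * y j) n]
    congr 1
    ext j
    simp only [Pi.add_apply, hn]
    push_cast
    ring
  exact ⟨hq'.lift G hfac, DFunLike.congr_fun (hq'.lift_comp G hfac)⟩

lemma mFourier_coe (n : Fin r → ℤ) (x : Fin r → ℝ) :
    UnitAddTorus.mFourier n (fun j => (x j : UnitAddCircle)) =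
      Complex.exp (2 * Real.pi * Complex.I * ∑ j, (n j : ℂ) * x j) := by
  change ∏ j, fourier (n j) (x j : UnitAddCircle) = _
  rw [Finset.mul_sum, Complex.exp_sum]
  refine Finset.prod_congr rfl fun j _ => ?_
  rw [fourier_coe_apply]
  congr 1
  push_cast
  ring

/-- The integrand of the Fourier coefficient of index `n` of `x ↦ F (2π x)`. -/
noncomputable def torusIntegrand (F : (Fin r → ℂ) → ℂ) (n : Fin r → ℤ) (x : Fin r → ℝ) : ℂ :=
  Complex.exp (2 * Real.pi * Complex.I * ∑ i, ((-n) i : ℂ) * x i) *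
    F fun i => ((2 * Real.pi * x i : ℝ) : ℂ)

lemma norm_exp_two_pi_I_sum (n : Fin r → ℤ) (x : Fin r → ℝ) :
    ‖Complex.exp (2 * Real.pi * Complex.I * ∑ i, ((-n) i : ℂ) * x i)‖ = 1 := by
  have : (2 * Real.pi * Complex.I * ∑ i, ((-n) i : ℂ) * x i) =
      ((2 * Real.pi * ∑ i, ((-n) i : ℝ) * x i : ℝ) : ℂ) * Complex.I := by
    push_cast
    ring
  rw [this, Complex.norm_exp_ofReal_mul_I]

lemma norm_torusIntegrand_le {M : ℝ} (hρ : 0 ≤ ρ) (hM : ∀ θ ∈ strip r ρ, ‖F θ‖ ≤ M)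
    (n : Fin r → ℤ) (x : Fin r → ℝ) : ‖torusIntegrand F n x‖ ≤ M := by
  rw [torusIntegrand, norm_mul, norm_exp_two_pi_I_sum, one_mul]
  exact hM _ (real_mem_strip hρ _)

lemma continuous_torusIntegrand (hρ : 0 ≤ ρ) (hF : AnalyticOnNhd ℂ F (strip r ρ))
    (n : Fin r → ℤ) : Continuous (torusIntegrand F n) := by
  unfold torusIntegrand
  refine Continuous.mul (by fun_prop) ?_
  exact hF.continuousOn.comp_continuous (by fun_prop) fun x => real_mem_strip hρ _

lemma mFourierCoeff_eq_integral_torusIntegrand {f : C(UnitAddTorus (Fin r), ℂ)}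
    (hf : ∀ x : Fin r → ℝ,
      f (fun j => (x j : UnitAddCircle)) = F fun j => ((2 * Real.pi * x j : ℝ) : ℂ))
    (n : Fin r → ℤ) (a : Fin r → ℝ) : UnitAddTorus.mFourierCoeff f n =
      ∫ x in {x : Fin r → ℝ | ∀ i, x i ∈ Set.Ioc (a i) (a i + 1)}, torusIntegrand F n x := by
  rw [UnitAddTorus.mFourierCoeff_eq_integral f n a]
  congr 1
  ext x
  rw [torusIntegrand, mFourier_coe, hf, smul_eq_mul]

/-- The average of the integrand over a line in the direction `j` decays exponentially. -/
lemma norm_integral_line_le {M : ℝ} (hρ : 0 ≤ ρ) (hF : AnalyticOnNhd ℂ F (strip r ρ))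
    (hper : ∀ θ ∈ strip r ρ, ∀ j, F (θ + Pi.single j (2 * (Real.pi : ℂ))) = F θ)
    (hM : ∀ θ ∈ strip r ρ, ‖F θ‖ ≤ M) (n : Fin r → ℤ) (j : Fin r) (x : Fin r → ℝ) :
    ‖∫ u in (0 : ℝ)..1, torusIntegrand F n (x + Pi.single j u)‖ ≤
      M * Real.exp (-(ρ * |(n j : ℝ)|)) := by
  have hpi := Real.two_pi_pos
  set g : ℂ → ℂ := fun z =>
    F ((fun i => ((2 * Real.pi * x i : ℝ) : ℂ)) + Pi.single j (2 * Real.pi * z)) with hg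
  have hmem : ∀ z : ℂ, |z.im| ≤ ρ / (2 * Real.pi) →
      ((fun i => ((2 * Real.pi * x i : ℝ) : ℂ)) + Pi.single j (2 * Real.pi * z)) ∈ strip r ρ := by
    intro z hz i
    rw [Pi.add_apply, Complex.add_im, Complex.ofReal_im, zero_add]
    by_cases h : i = j
    · subst h
      rw [Pi.single_eq_same]
      have : (2 * (Real.pi : ℂ) * z).im = 2 * Real.pi * z.im := by simp
      rw [this, abs_mul, abs_of_pos hpi]
      rwa [le_div_iff₀ hpi, mul_comm] at hz
    · rw [Pi.single_eq_of_ne h]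
      simpa using hρ
  have hgd : DifferentiableOn ℂ g {z | |z.im| ≤ ρ / (2 * Real.pi)} := fun z hz => by
    refine ((hF _ (hmem z hz)).differentiableAt.comp z ?_).differentiableWithinAt
    refine (differentiableAt_const _).add ?_
    exact ((ContinuousLinearMap.single ℂ (fun _ : Fin r => ℂ) j).differentiableAt).comp z
      (by fun_prop)
  have h1 := norm_integral_exp_mul_le (g := g) (s := ρ / (2 * Real.pi)) (M := M) (by positivity)
    hgd (fun z hz => by
      simp only [hg]
      rw [← hper _ (hmem z hz) j, add_assoc, ← Pi.single_add]
      ring_nf) (fun z hz => hM _ (hmem z hz)) (n j)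
  have hexp : 2 * Real.pi * (ρ / (2 * Real.pi)) = ρ := by field_simp
  rw [hexp] at h1
  have h2 : ∀ u : ℝ, torusIntegrand F n (x + Pi.single j u) =
      Complex.exp (2 * Real.pi * Complex.I * ∑ i, ((-n) i : ℂ) * x i) *
        (Complex.exp (-(2 * Real.pi * Complex.I * n j * (u : ℂ))) * g u) := fun u => by
    simp only [torusIntegrand, hg]
    rw [← mul_assoc, ← Complex.exp_add]
    congr 2
    · have : ∑ i, (((-n) i : ℤ) : ℂ) * (((x + Pi.single j u : Fin r → ℝ) i : ℝ) : ℂ) =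
          ∑ i, (((-n) i : ℤ) : ℂ) * x i + -(n j : ℂ) * u := by
        simp only [Pi.add_apply, Complex.ofReal_add, mul_add, Finset.sum_add_distrib]
        congr 1
        rw [Finset.sum_eq_single j]
        · simp
        · intro i _ hi
          simp [hi]
        · simp
      rw [this]
      ring
    · ext i
      by_cases h : i = j
      · subst h
        simp
        ring
      · simp [h]
  simp_rw [h2]
  rw [intervalIntegral.integral_const_mul, norm_mul]
  have h3 : ‖Complex.exp (2 * Real.pi * Complex.I * ∑ i, ((-n) i : ℂ) * x i)‖ = 1 := by
    have : (2 * Real.pi * Complex.I * ∑ i, ((-n) i : ℂ) * x i) =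
        ((2 * Real.pi * ∑ i, ((-n) i : ℝ) * x i : ℝ) : ℂ) * Complex.I := by
      push_cast
      ring
    rw [this, Complex.norm_exp_ofReal_mul_I]
  rw [h3, one_mul]
  exact h1

lemma integral_box_translate (Φ : (Fin r → ℝ) → ℂ) (v : Fin r → ℝ) :
    ∫ x in {x : Fin r → ℝ | ∀ i, x i ∈ Set.Ioc (0 : ℝ) 1}, Φ (x + v) =
      ∫ x in {x : Fin r → ℝ | ∀ i, x i ∈ Set.Ioc (v i) (v i + 1)}, Φ x := by
  have h := (measurePreserving_add_right (volume : Measure (Fin r → ℝ)) v).setIntegral_preimage_emb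
    (MeasurableEquiv.addRight v).measurableEmbedding Φ
    {x | ∀ i, x i ∈ Set.Ioc (v i) (v i + 1)}
  refine Eq.trans ?_ h
  congr 2
  ext x
  simp only [Set.mem_ofPred_eq, Set.mem_preimage, Pi.add_apply, Set.mem_Ioc]
  refine forall_congr' fun i => ?_
  constructor <;> rintro ⟨h1, h2⟩ <;> constructor <;> linarith

lemma volume_unit_box : volume {x : Fin r → ℝ | ∀ i, x i ∈ Set.Ioc (0 : ℝ) 1} = 1 := by
  have : {x : Fin r → ℝ | ∀ i, x i ∈ Set.Ioc (0 : ℝ) 1} =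
      Set.univ.pi fun _ => Set.Ioc (0 : ℝ) 1 := by ext x; simp
  rw [this, Real.volume_pi_Ioc]
  simp

/-- Exponential decay of the Fourier coefficients in each index separately. Averaging over
translations in the direction `j` reduces the claim to functions of one variable. -/
lemma norm_mFourierCoeff_le {M : ℝ} (hρ : 0 ≤ ρ) (hF : AnalyticOnNhd ℂ F (strip r ρ))
    (hper : ∀ θ ∈ strip r ρ, ∀ j, F (θ + Pi.single j (2 * (Real.pi : ℂ))) = F θ)
    (hM : ∀ θ ∈ strip r ρ, ‖F θ‖ ≤ M) {f : C(UnitAddTorus (Fin r), ℂ)}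
    (hf : ∀ x : Fin r → ℝ,
      f (fun j => (x j : UnitAddCircle)) = F fun j => ((2 * Real.pi * x j : ℝ) : ℂ))
    (n : Fin r → ℤ) (j : Fin r) :
    ‖UnitAddTorus.mFourierCoeff f n‖ ≤ M * Real.exp (-(ρ * |(n j : ℝ)|)) := by
  obtain ⟨box, hbox⟩ : ∃ box : Set (Fin r → ℝ), box = {x | ∀ i, x i ∈ Set.Ioc (0 : ℝ) 1} :=
    ⟨_, rfl⟩
  have hvol : volume box = 1 := by rw [hbox, volume_unit_box]
  have hfin : IsFiniteMeasure (volume.restrict box) := ⟨by simp [hvol]⟩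
  have hfin2 : IsFiniteMeasure (volume.restrict (Set.uIoc (0 : ℝ) 1)) := ⟨by simp⟩
  have htrans : ∀ u : ℝ, ∫ x in box, torusIntegrand F n (x + Pi.single j u) =
      UnitAddTorus.mFourierCoeff f n := fun u => by
    rw [mFourierCoeff_eq_integral_torusIntegrand hf n (Pi.single j u), hbox,
      integral_box_translate (torusIntegrand F n)]
  have hint : Integrable (Function.uncurry fun (u : ℝ) (x : Fin r → ℝ) =>
      torusIntegrand F n (x + Pi.single j u))
      ((volume.restrict (Set.uIoc (0 : ℝ) 1)).prod (volume.restrict box)) := by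
    refine Integrable.of_bound (C := M) ?_ (Eventually.of_forall fun z =>
      norm_torusIntegrand_le hρ hM n _)
    apply Continuous.aestronglyMeasurable
    refine (continuous_torusIntegrand hρ hF n).comp (continuous_snd.add ?_)
    exact (continuous_single j).comp continuous_fst
  have hswap := intervalIntegral_integral_swap hint
  simp_rw [htrans] at hswap
  rw [intervalIntegral.integral_const, sub_zero, one_smul] at hswap
  rw [hswap]
  have hreal : volume.real box = 1 := by rw [measureReal_def, hvol, ENNReal.toReal_one]
  have hlt : volume box < ⊤ := by rw [hvol]; exact ENNReal.one_lt_top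
  obtain ⟨L, hL⟩ : ∃ L : (Fin r → ℝ) → ℂ,
      ∀ x, ∫ u in (0 : ℝ)..1, torusIntegrand F n (x + Pi.single j u) = L x := ⟨_, fun _ => rfl⟩
  have hle : ∀ x ∈ box, ‖L x‖ ≤ M * Real.exp (-(ρ * |(n j : ℝ)|)) := fun x _ => by
    rw [← hL]
    exact norm_integral_line_le hρ hF hper hM n j x
  simp_rw [hL]
  have h := norm_setIntegral_le_of_norm_le_const hlt hle
  rwa [hreal, mul_one] at h

/-- A function that is analytic on a strip and `2π`-periodic is on the real torus the sum of a
Fourier series with exponentially decaying coefficients. -/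
theorem exists_fourier_series (hr : 1 ≤ r) (hρ : 0 < ρ) (hF : AnalyticOnNhd ℂ F (strip r ρ))
    (hper : ∀ θ ∈ strip r ρ, ∀ j, F (θ + Pi.single j (2 * (Real.pi : ℂ))) = F θ) :
    ∃ (c : (Fin r → ℤ) → ℂ) (s A : ℝ), 0 < s ∧ s ≤ 1 ∧ SumBound s A c ∧
      ∀ (ω : Fin r → ℝ) (t : ℝ), F (fun j => ((ω j * t : ℝ) : ℂ)) = ev ω c t := by
  obtain ⟨M, hM0, hM⟩ := exists_bound_on_strip hF hper
  obtain ⟨f, hf⟩ := exists_torus_restriction hρ.le hF hper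
  set c := UnitAddTorus.mFourierCoeff f with hc
  have hr0 : (0 : ℝ) < r := by exact_mod_cast hr
  set δ := ρ / (2 * r) with hδ
  have hδ0 : 0 < δ := by positivity
  have hdecay : ∀ k, ‖c k‖ ≤ M * Real.exp (-((min 1 δ + δ) * l1 k)) := by
    intro k
    have : Nonempty (Fin r) := ⟨⟨0, hr⟩⟩
    obtain ⟨j, -, hj⟩ := Finset.exists_max_image Finset.univ (fun j => |(k j : ℝ)|)
      Finset.univ_nonempty
    have hl : l1 k ≤ r * |(k j : ℝ)| := by
      have := Finset.sum_le_card_nsmul Finset.univ (fun i => |(k i : ℝ)|) _ hj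
      simpa [l1] using this
    refine (norm_mFourierCoeff_le hρ.le hF hper hM hf k j).trans ?_
    refine mul_le_mul_of_nonneg_left (Real.exp_le_exp.2 (neg_le_neg ?_)) hM0
    have h0 := l1_nonneg k
    calc (min 1 δ + δ) * l1 k ≤ (δ + δ) * (r * |(k j : ℝ)|) := by
          gcongr
          exact min_le_right _ _
      _ = ρ * |(k j : ℝ)| := by rw [hδ]; field_simp; ring
  have hb := sumBound_of_exp_decay hδ0 hM0 hdecay
  have hmin : 0 < min 1 δ := lt_min one_pos hδ0
  refine ⟨c, min 1 δ, _, hmin, min_le_left _ _, hb, fun ω t => ?_⟩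
  have hsum := UnitAddTorus.hasSum_mFourier_series_apply_of_summable
    (hb.mono_width hmin.le).summable_norm.of_norm
    (fun j => ((ω j * t / (2 * Real.pi) : ℝ) : UnitAddCircle))
  rw [hf] at hsum
  have h1 : (fun j => ((2 * Real.pi * (ω j * t / (2 * Real.pi)) : ℝ) : ℂ)) =
      fun j => ((ω j * t : ℝ) : ℂ) := by
    ext j
    congr 1
    have := Real.pi_ne_zero
    field_simp
  rw [h1] at hsum
  rw [← hsum.tsum_eq]
  refine tsum_congr fun k => ?_
  rw [smul_eq_mul, mFourier_coe]
  congr 2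
  have := Complex.ofReal_ne_zero.2 Real.pi_ne_zero
  simp only [pairing]
  push_cast
  rw [Finset.mul_sum, Finset.sum_mul, Finset.sum_mul]
  refine Finset.sum_congr rfl fun j _ => ?_
  field_simp

end Torus

end

section

variable {r : ℕ} {c : (Fin r → ℤ) → ℂ} {s M : ℝ}

/-! ### Analyticity of Fourier series -/

/-- The continuous linear form `h ↦ i ⟨k, h⟩`. -/
noncomputable def phaseForm (k : Fin r → ℤ) : (Fin r → ℂ) →L[ℂ] ℂ :=
  ∑ j, (Complex.I * (k j : ℂ)) • ContinuousLinearMap.proj j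

lemma phaseForm_apply (k : Fin r → ℤ) (θ : Fin r → ℂ) :
    phaseForm k θ = Complex.I * ∑ j, (k j : ℂ) * θ j := by
  simp [phaseForm, Finset.mul_sum, mul_assoc]

lemma norm_phaseForm_le (k : Fin r → ℤ) : ‖phaseForm k‖ ≤ l1 k := by
  refine ContinuousLinearMap.opNorm_le_bound _ (l1_nonneg k) fun h => ?_
  rw [phaseForm_apply, norm_mul, Complex.norm_I, one_mul, l1, Finset.sum_mul]
  refine (norm_sum_le _ _).trans (Finset.sum_le_sum fun j _ => ?_)
  rw [norm_mul, Complex.norm_intCast]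
  exact mul_le_mul_of_nonneg_left (norm_le_pi_norm h j) (abs_nonneg _)

/-- The function `θ ↦ ∑ c k e^{i ⟨k, θ⟩}` of complex angles with Fourier coefficients `c`. -/
noncomputable def fourierSeries (c : (Fin r → ℤ) → ℂ) (θ : Fin r → ℂ) : ℂ :=
  ∑' k, c k * Complex.exp (phaseForm k θ)

lemma fourierSeries_line (ω : Fin r → ℝ) (t : ℝ) :
    fourierSeries c (fun j => ((ω j * t : ℝ) : ℂ)) = ev ω c t := by
  refine tsum_congr fun k => ?_
  rw [phaseForm_apply]
  congr 2
  simp only [pairing]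
  push_cast
  rw [Finset.mul_sum, Finset.sum_mul, Finset.sum_mul]
  exact Finset.sum_congr rfl fun j _ => by ring

lemma fourierSeries_add_period (θ : Fin r → ℂ) (j : Fin r) :
    fourierSeries c (θ + Pi.single j (2 * (Real.pi : ℂ))) = fourierSeries c θ := by
  refine tsum_congr fun k => ?_
  congr 1
  rw [Complex.exp_eq_exp_iff_exists_int]
  refine ⟨k j, ?_⟩
  rw [map_add, phaseForm_apply k (Pi.single _ _), Finset.sum_eq_single j]
  · simp
    ring
  · intro i _ hi
    simp [hi]
  · simp

lemma norm_exp_phaseForm_le {ρ : ℝ} {θ : Fin r → ℂ} (hθ : θ ∈ strip r ρ) (k : Fin r → ℤ) :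
    ‖Complex.exp (phaseForm k θ)‖ ≤ Real.exp (ρ * l1 k) := by
  rw [Complex.norm_exp, phaseForm_apply]
  refine Real.exp_le_exp.2 ?_
  have h1 : (Complex.I * ∑ j, (k j : ℂ) * θ j).re = ∑ j, -((k j : ℝ) * (θ j).im) := by
    rw [Complex.I_mul_re, Complex.im_sum, Finset.sum_neg_distrib]
    simp
  rw [h1, l1, Finset.mul_sum]
  refine Finset.sum_le_sum fun j _ => ?_
  calc -((k j : ℝ) * (θ j).im) ≤ |(k j : ℝ) * (θ j).im| := neg_le_abs _
    _ = |(k j : ℝ)| * |(θ j).im| := abs_mul _ _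
    _ ≤ |(k j : ℝ)| * ρ := mul_le_mul_of_nonneg_left (hθ j) (abs_nonneg _)
    _ = _ := mul_comm _ _

/-- The homogeneous Taylor polynomial of degree `n` of the term of index `k`, as a multilinear
map. -/
noncomputable def phaseTaylor (n : ℕ) (k : Fin r → ℤ) :
    ContinuousMultilinearMap ℂ (fun _ : Fin n => Fin r → ℂ) ℂ :=
  ((n.factorial : ℂ)⁻¹) • (ContinuousMultilinearMap.mkPiAlgebraFin ℂ n ℂ).compContinuousLinearMap
    fun _ => phaseForm k

lemma phaseTaylor_apply (n : ℕ) (k : Fin r → ℤ) (h : Fin r → ℂ) :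
    phaseTaylor n k (fun _ => h) = phaseForm k h ^ n / n.factorial := by
  simp [phaseTaylor, List.ofFn_const, div_eq_inv_mul]

lemma norm_phaseTaylor_le (n : ℕ) (k : Fin r → ℤ) :
    ‖phaseTaylor n k‖ ≤ l1 k ^ n / n.factorial := by
  rw [phaseTaylor, norm_smul, norm_inv, Complex.norm_natCast, div_eq_inv_mul]
  refine mul_le_mul_of_nonneg_left ?_ (by positivity)
  refine (ContinuousMultilinearMap.norm_compContinuousLinearMap_le _ _).trans ?_
  rw [ContinuousMultilinearMap.norm_mkPiAlgebraFin, one_mul, Finset.prod_const, Finset.card_fin]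
  exact pow_le_pow_left₀ (norm_nonneg _) (norm_phaseForm_le k) n

/-- A Fourier series with coefficients summable in width `s` is analytic on every smaller strip:
its Taylor series at a point is obtained by expanding the exponentials and exchanging the sums. -/
lemma analyticOnNhd_fourierSeries {ρ : ℝ} (hc : SumBound s M c) (hρ : ρ < s) :
    AnalyticOnNhd ℂ (fourierSeries c) (strip r ρ) := by
  intro θ hθ
  obtain ⟨δ, hδ, hδs⟩ : ∃ δ : ℝ, 0 < δ ∧ ρ + δ = s := ⟨s - ρ, by linarith, by ring⟩
  obtain ⟨b, hb⟩ : ∃ b : (Fin r → ℤ) → ℂ, ∀ k, c k * Complex.exp (phaseForm k θ) = b k :=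
    ⟨_, fun _ => rfl⟩
  have hbb : SumBound δ M b := fun S => by
    refine (Finset.sum_le_sum fun k _ => ?_).trans (hc S)
    rw [← hb, norm_mul, mul_assoc, ← hδs, add_mul, Real.exp_add]
    have := norm_exp_phaseForm_le hθ k
    gcongr
  have hterm : ∀ (n : ℕ) (k : Fin r → ℤ) (t : ℝ), 0 ≤ t → t ≤ δ →
      l1 k ^ n / n.factorial * t ^ n ≤ Real.exp (δ * l1 k) := fun n k t ht htδ => by
    have h0 := l1_nonneg k
    calc l1 k ^ n / n.factorial * t ^ n = (t * l1 k) ^ n / n.factorial := by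
          rw [mul_pow]; ring
      _ ≤ (δ * l1 k) ^ n / n.factorial := by gcongr
      _ ≤ _ := Real.pow_div_factorial_le_exp _ (by positivity) n
  have hsumnn : ∀ n, Summable fun k => ‖b k • phaseTaylor n k‖ := fun n => by
    refine Summable.of_nonneg_of_le (fun k => norm_nonneg _) (fun k => ?_)
      (hbb.summable.div_const (δ ^ n))
    rw [norm_smul, le_div_iff₀ (by positivity), mul_assoc]
    refine mul_le_mul_of_nonneg_left ?_ (norm_nonneg _)
    refine (mul_le_mul_of_nonneg_right (norm_phaseTaylor_le n k) (by positivity)).trans ?_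
    exact hterm n k δ hδ.le le_rfl
  have hsumn : ∀ n, Summable fun k => b k • phaseTaylor n k := fun n => (hsumnn n).of_norm
  let p : FormalMultilinearSeries ℂ (Fin r → ℂ) ℂ := fun n => ∑' k, b k • phaseTaylor n k
  have hp : ∀ n, ‖p n‖ * δ ^ n ≤ M := fun n => by
    have h1 : ‖p n‖ ≤ ∑' k, ‖b k • phaseTaylor n k‖ := norm_tsum_le_tsum_norm (hsumnn n)
    refine (mul_le_mul_of_nonneg_right h1 (by positivity)).trans ?_
    rw [← tsum_mul_right]
    refine (Summable.tsum_le_tsum (fun k => ?_) ((hsumnn n).mul_right _) hbb.summable).trans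
      hbb.tsum_le
    rw [norm_smul, mul_assoc]
    refine mul_le_mul_of_nonneg_left ?_ (norm_nonneg _)
    refine (mul_le_mul_of_nonneg_right (norm_phaseTaylor_le n k) (by positivity)).trans ?_
    exact hterm n k δ hδ.le le_rfl
  refine ⟨p, ENNReal.ofReal δ, ⟨?_, by simpa using hδ, fun {y} hy => ?_⟩⟩
  · exact p.le_radius_of_bound (r := ⟨δ, hδ.le⟩) M hp |>.trans' (by
      rw [ENNReal.ofReal, Real.toNNReal_of_nonneg hδ.le]
      exact le_rfl)
  · have hyδ : ‖y‖ < δ := by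
      rw [Metric.mem_eball, edist_zero_right, ← ofReal_norm] at hy
      exact (ENNReal.ofReal_lt_ofReal_iff hδ).1 hy
    have hval : ∀ n, p n (fun _ => y) = ∑' k, b k * (phaseForm k y ^ n / n.factorial) := fun n => by
      have := (hsumn n).hasSum.mapL
        (ContinuousMultilinearMap.apply ℂ (fun _ : Fin n => Fin r → ℂ) ℂ fun _ => y)
      rw [← ContinuousMultilinearMap.apply_apply (𝕜 := ℂ), ← this.tsum_eq]
      refine tsum_congr fun k => ?_
      rw [ContinuousMultilinearMap.apply_apply, smul_apply,
        phaseTaylor_apply, smul_eq_mul]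
    have hnorm : ∀ k, ‖phaseForm k y‖ ≤ δ * l1 k := fun k =>
      ((phaseForm k).le_opNorm y).trans (by
        rw [mul_comm]
        exact mul_le_mul hyδ.le (norm_phaseForm_le k) (norm_nonneg _) hδ.le)
    have hexp : ∀ k, HasSum (fun n : ℕ => b k * (phaseForm k y ^ n / n.factorial))
        (b k * Complex.exp (phaseForm k y)) := fun k => by
      rw [Complex.exp_eq_exp_ℂ]
      exact (NormedSpace.expSeries_div_hasSum_exp (phaseForm k y)).mul_left _
    have hexpn : ∀ k, HasSum (fun n : ℕ => ‖b k‖ * ((δ * l1 k) ^ n / n.factorial))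
        (‖b k‖ * Real.exp (δ * l1 k)) := fun k => by
      rw [Real.exp_eq_exp_ℝ]
      exact (NormedSpace.expSeries_div_hasSum_exp (δ * l1 k)).mul_left _
    have hsum2 : Summable fun z : (Fin r → ℤ) × ℕ =>
        b z.1 * (phaseForm z.1 y ^ z.2 / z.2.factorial) := by
      refine Summable.of_norm_bounded
        (g := fun z : (Fin r → ℤ) × ℕ => ‖b z.1‖ * ((δ * l1 z.1) ^ z.2 / z.2.factorial)) ?_ ?_
      · refine (summable_prod_of_nonneg fun z => ?_).2 ⟨fun k => (hexpn k).summable, ?_⟩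
        · have := l1_nonneg z.1
          simp only [Pi.zero_apply]
          positivity
        · exact hbb.summable.congr fun k => (hexpn k).tsum_eq.symm
      · intro z
        rw [norm_mul, norm_div, norm_pow, Complex.norm_natCast]
        have := hnorm z.1
        gcongr
    have htot : fourierSeries c (θ + y) = ∑' k, b k * Complex.exp (phaseForm k y) := by
      refine tsum_congr fun k => ?_
      rw [map_add, Complex.exp_add, ← hb]
      ring
    have h1 : HasSum (fun z : (Fin r → ℤ) × ℕ => b z.1 * (phaseForm z.1 y ^ z.2 / z.2.factorial))
        (fourierSeries c (θ + y)) := by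
      rw [htot, ← tsum_congr fun k => (hexp k).tsum_eq, ← hsum2.tsum_prod]
      exact hsum2.hasSum
    have h2 := ((Equiv.prodComm ℕ (Fin r → ℤ)).hasSum_iff).2 h1
    have h3 := h2.prod_fiberwise fun n =>
      (((Equiv.prodComm ℕ (Fin r → ℤ)).summable_iff.2 hsum2).prod_factor n).hasSum
    refine h3.congr_fun ?_
    exact fun n => hval n

end

section

variable {r : ℕ} {ω : Fin r → ℝ}

/-! ### Solutions of the Hill equation -/

/-- Two independent complex solutions express every solution of a linear second-order equation
`x'' + q x = 0`, with Wronskians as coefficients. -/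
lemma wronskian_const {q : ℝ → ℂ} {x x' y y' : ℝ → ℂ} (hx : ∀ t, HasDerivAt x (x' t) t)
    (hx' : ∀ t, HasDerivAt x' (-(q t * x t)) t) (hy : ∀ t, HasDerivAt y (y' t) t)
    (hy' : ∀ t, HasDerivAt y' (-(q t * y t)) t) (t : ℝ) :
    x t * y' t - x' t * y t = x 0 * y' 0 - x' 0 * y 0 := by
  have hd : ∀ t, HasDerivAt (fun t => x t * y' t - x' t * y t) 0 t := fun t => by
    refine (((hx t).mul (hy' t)).sub ((hx' t).mul (hy t))).congr_deriv ?_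
    ring
  exact is_const_of_deriv_eq_zero (fun t => (hd t).differentiableAt) (fun t => (hd t).deriv) t 0

/-- The angle-space function with coefficients `c` times the phase `e^{i l ϑ}` of the last angle. -/
noncomputable def phasedSeries (l : ℂ) (c : (Fin r → ℤ) → ℂ) (θ : Fin (r + 1) → ℂ) : ℂ :=
  Complex.exp (l * Complex.I * θ (Fin.last r)) * fourierSeries c fun j => θ j.castSucc

lemma analyticOnNhd_phasedSeries {c : (Fin r → ℤ) → ℂ} {s M ρ : ℝ} (l : ℂ) (hc : SumBound s M c)
    (hρ : ρ < s) : AnalyticOnNhd ℂ (phasedSeries l c) (strip (r + 1) ρ) := by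
  intro θ hθ
  unfold phasedSeries
  refine AnalyticAt.mul ?_ ?_
  · refine AnalyticAt.cexp (analyticAt_const.mul ?_)
    exact (ContinuousLinearMap.proj (R := ℂ) (φ := fun _ : Fin (r + 1) => ℂ)
      (Fin.last r)).analyticAt θ
  · let L : (Fin (r + 1) → ℂ) →L[ℂ] (Fin r → ℂ) :=
      ContinuousLinearMap.pi fun j => ContinuousLinearMap.proj j.castSucc
    exact AnalyticAt.comp (g := fourierSeries c) (f := L)
      (analyticOnNhd_fourierSeries hc hρ (L θ) fun j => hθ j.castSucc) (L.analyticAt θ)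

lemma phasedSeries_add_period {c : (Fin r → ℤ) → ℂ} (l : ℤ) (θ : Fin (r + 1) → ℂ)
    (j : Fin (r + 1)) :
    phasedSeries l c (θ + Pi.single j (2 * (Real.pi : ℂ))) = phasedSeries l c θ := by
  unfold phasedSeries
  induction j using Fin.lastCases with
  | last =>
    congr 1
    · rw [Pi.add_apply, Pi.single_eq_same, Complex.exp_eq_exp_iff_exists_int]
      exact ⟨l, by ring⟩
    · congr 1
      ext j
      rw [Pi.add_apply, Pi.single_eq_of_ne (Fin.castSucc_lt_last j).ne, add_zero]
  | cast j =>
    congr 1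
    · rw [Pi.add_apply, Pi.single_eq_of_ne (Fin.castSucc_lt_last j).ne', add_zero]
    · refine Eq.trans (congrArg (fourierSeries c) ?_)
        (fourierSeries_add_period (fun i => θ i.castSucc) j)
      ext i
      rw [Pi.add_apply, Pi.add_apply]
      by_cases h : i = j
      · subst h; simp
      · rw [Pi.single_eq_of_ne h, Pi.single_eq_of_ne fun h' => h (Fin.castSucc_injective r h')]

lemma phasedSeries_line {c : (Fin r → ℤ) → ℂ} (l : ℂ) (lam t : ℝ) :
    phasedSeries l c (fun j => (((Fin.snoc (α := fun _ => ℝ) ω lam : Fin (r + 1) → ℝ) j * t : ℝ) : ℂ)) =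
      Complex.exp (l * Complex.I * ((lam * t : ℝ) : ℂ)) * ev ω c t := by
  simp only [phasedSeries, Fin.snoc_last, Fin.snoc_castSucc]
  rw [fourierSeries_line]

/-- A Floquet solution with real parameter and its conjugate span the solutions of the Hill
equation, all of which are therefore analytic quasi-periodic. -/
theorem IsFloquet.isAnalyticQuasiPeriodicOn {c U : (Fin r → ℤ) → ℂ} {s lam ε : ℝ} {a : ℝ → ℝ}
    (H : IsFloquet ω c s (1 / 100) (lam / 100) lam U ε) (hs : 0 < s) (hlam : 0 < lam)
    (hac : ∀ t, (a t : ℂ) = ev ω c t) {x : ℝ → ℝ} (hx : IsHillSolution a ε x) :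
    IsAnalyticQuasiPeriodicOn (s / 2) (Fin.snoc (α := fun _ => ℝ) ω lam : Fin (r + 1) → ℝ) x := by
  obtain ⟨v, hxv, hva⟩ := hx
  have bU := sumBound_two_of_sub_one H.bound (by norm_num)
  have bU0 := bU.mono_width hs.le
  obtain ⟨M₁, bDDU⟩ := bU.exists_ddcoeff hs ω
  have dU : ∀ t, HasDerivAt (ev ω U) (ev ω (dcoeff ω U) t) t := hasDerivAt_ev bU0 H.dbound
  have dDU : ∀ t, HasDerivAt (ev ω (dcoeff ω U)) (ev ω (dcoeff ω (dcoeff ω U)) t) t :=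
    hasDerivAt_ev H.dbound bDDU
  set q : ℝ → ℂ := fun t => ε * a t with hq
  set E : ℝ → ℂ := fun t => Complex.exp (1 * Complex.I * ((lam * t : ℝ) : ℂ)) with hE
  have dE : ∀ t, HasDerivAt E (Complex.I * lam * E t) t := fun t => by
    have h1 : HasDerivAt (fun t : ℝ => 1 * Complex.I * ((lam * t : ℝ) : ℂ)) (Complex.I * lam) t := by
      have := (((hasDerivAt_id t).const_mul lam).ofReal_comp).const_mul (1 * Complex.I)
      simpa using this
    refine h1.cexp.congr_deriv ?_
    simp only [hE]
    ring
  set φ : ℝ → ℂ := fun t => E t * ev ω U t with hφ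
  set φ' : ℝ → ℂ := fun t => E t * (ev ω (dcoeff ω U) t + Complex.I * lam * ev ω U t) with hφ'
  have dφ : ∀ t, HasDerivAt φ (φ' t) t := fun t => by
    refine ((dE t).mul (dU t)).congr_deriv ?_
    simp only [hφ']
    ring
  have dφ' : ∀ t, HasDerivAt φ' (-(q t * φ t)) t := fun t => by
    refine ((dE t).mul ((dDU t).add ((dU t).const_mul (Complex.I * lam)))).congr_deriv ?_
    simp only [hq, hφ, hac, Pi.add_apply]
    linear_combination (E t) * H.eqn t + E t * lam ^ 2 * ev ω U t * Complex.I_sq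
  set ψ : ℝ → ℂ := fun t => (starRingEnd ℂ) (φ t) with hψ
  set ψ' : ℝ → ℂ := fun t => (starRingEnd ℂ) (φ' t) with hψ'
  have dψ : ∀ t, HasDerivAt ψ (ψ' t) t := fun t => (dφ t).star
  have dψ' : ∀ t, HasDerivAt ψ' (-(q t * ψ t)) t := fun t => by
    refine (dφ' t).star.congr_deriv ?_
    simp [hq, hψ]
  have dx : ∀ t, HasDerivAt (fun t => (x t : ℂ)) (v t : ℂ) t := fun t => (hxv t).ofReal_comp
  have dv : ∀ t, HasDerivAt (fun t => (v t : ℂ)) (-(q t * (x t : ℂ))) t := fun t => by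
    refine (hva t).ofReal_comp.congr_deriv ?_
    simp [hq]
  have w1 := wronskian_const dx dv dψ dψ'
  have w2 := wronskian_const dx dv dφ dφ'
  have w3 := wronskian_const dφ dφ' dψ dψ'
  set c₁ := (x 0 : ℂ) * ψ' 0 - (v 0 : ℂ) * ψ 0 with hc₁
  set c₂ := (x 0 : ℂ) * φ' 0 - (v 0 : ℂ) * φ 0 with hc₂
  set W := φ 0 * ψ' 0 - φ' 0 * ψ 0 with hW
  -- the Wronskian is `-2 i λ` up to a small relative error
  have hW0 : W ≠ 0 := by
    have hE0 : E 0 = 1 := by simp [hE]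
    set u := ev ω U 0 with hu
    set u' := ev ω (dcoeff ω U) 0 with hu'
    have e1 : W = -(2 * Complex.I * lam * (u * (starRingEnd ℂ) u)) +
        (u * (starRingEnd ℂ) u' - u' * (starRingEnd ℂ) u) := by
      simp only [hW, hφ, hψ, hφ', hψ', hE0, one_mul, map_one, map_add, map_mul, Complex.conj_I,
        Complex.conj_ofReal]
      ring
    have n1 : ‖u - 1‖ ≤ 1 / 100 := by
      have := (H.bound.mono_width hs.le).norm_ev_le (ω := ω) 0
      rwa [ev_sub bU0 (sumBound_oneCoeff 0), ev_oneCoeff] at this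
    have n2 : ‖u'‖ ≤ lam / 100 := H.dbound.norm_ev_le 0
    have n3 : 99 / 100 ≤ ‖u‖ := by
      have := norm_le_norm_add_norm_sub u 1
      rw [norm_one] at this
      linarith
    intro h0
    have e2 : 2 * Complex.I * lam * (u * (starRingEnd ℂ) u) =
        u * (starRingEnd ℂ) u' - u' * (starRingEnd ℂ) u := by
      linear_combination e1 - h0
    have e3 := congrArg norm e2
    have e4 := norm_sub_le (u * (starRingEnd ℂ) u') (u' * (starRingEnd ℂ) u)
    rw [← e3] at e4
    simp only [norm_mul, RCLike.norm_conj, Complex.norm_I, Complex.norm_real, Complex.norm_ofNat,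
      mul_one, Real.norm_of_nonneg hlam.le] at e4
    have hu0 : 0 < ‖u‖ := by linarith
    have e5 : 2 * lam * ‖u‖ * ‖u‖ ≤ (2 * (lam / 100)) * ‖u‖ := by nlinarith
    have e6 := le_of_mul_le_mul_right e5 hu0
    nlinarith
  have hcomb : ∀ t, (x t : ℂ) = (c₁ / W) * φ t - (c₂ / W) * ψ t := fun t => by
    have h1 := w1 t
    have h2 := w2 t
    have h3 := w3 t
    field_simp
    rw [← h1, ← h2, ← h3]
    ring
  have evφ : ∀ t, φ t = phasedSeries ((1 : ℤ) : ℂ) U (fun j =>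
      (((Fin.snoc (α := fun _ => ℝ) ω lam : Fin (r + 1) → ℝ) j * t : ℝ) : ℂ)) := fun t => by
    rw [phasedSeries_line, Int.cast_one]
  have evψ : ∀ t, ψ t = phasedSeries ((-1 : ℤ) : ℂ) (fun k => (starRingEnd ℂ) (U (-k))) (fun j =>
      (((Fin.snoc (α := fun _ => ℝ) ω lam : Fin (r + 1) → ℝ) j * t : ℝ) : ℂ)) := fun t => by
    rw [phasedSeries_line, ← conj_ev]
    simp only [hψ, hφ, hE, map_mul, ← Complex.exp_conj, Complex.conj_I, Complex.conj_ofReal,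
      map_one]
    push_cast
    ring_nf
  have hlt : s / 2 < s := by linarith
  refine ⟨fun θ => (c₁ / W) * phasedSeries ((1 : ℤ) : ℂ) U θ -
    (c₂ / W) * phasedSeries ((-1 : ℤ) : ℂ) (fun k => (starRingEnd ℂ) (U (-k))) θ, ?_, ?_, ?_⟩
  · intro θ hθ
    exact (analyticAt_const.mul (analyticOnNhd_phasedSeries _ bU hlt θ hθ)).sub
      (analyticAt_const.mul (analyticOnNhd_phasedSeries _ bU.conj hlt θ hθ))
  · intro θ _ j
    simp only [phasedSeries_add_period]
  · intro t
    simp only [← evφ, ← evψ]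
    exact hcomb t

end

section

variable {r : ℕ} {ω : Fin r → ℝ}

/-! ### The measure of the nonresonant parameters -/

/-- The values `m = λ²` for which `(ω, λ)` satisfies the Diophantine condition with constants
`α / 2` and `q`. -/
def goodSet (ω : Fin r → ℝ) (α q : ℝ) : Set ℝ :=
  {m | ∀ (k : Fin r → ℤ) (l : ℤ), k ≠ 0 →
    (α / 2) / (l1 k + |(l : ℝ)|) ^ q ≤ |pairing k ω + (l : ℝ) * √m|}

lemma isClosed_goodSet (ω : Fin r → ℝ) (α q : ℝ) : IsClosed (goodSet ω α q) := by
  simp only [goodSet, Set.ofPred_forall]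
  refine isClosed_iInter fun k => isClosed_iInter fun l => isClosed_iInter fun _ => ?_
  exact isClosed_le continuous_const (by fun_prop)

lemma summable_one_add_abs_rpow {γ : ℝ} (hγ : 1 < γ) :
    Summable fun m : ℤ => (1 + |(m : ℝ)|) ^ (-γ) := by
  have h : Summable fun n : ℕ => ((n + 1 : ℕ) : ℝ) ^ (-γ) :=
    (summable_nat_add_iff 1).2 (Real.summable_nat_rpow.2 (by linarith))
  refine Summable.of_nat_of_neg ?_ ?_ <;>
  · refine h.congr fun n => ?_
    simp [add_comm]

/-- The series `∑ (|k| + |l|) ^ (-β)` over the lattice `ℤ^r × ℤ` converges for `β > r + 1`. -/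
lemma summable_lattice {β : ℝ} (hβ : (r : ℝ) + 1 < β) :
    Summable fun z : (Fin r → ℤ) × ℤ => (1 + (l1 z.1 + |(z.2 : ℝ)|)) ^ (-β) := by
  have hr : (0 : ℝ) < r + 1 := by positivity
  set γ := β / (r + 1) with hγ
  have hγ1 : 1 < γ := by rwa [hγ, one_lt_div hr]
  have hs := summable_one_add_abs_rpow hγ1
  have h0 : ∀ m : ℤ, 0 ≤ (1 + |(m : ℝ)|) ^ (-γ) := fun m => by positivity
  have hprod : Summable fun k : Fin r → ℤ => ∏ j, (1 + |(k j : ℝ)|) ^ (-γ) :=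
    summable_of_sum_le (fun k => Finset.prod_nonneg fun j _ => h0 _)
      fun S => sum_prod_le_tsum_pow hs h0 S
  refine Summable.of_nonneg_of_le (fun z => ?_) (fun z => ?_)
    (hprod.mul_of_nonneg hs (fun k => Finset.prod_nonneg fun j _ => h0 _) h0)
  · have := l1_nonneg z.1
    positivity
  · obtain ⟨k, l⟩ := z
    have hl1 := l1_nonneg k
    set N := 1 + (l1 k + |(l : ℝ)|) with hN
    have hN1 : 0 < N := by positivity
    have hle : ∀ x : ℝ, 0 ≤ x → x ≤ l1 k + |(l : ℝ)| → N ^ (-γ) ≤ (1 + x) ^ (-γ) := fun x hx hxN =>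
      Real.rpow_le_rpow_of_nonpos (by positivity) (by linarith) (by linarith)
    have e1 : N ^ (-β) = (∏ _j : Fin r, N ^ (-γ)) * N ^ (-γ) := by
      rw [Finset.prod_const, Finset.card_fin, ← pow_succ, ← Real.rpow_natCast,
        ← Real.rpow_mul hN1.le]
      congr 1
      rw [hγ]
      push_cast
      field_simp
    simp only
    rw [e1]
    refine mul_le_mul (Finset.prod_le_prod (fun j _ => by positivity) fun j _ => ?_) ?_
      (by positivity) (Finset.prod_nonneg fun j _ => h0 _)
    · refine hle _ (abs_nonneg _) ?_
      have : |(k j : ℝ)| ≤ l1 k := Finset.single_le_sum (f := fun j => |(k j : ℝ)|)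
        (fun _ _ => abs_nonneg _) (Finset.mem_univ j)
      have := abs_nonneg (l : ℝ)
      linarith
    · exact hle _ (abs_nonneg _) (by linarith)

/-- The resonance zone of `(k, l)` within `(0, μ)` is empty unless `|k| + |l|` is large, and its
measure is small compared with `μ`. -/
lemma volume_resonance_le {α τ : ℝ} (hα : 0 < α) (hτ : 0 < τ) (hω : IsDiophantine ω α τ)
    {μ : ℝ} (hμ : 0 < μ) {k : Fin r → ℤ} (hk : k ≠ 0) (l : ℤ) :
    volume {x | x ∈ Set.Ioo 0 μ ∧
      |pairing k ω + (l : ℝ) * x| < (α / 2) / (l1 k + |(l : ℝ)|) ^ (5 * τ + 4)} ≤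
    ENNReal.ofReal (μ * (if μ * (l1 k + |(l : ℝ)|) ^ (1 + τ) > α / 2 then
      2 * (l1 k + |(l : ℝ)|) ^ (-(4 * τ + 3)) else 0)) := by
  have hk1 := one_le_l1 hk
  have hl0 := abs_nonneg (l : ℝ)
  set N := l1 k + |(l : ℝ)| with hN
  have hN1 : 1 ≤ N := by linarith
  have hN0 : 0 < N := by linarith
  have hdio := hω k hk
  have hkτ : 0 < l1 k ^ τ := Real.rpow_pos_of_pos (by linarith) _
  have hNq : l1 k ^ τ ≤ N ^ (5 * τ + 4) :=
    (Real.rpow_le_rpow (by linarith) (by linarith) hτ.le).trans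
      (Real.rpow_le_rpow_of_exponent_le hN1 (by linarith))
  have hNq0 : 0 < N ^ (5 * τ + 4) := Real.rpow_pos_of_pos hN0 _
  by_cases hbig : |(l : ℝ)| * μ ≤ α / 2 / l1 k ^ τ
  · -- far from resonance the zone is empty
    have : {x | x ∈ Set.Ioo 0 μ ∧ |pairing k ω + (l : ℝ) * x| < (α / 2) / N ^ (5 * τ + 4)} = ∅ := by
      refine Set.eq_empty_of_forall_notMem fun x hx => ?_
      obtain ⟨⟨hx0, hxμ⟩, hx2⟩ := hx
      have h1 : |(l : ℝ) * x| ≤ |(l : ℝ)| * μ := by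
        rw [abs_mul, abs_of_pos hx0]
        gcongr
      have h2 : (α / 2) / N ^ (5 * τ + 4) ≤ α / 2 / l1 k ^ τ := by gcongr
      have h3 := abs_sub_abs_le_abs_sub (pairing k ω) (-((l : ℝ) * x))
      rw [abs_neg, sub_neg_eq_add] at h3
      have h4 : α / l1 k ^ τ = α / 2 / l1 k ^ τ + α / 2 / l1 k ^ τ := by ring
      linarith
    rw [this, measure_empty]
    exact zero_le
  · push Not at hbig
    have hl : (l : ℝ) ≠ 0 := fun h => by
      rw [h, abs_zero, zero_mul] at hbig
      have : 0 < α / 2 / l1 k ^ τ := by positivity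
      linarith
    have hl1 : 1 ≤ |(l : ℝ)| := by
      have : l ≠ 0 := by exact_mod_cast hl
      exact_mod_cast Int.one_le_abs this
    have hcond : μ * N ^ (1 + τ) > α / 2 := by
      rw [div_lt_iff₀ hkτ] at hbig
      refine hbig.trans_le ?_
      rw [Real.rpow_add hN0, Real.rpow_one, mul_comm |(l : ℝ)|, mul_assoc]
      have : l1 k ^ τ ≤ N ^ τ := Real.rpow_le_rpow (by linarith) (by linarith) hτ.le
      gcongr
      linarith
    rw [if_pos hcond]
    have hsub : {x | x ∈ Set.Ioo 0 μ ∧ |pairing k ω + (l : ℝ) * x| < (α / 2) / N ^ (5 * τ + 4)} ⊆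
        Metric.ball (-(pairing k ω) / l) ((α / 2) / N ^ (5 * τ + 4)) := by
      rintro x ⟨-, hx⟩
      rw [Metric.mem_ball, Real.dist_eq]
      have h1 : pairing k ω + (l : ℝ) * x = l * (x - -(pairing k ω) / l) := by field_simp; ring
      rw [h1, abs_mul] at hx
      refine lt_of_le_of_lt ?_ hx
      exact le_mul_of_one_le_left (abs_nonneg _) hl1
    refine (measure_mono hsub).trans ?_
    rw [Real.volume_ball]
    refine ENNReal.ofReal_le_ofReal ?_
    have e1 : N ^ (-(4 * τ + 3)) = N ^ (1 + τ) / N ^ (5 * τ + 4) := by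
      rw [← Real.rpow_sub hN0]
      congr 1
      ring
    rw [e1]
    calc 2 * (α / 2 / N ^ (5 * τ + 4)) = 2 * (α / 2) / N ^ (5 * τ + 4) := by ring
      _ ≤ 2 * (μ * N ^ (1 + τ)) / N ^ (5 * τ + 4) := by gcongr
      _ = _ := by ring

lemma volume_image_le_of_lipschitzOn {f : ℝ → ℝ} {s : Set ℝ} {K : NNReal}
    (h : LipschitzOnWith K f s) : volume (f '' s) ≤ K * volume s := by
  have := h.hausdorffMeasure_image_le (d := 1) zero_le_one
  simpa [hausdorffMeasure_real] using this

/-- The complement of `goodSet` has density zero at `0`: the resonance zones are summed, and only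
those with `|k| + |l|` large contribute to a short interval. -/
theorem exists_density_bound {α τ : ℝ} (hr : 1 ≤ r) (hα : 0 < α) (hτ : (r : ℝ) - 1 < τ)
    (hω : IsDiophantine ω α τ) :
    ∃ h : ℝ → ℝ, Tendsto h (𝓝[>] 0) (𝓝 0) ∧ ∀ m, 0 < m →
      volume (Set.Ioo 0 m \ goodSet ω α (5 * τ + 4)) ≤ ENNReal.ofReal (m * h m) := by
  have hr1 : (1 : ℝ) ≤ r := by exact_mod_cast hr
  have hτ0 : 0 < τ := by linarith
  set T : ℝ → (Fin r → ℤ) × ℤ → ℝ := fun μ z =>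
    if z.1 = 0 then 0 else if μ * (l1 z.1 + |(z.2 : ℝ)|) ^ (1 + τ) > α / 2 then
      2 * (l1 z.1 + |(z.2 : ℝ)|) ^ (-(4 * τ + 3)) else 0 with hT
  set bd : (Fin r → ℤ) × ℤ → ℝ := fun z =>
    2 * 2 ^ (4 * τ + 3) * (1 + (l1 z.1 + |(z.2 : ℝ)|)) ^ (-(4 * τ + 3)) with hbd
  have hbds : Summable bd := (summable_lattice (by linarith)).mul_left _
  have hT0 : ∀ μ z, 0 ≤ T μ z := fun μ z => by
    have := l1_nonneg z.1
    simp only [hT]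
    split_ifs <;> positivity
  have hTb : ∀ μ z, T μ z ≤ bd z := fun μ z => by
    have h0 := l1_nonneg z.1
    have hb0 : 0 ≤ bd z := by simp only [hbd]; positivity
    by_cases hk : z.1 = 0
    · simpa [hT, hk] using hb0
    · have h1 := one_le_l1 hk
      have h2 := abs_nonneg (z.2 : ℝ)
      set N := l1 z.1 + |(z.2 : ℝ)| with hN
      have hN1 : 1 ≤ N := by linarith
      simp only [hT, hk, if_false]
      split_ifs
      · simp only [hbd]
        have h3 : (2 * N) ^ (-(4 * τ + 3)) ≤ (1 + N) ^ (-(4 * τ + 3)) :=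
          Real.rpow_le_rpow_of_nonpos (by linarith) (by linarith) (by linarith)
        rw [Real.mul_rpow (by norm_num) (by linarith)] at h3
        have h4 : (2 : ℝ) ^ (4 * τ + 3) * 2 ^ (-(4 * τ + 3)) = 1 := by
          rw [← Real.rpow_add (by norm_num), add_neg_cancel, Real.rpow_zero]
        calc 2 * N ^ (-(4 * τ + 3)) =
              2 * 2 ^ (4 * τ + 3) * (2 ^ (-(4 * τ + 3)) * N ^ (-(4 * τ + 3))) := by
              linear_combination (-(2 * N ^ (-(4 * τ + 3)))) * h4
          _ ≤ _ := by gcongr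
      · exact hb0
  have hTs : ∀ μ, Summable (T μ) := fun μ => Summable.of_nonneg_of_le (hT0 μ) (hTb μ) hbds
  have hlim : Tendsto (fun μ => ∑' z, T μ z) (𝓝[>] 0) (𝓝 0) := by
    have := tendsto_tsum_of_dominated_convergence (f := T) (g := fun _ => (0 : ℝ)) (𝓕 := 𝓝[>] 0)
      hbds (fun z => ?_) (Eventually.of_forall fun μ z => by
        rw [Real.norm_of_nonneg (hT0 μ z)]
        exact hTb μ z)
    · simpa using this
    · refine tendsto_const_nhds.congr' ?_
      have hc : Tendsto (fun μ : ℝ => μ * (l1 z.1 + |(z.2 : ℝ)|) ^ (1 + τ)) (𝓝[>] 0) (𝓝 0) := by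
        have : Tendsto (fun μ : ℝ => μ * (l1 z.1 + |(z.2 : ℝ)|) ^ (1 + τ)) (𝓝 0) (𝓝 (0 * _)) :=
          tendsto_id.mul_const _
        rw [zero_mul] at this
        exact this.mono_left nhdsWithin_le_nhds
      filter_upwards [hc.eventually (gt_mem_nhds (by positivity : (0 : ℝ) < α / 2))] with μ hμ
      simp only [hT]
      rw [if_neg (not_lt.2 hμ.le), ite_self]
  -- the estimate in the variable `x = √m`
  have hroot : ∀ μ, 0 < μ → volume {x | x ∈ Set.Ioo 0 μ ∧ x ^ 2 ∉ goodSet ω α (5 * τ + 4)} ≤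
      ENNReal.ofReal (μ * ∑' z, T μ z) := fun μ hμ => by
    have hsub : {x | x ∈ Set.Ioo 0 μ ∧ x ^ 2 ∉ goodSet ω α (5 * τ + 4)} ⊆
        ⋃ z : (Fin r → ℤ) × ℤ, {x | z.1 ≠ 0 ∧ x ∈ Set.Ioo 0 μ ∧
          |pairing z.1 ω + (z.2 : ℝ) * x| < (α / 2) / (l1 z.1 + |(z.2 : ℝ)|) ^ (5 * τ + 4)} := by
      rintro x ⟨hx, hx2⟩
      simp only [goodSet, Set.mem_ofPred_eq, not_forall, not_le] at hx2
      obtain ⟨k, l, hk, hlt⟩ := hx2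
      rw [Real.sqrt_sq hx.1.le] at hlt
      exact Set.mem_iUnion.2 ⟨(k, l), hk, hx, hlt⟩
    refine (measure_mono hsub).trans ((measure_iUnion_le _).trans ?_)
    rw [← tsum_mul_left, ENNReal.ofReal_tsum_of_nonneg (fun z => mul_nonneg hμ.le (hT0 μ z))
      ((hTs μ).mul_left μ)]
    refine ENNReal.tsum_le_tsum fun z => ?_
    by_cases hk : z.1 = 0
    · simp [hk]
    · refine le_trans (measure_mono fun x hx => hx.2) ((volume_resonance_le hα hτ0 hω hμ hk z.2).trans
        (le_of_eq ?_))
      simp only [hT, hk, if_false]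
  refine ⟨fun m => 2 * ∑' z, T (√m) z, ?_, fun m hm => ?_⟩
  · have hs : Tendsto (fun m : ℝ => √m) (𝓝[>] 0) (𝓝[>] 0) := by
      refine tendsto_nhdsWithin_iff.2 ⟨?_, ?_⟩
      · have := (Real.continuous_sqrt.tendsto 0).mono_left (nhdsWithin_le_nhds (s := Set.Ioi 0))
        rwa [Real.sqrt_zero] at this
      · filter_upwards [self_mem_nhdsWithin] with m hm using Real.sqrt_pos.2 hm
    simpa using (hlim.comp hs).const_mul 2
  · have hμ : 0 < √m := Real.sqrt_pos.2 hm
    set μ := √m with hμdef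
    have hμ2 : μ * μ = m := Real.mul_self_sqrt hm.le
    set S := {x | x ∈ Set.Ioo 0 μ ∧ x ^ 2 ∉ goodSet ω α (5 * τ + 4)} with hS
    have hsub : Set.Ioo 0 m \ goodSet ω α (5 * τ + 4) ⊆ (fun x : ℝ => x ^ 2) '' S := by
      rintro y ⟨hy, hyg⟩
      refine ⟨√y, ⟨⟨Real.sqrt_pos.2 hy.1, Real.sqrt_lt_sqrt hy.1.le hy.2⟩, ?_⟩,
        Real.sq_sqrt hy.1.le⟩
      rwa [Real.sq_sqrt hy.1.le]
    have hlip : LipschitzOnWith (Real.toNNReal (2 * μ)) (fun x : ℝ => x ^ 2) S := by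
      refine LipschitzOnWith.of_dist_le_mul fun x hx y hy => ?_
      rw [Real.coe_toNNReal _ (by positivity), Real.dist_eq, Real.dist_eq]
      have h1 : x ^ 2 - y ^ 2 = (x + y) * (x - y) := by ring
      have h2 := hx.1
      have h3 := hy.1
      rw [h1, abs_mul, abs_of_pos (by linarith [h2.1, h3.1])]
      gcongr
      linarith [h2.2, h3.2]
    refine (measure_mono hsub).trans ((volume_image_le_of_lipschitzOn hlip).trans ?_)
    refine (mul_le_mul_right (hroot μ hμ) _).trans (le_of_eq ?_)
    rw [← ENNReal.ofReal.eq_1, ← ENNReal.ofReal_mul (by positivity)]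
    congr 1
    change 2 * μ * (μ * ∑' z, T μ z) = m * (2 * ∑' z, T μ z)
    linear_combination (2 * ∑' z, T μ z) * hμ2

end

section

variable {r : ℕ} {ω : Fin r → ℝ}

/-! ### The set of good parameters -/

/-- Transport of a set with full density at `0` along a parameter map `e` that is a Lipschitz
perturbation of `m ↦ m / ā`. The perturbation, extended by `0` at the origin, extends to a
Lipschitz function on the line, so that `e` becomes a bi-Lipschitz bijection near `0`. -/
lemma containsMostSmall_image {G : Set ℝ} (hG : IsClosed G) {h e : ℝ → ℝ}
    (hh : Tendsto h (𝓝[>] 0) (𝓝 0))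
    (hvol : ∀ m > 0, volume (Set.Ioo 0 m \ G) ≤ ENNReal.ofReal (m * h m)) {abar m₀ : ℝ}
    (habar : 0 < abar) (hm₀ : 0 < m₀)
    (he : ∀ m ∈ G ∩ Set.Ioc 0 m₀, |m - abar * e m| ≤ m / 2)
    (hlip : ∀ m ∈ G ∩ Set.Ioc 0 m₀, ∀ m' ∈ G ∩ Set.Ioc 0 m₀,
      |e m - e m' - (m - m') / abar| ≤ |m - m'| / (2 * abar)) :
    ContainsMostSmall (e '' (G ∩ Set.Ioc 0 m₀)) := by
  set M := G ∩ Set.Ioc 0 m₀ with hM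
  set K : ℝ := 1 / (2 * abar) with hK
  have hK0 : 0 < K := by positivity
  set f : ℝ → ℝ := fun m => if m = 0 then 0 else e m - m / abar with hf
  have hf0 : f 0 = 0 := by simp [hf]
  have hfM : ∀ m ∈ M, f m = e m - m / abar := fun m hm => by simp [hf, hm.2.1.ne']
  have hfzero : ∀ m ∈ M, |f m| ≤ K * |m| := by
    intro m hm
    have h1 : f m = -(m - abar * e m) / abar := by
      rw [hfM m hm]
      field_simp
      ring
    rw [h1, abs_div, abs_neg, abs_of_pos habar, div_le_iff₀ habar, abs_of_pos hm.2.1, hK]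
    refine (he m hm).trans (le_of_eq ?_)
    field_simp
  have hflip : LipschitzOnWith K.toNNReal f (insert 0 M) := by
    refine LipschitzOnWith.of_dist_le_mul fun x hx y hy => ?_
    rw [Real.coe_toNNReal _ hK0.le, Real.dist_eq, Real.dist_eq]
    rcases hx with rfl | hx <;> rcases hy with rfl | hy
    · simp
    · simpa [hf0] using hfzero y hy
    · simpa [hf0] using hfzero x hx
    · have h1 : f x - f y = e x - e y - (x - y) / abar := by rw [hfM x hx, hfM y hy]; ring
      rw [h1]
      refine (hlip x hx y hy).trans (le_of_eq ?_)
      rw [hK]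
      ring
  obtain ⟨F, hF, hFf⟩ := hflip.extend_real
  have hFd : ∀ x y, |F x - F y| ≤ K * |x - y| := fun x y => by
    have := hF.dist_le_mul x y
    rwa [Real.coe_toNNReal _ hK0.le, Real.dist_eq, Real.dist_eq] at this
  set g : ℝ → ℝ := fun m => 2 * K * m + F m with hg
  have hg0 : g 0 = 0 := by simp [hg, ← hFf (Set.mem_insert _ _), hf0]
  have hge : ∀ m ∈ M, g m = e m := fun m hm => by
    simp only [hg, ← hFf (Set.mem_insert_of_mem _ hm), hfM m hm, hK]
    field_simp
    ring
  have hmono : ∀ x y, x < y → K * (y - x) ≤ g y - g x := fun x y hxy => by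
    have h1 := hFd y x
    rw [abs_of_pos (sub_pos.2 hxy)] at h1
    have h2 := neg_le_of_abs_le h1
    simp only [hg]
    linarith
  have hstrict : StrictMono g := fun x y hxy => by
    have := hmono x y hxy
    have : 0 < K * (y - x) := mul_pos hK0 (sub_pos.2 hxy)
    linarith
  have hgpos : ∀ m, 0 < m → K * m ≤ g m := fun m hm => by
    simpa [hg0] using hmono 0 m hm
  have hglip : LipschitzWith (3 * K).toNNReal g := by
    refine LipschitzWith.of_dist_le_mul fun x y => ?_
    rw [Real.coe_toNNReal _ (by positivity), Real.dist_eq, Real.dist_eq]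
    have h1 : g x - g y = 2 * K * (x - y) + (F x - F y) := by simp only [hg]; ring
    rw [h1]
    refine (abs_add_le _ _).trans ?_
    rw [abs_mul, abs_of_pos (by positivity : 0 < 2 * K)]
    linarith [hFd x y]
  have himg : e '' M = g '' M := Set.image_congr fun m hm => (hge m hm).symm
  rw [himg]
  refine ⟨?_, ?_, ?_⟩
  · exact (hG.measurableSet.inter measurableSet_Ioc).image_of_continuousOn_injOn
      hglip.continuous.continuousOn hstrict.injective.injOn
  · rintro _ ⟨m, hm, rfl⟩
    exact (mul_pos hK0 hm.2.1).trans_le (hgpos m hm.2.1)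
  · have hscale : Tendsto (fun ε₀ : ℝ => ε₀ / K) (𝓝[>] 0) (𝓝[>] 0) := by
      refine tendsto_nhdsWithin_iff.2 ⟨?_, ?_⟩
      · have := ((continuous_id.div_const K).tendsto 0).mono_left
          (nhdsWithin_le_nhds (s := Set.Ioi (0 : ℝ)))
        simpa using this
      · filter_upwards [self_mem_nhdsWithin] with x hx using div_pos hx hK0
    have hbound : Tendsto (fun ε₀ : ℝ => ENNReal.ofReal (3 * h (ε₀ / K))) (𝓝[>] 0) (𝓝 0) := by
      have := ENNReal.tendsto_ofReal ((hh.comp hscale).const_mul 3)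
      simpa using this
    refine tendsto_of_tendsto_of_tendsto_of_le_of_le' tendsto_const_nhds hbound
      (Eventually.of_forall fun _ => zero_le) ?_
    have hsmall : ∀ᶠ ε₀ : ℝ in 𝓝[>] 0, ε₀ < K * m₀ :=
      mem_nhdsWithin_of_mem_nhds (Iio_mem_nhds (by positivity))
    filter_upwards [self_mem_nhdsWithin, hsmall] with ε₀ hε₀ hε₁
    have hε₀' : 0 < ε₀ := hε₀
    have hpos : 0 < ε₀ / K := div_pos hε₀' hK0
    have hsub : Set.Ioo 0 ε₀ \ g '' M ⊆ g '' (Set.Ioo 0 (ε₀ / K) \ G) := by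
      rintro y ⟨hy, hyM⟩
      have hend : ε₀ ≤ g (ε₀ / K) := by
        have := hgpos _ hpos
        rwa [mul_div_cancel₀ _ hK0.ne'] at this
      obtain ⟨m, hm, rfl⟩ := intermediate_value_Ioo hpos.le hglip.continuous.continuousOn
        (⟨by rw [hg0]; exact hy.1, hy.2.trans_le hend⟩ : y ∈ Set.Ioo (g 0) (g (ε₀ / K)))
      refine ⟨m, ⟨hm, fun hmG => hyM ⟨m, ⟨hmG, hm.1, hm.2.le.trans ?_⟩, rfl⟩⟩, rfl⟩
      rw [div_le_iff₀ hK0]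
      linarith
    refine ENNReal.div_le_of_le_mul ?_
    refine (measure_mono hsub).trans ((volume_image_le_of_lipschitzOn hglip.lipschitzOnWith).trans ?_)
    refine (mul_le_mul_right (hvol _ hpos) _).trans (le_of_eq ?_)
    rw [← ENNReal.ofReal.eq_1, ← ENNReal.ofReal_mul (by positivity), mul_comm (ENNReal.ofReal _),
      ← ENNReal.ofReal_mul hε₀'.le]
    congr 1
    field_simp

/-- The mean of a quasi-periodic function is the zeroth coefficient of its Fourier series. -/
lemma coeff_zero_eq_average (hω : ∀ k : Fin r → ℤ, k ≠ 0 → pairing k ω ≠ 0)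
    {c : (Fin r → ℤ) → ℂ} {M : ℝ} (hc : SumBound 0 M c) {a : ℝ → ℝ}
    (hac : ∀ t, (a t : ℂ) = ev ω c t) {abar : ℝ} (hmean : IsAverage a abar) : c 0 = abar := by
  refine tendsto_nhds_unique (tendsto_average_ev hω hc) ?_
  have h1 := (Complex.continuous_ofReal.tendsto abar).comp hmean
  refine h1.congr fun T => ?_
  simp only [Function.comp_apply, ← hac, intervalIntegral.integral_ofReal, Complex.ofReal_mul]

lemma IsDiophantine.divisorBound {α τ : ℝ} (hα : 0 < α) (hτ : 0 < τ) (hω : IsDiophantine ω α τ) :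
    DivisorBound ω 0 (2 / α) ⌈5 * τ + 4⌉₊ := by
  intro k hk
  have hl := one_le_l1 hk
  have h1 := hω k hk
  have hpos : 0 < l1 k ^ τ := by positivity
  have hle : l1 k ^ τ ≤ (l1 k + 2) ^ ⌈5 * τ + 4⌉₊ := by
    rw [← Real.rpow_natCast]
    refine (Real.rpow_le_rpow (by linarith) (by linarith : l1 k ≤ l1 k + 2) hτ.le).trans ?_
    exact Real.rpow_le_rpow_of_exponent_le (by linarith)
      (le_trans (by linarith) (Nat.le_ceil _))
  rw [div_le_iff₀ hpos] at h1
  have h2 : α ≤ |pairing k ω| * (l1 k + 2) ^ ⌈5 * τ + 4⌉₊ :=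
    h1.trans (mul_le_mul_of_nonneg_left hle (abs_nonneg _))
  rw [add_zero, mul_assoc, div_mul_eq_mul_div, le_div_iff₀ hα]
  linarith [mul_comm |pairing k ω| ((l1 k + 2) ^ ⌈5 * τ + 4⌉₊)]

lemma divisorBound_of_mem_goodSet {α q m : ℝ} (hα : 0 < α) (hm : m ∈ goodSet ω α q) :
    DivisorBound ω (2 * √m) (2 / α) ⌈q⌉₊ := by
  intro k hk
  have hl := one_le_l1 hk
  have h1 := hm k 2 hk
  have habs : |((2 : ℤ) : ℝ)| = 2 := by norm_num
  rw [habs] at h1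
  have hpos : 0 < (l1 k + 2) ^ q := by positivity
  have hle : (l1 k + 2) ^ q ≤ (l1 k + 2) ^ ⌈q⌉₊ := by
    rw [← Real.rpow_natCast]
    exact Real.rpow_le_rpow_of_exponent_le (by linarith) (Nat.le_ceil _)
  rw [div_le_iff₀ hpos] at h1
  push_cast at h1
  have h2 : α / 2 ≤ |pairing k ω + 2 * √m| * (l1 k + 2) ^ ⌈q⌉₊ :=
    h1.trans (mul_le_mul_of_nonneg_left hle (abs_nonneg _))
  rw [mul_assoc, div_mul_eq_mul_div, le_div_iff₀ hα]
  linarith [mul_comm |pairing k ω + 2 * √m| ((l1 k + 2) ^ ⌈q⌉₊)]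

end

end QPHill

theorem theorem4p3 (r : ℕ) (hr : 1 ≤ r) (ρ : ℝ) (hρ : 0 < ρ) (ω : Fin r → ℝ)
    (a : ℝ → ℝ) (ha : QPHill.IsAnalyticQuasiPeriodicOn ρ ω a)
    (abar : ℝ) (hmean : QPHill.IsAverage a abar) (habar : 0 < abar)
    (α τ : ℝ) (hα : 0 < α) (hτ : (r : ℝ) - 1 < τ) (hω : QPHill.IsDiophantine ω α τ) :
    ∃ (E : Set ℝ) (b : ℝ → ℝ) (C : ℝ),
      QPHill.ContainsMostSmall E ∧
      ∀ ε ∈ E,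
        0 < b ε ∧
        |b ε - abar * ε| ≤ C * ε ^ 2 ∧
        (∀ (k : Fin r → ℤ) (l : ℤ), k ≠ 0 →
          (α / 2) / (QPHill.l1 k + |(l : ℝ)|) ^ (5 * τ + 4) ≤
            |QPHill.pairing k ω + (l : ℝ) * √(b ε)|) ∧
        ∀ x : ℝ → ℝ, QPHill.IsHillSolution a ε x →
          ∃ ρ' : ℝ, 0 < ρ' ∧
            QPHill.IsAnalyticQuasiPeriodicOn ρ'
              (Fin.snoc (α := fun _ => ℝ) ω (√(b ε)) : Fin (r + 1) → ℝ) x := by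
  have hτ0 : 0 < τ := by
    have : (1 : ℝ) ≤ r := by exact_mod_cast hr
    linarith
  obtain ⟨F, hF, hper, haF⟩ := ha
  obtain ⟨c, s, A, hs, hs1, hc, hFc⟩ := QPHill.exists_fourier_series hr hρ hF hper
  have hac : ∀ t, (a t : ℂ) = QPHill.ev ω c t := fun t => (haF t).trans (hFc ω t)
  have h0 := hω.divisorBound hα hτ0
  have hc0 : c 0 = abar := QPHill.coeff_zero_eq_average
    (fun k hk => by simpa using h0.ne_zero hk) (hc.mono_width hs.le) hac hmean
  obtain ⟨lam₀, C, U, e, hlam₀, hU, hlip⟩ := QPHill.exists_real_floquet hs hs1 hc hc0 habar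
    (fun t => by rw [← hac, Complex.conj_ofReal]) (by positivity) h0
  obtain ⟨h, hh, hvol⟩ := QPHill.exists_density_bound hr hα hτ hω
  set G := QPHill.goodSet ω α (5 * τ + 4) with hG
  -- the solutions are parametrised by `m = λ²`, where `b = m` when `ε = e (√m)`
  have hsqrt : ∀ m ∈ G ∩ Set.Ioc 0 (lam₀ ^ 2), 0 < √m ∧ √m ≤ lam₀ ∧ √m ^ 2 = m ∧
      QPHill.DivisorBound ω (2 * √m) (2 / α) ⌈5 * τ + 4⌉₊ := fun m hm =>
    ⟨Real.sqrt_pos.2 hm.2.1, Real.sqrt_le_iff.2 ⟨hlam₀.le, hm.2.2⟩, Real.sq_sqrt hm.2.1.le,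
      QPHill.divisorBound_of_mem_goodSet hα hm.1⟩
  refine ⟨(fun m => e √m) '' (G ∩ Set.Ioc 0 (lam₀ ^ 2)),
    Function.invFunOn (fun m => e √m) (G ∩ Set.Ioc 0 (lam₀ ^ 2)), C, ?_, fun ε hε => ?_⟩
  · refine QPHill.containsMostSmall_image (QPHill.isClosed_goodSet ω α _) hh hvol habar
      (pow_pos hlam₀ 2) (fun m hm => ?_) fun m hm m' hm' => ?_
    · obtain ⟨h1, h2, h3, h4⟩ := hsqrt m hm
      have := (hU _ h1 h2 h4).2.2.2
      rwa [h3] at this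
    · obtain ⟨h1, h2, h3, h4⟩ := hsqrt m hm
      obtain ⟨h1', h2', h3', h4'⟩ := hsqrt m' hm'
      have := hlip _ _ h1 h2 h4 h1' h2' h4'
      rwa [h3, h3'] at this
  · have hmem := Function.invFunOn_mem hε
    have heq := Function.invFunOn_eq hε
    set m := Function.invFunOn (fun m => e √m) (G ∩ Set.Ioc 0 (lam₀ ^ 2)) ε
    obtain ⟨h1, h2, h3, h4⟩ := hsqrt m hmem
    obtain ⟨hfl, -, hC, -⟩ := hU _ h1 h2 h4
    have heq' : e √m = ε := heq
    rw [heq'] at hfl hC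
    rw [h3] at hC
    exact ⟨hmem.2.1, hC, hmem.1, fun x hx => ⟨s / 2 / 2, by positivity,
      hfl.isAnalyticQuasiPeriodicOn (by positivity) h1 hac hx⟩⟩
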